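/- Let $n\ge 2$ and let $\mathbb S^n=(\mathbb R^{n+1}\setminus\{0\})/\mathbb R_{>0}$ be the real projective sphere. Convex means: convex subset of an open hemisphere (an affine subspace); properly convex means in addition that the closure lies in an open hemisphere. For a vertex $v$ and a set $A$, $\{v\}*A$ is the union of the segments from $v$ to points of $A$. Let $M=\tilde M/\Gamma$ be a convex real projective $n$-orbifold: $\tilde M\subset\mathbb S^n$ is a convex domain with nonempty interior, possibly with smooth boundary, and $\Gamma\subset \mathrm{SL}_\pm(n+1,\mathbb R)$ preserves $\tilde M$ and acts properly discontinuously on it. Assume that $M$ is strongly tame: outside a compact set it is a disjoint union of end neighborhoods homeomorphic to closed $(n-1)$-orbifolds times open intervals. An end neighborhood is a component of the complement of a compact set that lies in no compact set; a proper p-end neighborhood is an open component in $\tilde M$ of the inverse image of an end neighborhood homeomorphic to a closed $(n-1)$-orbifold times an open interval. A p-end $\tilde E$ is given by a decreasing sequence of proper p-end neighborhoods that leaves every compact subset of $M$; its p-end fundamental group $\Gamma_{\tilde E}\subset\Gamma$ is the stabilizer of these neighborhoods. A p-end neighborhood of $\tilde E$ is a $\Gamma_{\tilde E}$-invariant open subset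 of $\mathbb S^n$ contained in $\tilde M$ that contains a member of the sequence. Let $\tilde E$ be a p-R-end with p-end vertex $v$: it has a proper p-end neighborhood $\Gamma_{\tilde E}$-equivariantly homeomorphic to $X\times(0,1)$, with $X/\Gamma_{\tilde E}$ a closed $(n-1)$-orbifold, in which the sets $\{x\}\times(0,1)$ are open projective geodesics ending at $v$ as $t\to0$, and each member of the sequence defining $\tilde E$ contains $X\times(0,\varepsilon)$ for some $\varepsilon>0$. Let $\tilde\Sigma_{\tilde E}$ be the set of directions at $v$ of these geodesics. Assume that $\Gamma_{\tilde E}$ is admissible: the closure of $\tilde\Sigma_{\tilde E}$ is a strict join $K_1*\cdots*K_k$ of compact properly convex, strictly convex sets (points allowed), and some finite-index subgroup of $\Gamma_{\tilde E}$ is an internal direct product $\Gamma_1\times\cdots\times\Gamma_k$ where $\Gamma_i$ preserves $K_i$, acts trivially on $K_j$ for $j\ne i$, and $K_i^o/\Gamma_i$ is compact. Suppose that 1. $\Gamma_{\tilde E}$ is generated by elements of finite order, or is generated by elements having $v$ as fixed point with eigenvalue $1$; and 2. there is a $\Gamma_{\tilde E}$-invariant totally geodesic properly convex $(n-1)$-dimensional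 domain $D$ (a convex set spanning a hyperspace) contained in a p-end neighborhood of $\tilde E$, with $v\notin\overline D$. Then $\tilde E$ is lens-shaped: there is a $\Gamma_{\tilde E}$-invariant $n$-dimensional convex domain $L$ (a lens), whose manifold boundary $L\setminus L^o$ is the disjoint union of two smooth strictly convex embedded open $(n-1)$-cells $\partial_+L$ and $\partial_-L$, such that $v\notin\overline L$, the cone $\{v\}*L$ is properly convex and equals $\{v\}*\partial_+L$, every segment from $v$ to a point of $\partial_+L$ meets $\partial_-L$ in exactly one point, $\{v\}*L\setminus\{v\}\subset\tilde M$, and the interior of $\{v\}*L$ is a p-end neighborhood of $\tilde E$. -/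

import Mathlib

open Set Filter Topology
open scoped Pointwise ContDiff

/-! ### The projective sphere, cones and convexity -/

/-- The space of rays of a real topological vector space `M` carries the quotient topology
from `M ∖ {0}`. -/
instance rayVectorTopology {M : Type*} [Zero M] [TopologicalSpace M] :
    TopologicalSpace (RayVector ℝ M) :=
  inferInstanceAs (TopologicalSpace {v : M // v ≠ 0})

instance rayTopology {M : Type*} [AddCommGroup M] [Module ℝ M] [TopologicalSpace M] :
    TopologicalSpace (Module.Ray ℝ M) :=
  inferInstanceAs (TopologicalSpace (Quotient (RayVector.Setoid ℝ M)))

/-- The vector space `ℝ^{n+1}`. -/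
abbrev Vec (n : ℕ) : Type := EuclideanSpace ℝ (Fin (n + 1))

/-- The real projective sphere `𝕊ⁿ = (ℝ^{n+1} ∖ {0}) / ℝ_{>0}`. Linear automorphisms of `ℝ^{n+1}`
act on it. -/
abbrev ProjSphere (n : ℕ) : Type := Module.Ray ℝ (Vec n)

/-- Linear automorphisms of `ℝ^{n+1}`; those with determinant `±1` make up `Aut(𝕊ⁿ)`. -/
abbrev LinAut (n : ℕ) : Type := Vec n ≃ₗ[ℝ] Vec n

/-- The cone in `ℝ^{n+1} ∖ {0}` over a subset of the projective sphere. -/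
def cone {n : ℕ} (A : Set (ProjSphere n)) : Set (Vec n) :=
  {x | ∃ hx : x ≠ 0, rayOfNeZero ℝ x hx ∈ A}

/-- A convex subset of the projective sphere: a convex subset of an affine subspace
(an open hemisphere `φ > 0`). -/
def IsConvexSubset {n : ℕ} (A : Set (ProjSphere n)) : Prop :=
  Convex ℝ (cone A) ∧ ∃ φ : Vec n →ₗ[ℝ] ℝ, ∀ x ∈ cone A, 0 < φ x

/-- A properly convex subset of the projective sphere: a convex set whose (compact) closure lies
in an affine subspace. -/
def IsProperlyConvexSubset {n : ℕ} (A : Set (ProjSphere n)) : Prop :=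
  Convex ℝ (cone A) ∧ ∃ φ : Vec n →ₗ[ℝ] ℝ, ∀ x ∈ cone (closure A), 0 < φ x

/-- The open segment between two points of the projective sphere that are not antipodal. -/
def openSeg {n : ℕ} (p x : ProjSphere n) : Set (ProjSphere n) :=
  {y | ∃ u ∈ cone {p}, ∃ w ∈ cone {x}, u + w ∈ cone {y}}

/-- The closed segment between two points of the projective sphere that are not antipodal. -/
def closedSeg {n : ℕ} (p x : ProjSphere n) : Set (ProjSphere n) :=
  insert p (insert x (openSeg p x))

/-- The cone `{p} * A` over `A` with vertex `p`: the union of all segments from `p` to points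
of `A`. -/
def coneOver {n : ℕ} (p : ProjSphere n) (A : Set (ProjSphere n)) : Set (ProjSphere n) :=
  ⋃ x ∈ A, closedSeg p x

/-- Near the point `y`, the set `A` is a smooth domain with boundary, and `y` is on the boundary:
near a vector over `y`, the cone over `A` is `{f ≤ 0}` for a smooth `f` without critical point. -/
def SmoothBoundaryAt {n : ℕ} (A : Set (ProjSphere n)) (y : ProjSphere n) : Prop :=
  ∃ v ∈ cone {y}, ∃ (N : Set (Vec n)) (f : Vec n → ℝ), IsOpen N ∧ v ∈ N ∧ ContDiffOn ℝ ∞ f N ∧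
    f v = 0 ∧ fderiv ℝ f v ≠ 0 ∧ ∀ x ∈ N, (x ∈ cone A ↔ f x ≤ 0)

/-- Near the point `y`, the set `A` is a smooth domain whose boundary is a strictly convex
hypersurface through `y`: the defining function has positive Hessian on the tangent space of the
hypersurface. (As `f` cuts out a cone in `ℝ^{n+1}`, the radial direction is always a null
direction of the Hessian; it disappears in an affine chart.) -/
def SmoothStrictlyConvexBoundaryAt {n : ℕ} (A : Set (ProjSphere n)) (y : ProjSphere n) : Prop :=
  ∃ v ∈ cone {y}, ∃ (N : Set (Vec n)) (f : Vec n → ℝ), IsOpen N ∧ v ∈ N ∧ ContDiffOn ℝ ∞ f N ∧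
    f v = 0 ∧ fderiv ℝ f v ≠ 0 ∧ (∀ x ∈ N, (x ∈ cone A ↔ f x ≤ 0)) ∧
    ∀ w : Vec n, fderiv ℝ f v w = 0 → w ∉ Submodule.span ℝ {v} →
      0 < fderiv ℝ (fderiv ℝ f) v w w

/-! ### Convex real projective orbifolds -/

/-- A convex real projective `n`-orbifold `M = dom / grp`, given by its developed universal cover
`dom`, a convex domain in `𝕊ⁿ`, possibly with smooth boundary, and its deck transformation group
`grp`, a group of projective automorphisms of `𝕊ⁿ` acting properly discontinuously on `dom`. -/
structure ConvexProjOrbifold (n : ℕ) where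
  dom : Set (ProjSphere n)
  grp : Subgroup (LinAut n)
  convex : IsConvexSubset dom
  interior_nonempty : (interior dom).Nonempty
  boundary_smooth : ∀ y ∈ dom, y ∉ interior dom → SmoothBoundaryAt dom y
  det_eq : ∀ g ∈ grp, |LinearMap.det (g : Vec n →ₗ[ℝ] Vec n)| = 1
  invariant : ∀ g ∈ grp, g • dom = dom
  properlyDiscontinuous : ∀ K ⊆ dom, IsCompact K →
    {g : LinAut n | g ∈ grp ∧ ((g • K) ∩ K).Nonempty}.Finite

/-- A product structure `W ≅ X × (0,1)`, equivariant for the group `G` acting on `W`, where `X` is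
an `(n-1)`-manifold with a cocompact action of `G` (trivial on the interval). When `G` acts
properly discontinuously on `W` this says that the orbifold `W / G` is homeomorphic to
the closed `(n-1)`-orbifold `X / G` times an open interval. -/
structure ProductStructure {n : ℕ} (G : Subgroup (LinAut n)) (W : Set (ProjSphere n)) where
  X : Type
  [topX : TopologicalSpace X]
  [chartedX : ChartedSpace (EuclideanSpace ℝ (Fin (n - 1))) X]
  [actX : MulAction G X]
  cocompact : ∃ C : Set X, IsCompact C ∧ ∀ x : X, ∃ g : G, g • x ∈ C
  homeo : W ≃ₜ X × Ioo (0 : ℝ) 1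
  equivariant : ∀ (g : G) (w w' : W), (w' : ProjSphere n) = (g : LinAut n) • (w : ProjSphere n) →
    homeo w' = (g • (homeo w).1, (homeo w).2)

attribute [instance] ProductStructure.topX ProductStructure.chartedX ProductStructure.actX

namespace ConvexProjOrbifold

variable {n : ℕ} (O : ConvexProjOrbifold n)

/-- The projection of `𝕊ⁿ` to its space of orbits. -/
def proj (x : ProjSphere n) : MulAction.orbitRel.Quotient O.grp (ProjSphere n) :=
  Quotient.mk _ x

instance : TopologicalSpace (MulAction.orbitRel.Quotient O.grp (ProjSphere n)) :=
  inferInstanceAs (TopologicalSpace (Quotient (MulAction.orbitRel O.grp (ProjSphere n))))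

/-- The underlying space of the orbifold: the image of `dom` in the space of orbits. -/
def space : Set (MulAction.orbitRel.Quotient O.grp (ProjSphere n)) := O.proj '' O.dom

/-- The group of deck transformations that preserve `W`. -/
def stab (W : Set (ProjSphere n)) : Subgroup (LinAut n) :=
  O.grp ⊓ MulAction.stabilizer (LinAut n) W

/-- `U` is a component of the complement of a compact subset `K` of the orbifold. -/
def IsComplComponent (K U : Set (MulAction.orbitRel.Quotient O.grp (ProjSphere n))) : Prop :=
  ∃ x ∈ O.space \ K, U = connectedComponentIn (O.space \ K) x

/-- `U` is an end neighborhood: a component of the complement of a compact subset that is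
not contained in any compact subset. -/
def IsEndNhd (U : Set (MulAction.orbitRel.Quotient O.grp (ProjSphere n))) : Prop :=
  (∃ K ⊆ O.space, IsCompact K ∧ O.IsComplComponent K U) ∧
    ∀ C ⊆ O.space, IsCompact C → ¬ U ⊆ C

/-- `W` is a component of the inverse image of `U` in the universal cover. -/
def IsLift (U : Set (MulAction.orbitRel.Quotient O.grp (ProjSphere n)))
    (W : Set (ProjSphere n)) : Prop :=
  ∃ x ∈ O.dom ∩ O.proj ⁻¹' U, W = connectedComponentIn (O.dom ∩ O.proj ⁻¹' U) x

/-- `W` is a proper p-end neighborhood: a component of the inverse image of an end neighborhood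
that is homeomorphic to a closed `(n-1)`-orbifold times an open interval. -/
def IsProperPEndNhd (W : Set (ProjSphere n)) : Prop :=
  IsOpen W ∧ (∃ U, O.IsEndNhd U ∧ O.IsLift U W) ∧ Nonempty (ProductStructure (O.stab W) W)

/-- Strong tameness: outside some compact subset, the orbifold is a disjoint union of end
neighborhoods homeomorphic to closed `(n-1)`-orbifolds times open intervals. -/
def IsStronglyTame : Prop :=
  ∃ K ⊆ O.space, IsCompact K ∧ ∀ U, O.IsComplComponent K U →
    O.IsEndNhd U ∧ ∀ W, O.IsLift U W → O.IsProperPEndNhd W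

/-- A p-end of the universal cover, given by a p-end sequence, that is, an exiting decreasing
sequence of proper p-end neighborhoods. -/
structure PEnd where
  nhd : ℕ → Set (ProjSphere n)
  antitone : Antitone nhd
  proper : ∀ i, O.IsProperPEndNhd (nhd i)
  exiting : ∀ K ⊆ O.space, IsCompact K → {i | (nhd i ∩ O.proj ⁻¹' K).Nonempty}.Finite

variable {O}

/-- The p-end fundamental group (as a holonomy group). -/
def PEnd.grp (E : O.PEnd) : Subgroup (LinAut n) := O.stab (E.nhd 0)

/-- `W` is a p-end neighborhood of `E`: an open subset of the universal cover, invariant under the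
p-end fundamental group, that contains a proper p-end neighborhood of `E`. -/
def PEnd.IsNhd (E : O.PEnd) (W : Set (ProjSphere n)) : Prop :=
  IsOpen W ∧ W ⊆ O.dom ∧ (∀ g ∈ E.grp, g • W = W) ∧ ∃ i, E.nhd i ⊆ W

variable (O)

/-- A p-R-end (radial p-end): a p-end with a p-end vertex `vertex` and a proper p-end neighborhood
`rad ≅ X × (0,1)` whose leaves `{x} × (0,1)` are open projective geodesics ending at the vertex
as `t → 0`, where `t → 0` is the direction of the end. The leaf space `X` is the universal
cover of the end orbifold, the closed orbifold `X / π₁(E)`. -/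
structure PREnd extends O.PEnd where
  vertex : ProjSphere n
  rad : Set (ProjSphere n)
  rad_proper : O.IsProperPEndNhd rad
  nhd_subset_rad : ∃ i, nhd i ⊆ rad
  prod : ProductStructure (O.stab rad) rad
  leaf_radial : ∀ (x : prod.X) (t : Ioo (0 : ℝ) 1),
    (fun s => (prod.homeo.symm (x, s) : ProjSphere n)) '' Iio t =
      openSeg vertex (prod.homeo.symm (x, t) : ProjSphere n)
  leaf_toEnd : ∀ i, ∃ ε : ℝ, 0 < ε ∧ ∀ w : rad,
    ((prod.homeo w).2 : ℝ) < ε → (w : ProjSphere n) ∈ nhd i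

variable {O}

namespace PREnd

variable (E : O.PREnd)

/-- The line in `ℝ^{n+1}` over the p-end vertex `v`. The linking sphere `𝕊^{n-1}_v` of
directions at `v` is the projective sphere of `ℝ^{n+1} ⧸ E.line`. -/
def line : Submodule ℝ (Vec n) := Submodule.span ℝ (cone {E.vertex})

/-- The open cone in `ℝ^{n+1} ⧸ E.line` over the domain `Σ̃_E` of the linking sphere that consists
of the directions of the radial leaves. -/
def dirCone : Set (Vec n ⧸ E.line) := E.line.mkQ '' cone E.rad

/-- Admissibility of the p-end fundamental group: the closure of `Σ̃_E` is a strict join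
`K_1 * ⋯ * K_k` of strictly convex, properly convex compact sets (or points) `K_i`, with cones
`C i` in independent subspaces `S i`, and a subgroup of finite index is an internal direct product
`G 1 × ⋯ × G k`, where `G i` acts on `K_i` with compact quotient `K_iᵒ / G i` and trivially on
`K_j` for `j ≠ i`. -/
def Admissible : Prop :=
  ∃ (k : ℕ) (S : Fin k → Submodule ℝ (Vec n ⧸ E.line)) (C : Fin k → Set (Vec n ⧸ E.line))
    (G : Fin k → Subgroup (LinAut n)),
    -- the strict join decomposition
    DirectSum.IsInternal S ∧ (∀ i, S i ≠ ⊥) ∧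
    (∀ i, Submodule.span ℝ (C i) = S i ∧ IsClosed (C i) ∧ Convex ℝ (C i) ∧
      (∀ x ∈ C i, ∀ t : ℝ, 0 ≤ t → t • x ∈ C i) ∧
      (∀ x ∈ C i, -x ∈ C i → x = 0) ∧
      (∀ x ∈ C i, ∀ y ∈ C i, ¬ SameRay ℝ x y → x + y ∈ intrinsicInterior ℝ (C i))) ∧
    closure E.dirCone = {x | ∃ c : Fin k → Vec n ⧸ E.line, (∀ i, c i ∈ C i) ∧ x = ∑ i, c i} ∧
    -- the virtual direct product decomposition
    (∀ i j, i ≠ j → ∀ g ∈ G i, ∀ h ∈ G j, g * h = h * g) ∧ iSupIndep G ∧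
    (⨆ i, G i) ≤ E.toPEnd.grp ∧ (⨆ i, G i).relIndex E.toPEnd.grp ≠ 0 ∧
    -- the actions on the factors
    (∀ i, ∀ g ∈ G i, ∀ x : Vec n, E.line.mkQ (g x) ∈ C i ↔ E.line.mkQ x ∈ C i) ∧
    (∀ i j, j ≠ i → ∀ g ∈ G i, ∃ c : ℝ, 0 < c ∧ ∀ x : Vec n, E.line.mkQ x ∈ S j →
      E.line.mkQ (g x) = c • E.line.mkQ x) ∧
    (∀ i, ∃ F ⊆ intrinsicInterior ℝ (C i), IsCompact F ∧ ∀ x : Vec n,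
      E.line.mkQ x ∈ intrinsicInterior ℝ (C i) →
        ∃ g ∈ G i, ∃ t : ℝ, 0 < t ∧ t • E.line.mkQ (g x) ∈ F)

end PREnd

end ConvexProjOrbifold

/-! ### Lenses and lens-cones -/

/-- `L` is a lens with boundary components `Lp` and `Lm`: an `n`-dimensional convex domain whose
manifold boundary is the disjoint union of two smooth strictly convex embedded open
`(n-1)`-cells. -/
def IsLens {n : ℕ} (L Lp Lm : Set (ProjSphere n)) : Prop :=
  IsConvexSubset L ∧ (interior L).Nonempty ∧ Disjoint Lp Lm ∧ Lp ∪ Lm = L \ interior L ∧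
  Nonempty (Lp ≃ₜ EuclideanSpace ℝ (Fin (n - 1))) ∧
  Nonempty (Lm ≃ₜ EuclideanSpace ℝ (Fin (n - 1))) ∧
  ∀ y ∈ L \ interior L, SmoothStrictlyConvexBoundaryAt L y

/-- `{p} * L` is a lens-cone over the lens `L` with top `Lp` and bottom `Lm`. -/
def IsLensCone {n : ℕ} (p : ProjSphere n) (L Lp Lm : Set (ProjSphere n)) : Prop :=
  IsLens L Lp Lm ∧ p ∉ closure L ∧ IsProperlyConvexSubset (coneOver p L) ∧
  coneOver p L = coneOver p Lp ∧ ∀ x ∈ Lp, ∃! y, y ∈ closedSeg p x ∧ y ∈ Lm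

/-- The p-R-end is lens-shaped: it has a p-end neighborhood that is a lens-cone with vertex the
p-end vertex, over a lens on which the p-end fundamental group acts. (The lens-cone without its
vertex lies in the universal cover and its interior is the open p-end neighborhood.) -/
def ConvexProjOrbifold.PREnd.IsLensShaped {n : ℕ} {O : ConvexProjOrbifold n} (E : O.PREnd) :
    Prop :=
  ∃ L Lp Lm : Set (ProjSphere n), IsLensCone E.vertex L Lp Lm ∧
    coneOver E.vertex L \ {E.vertex} ⊆ O.dom ∧ E.toPEnd.IsNhd (interior (coneOver E.vertex L)) ∧
    ∀ g ∈ E.toPEnd.grp, g • L = L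

/-- A totally geodesic convex domain of dimension `n - 1`: a convex set spanning a hyperspace. -/
def IsTotallyGeodesicHyperdomain {n : ℕ} (D : Set (ProjSphere n)) : Prop :=
  IsConvexSubset D ∧ Module.finrank ℝ (Submodule.span ℝ (cone D)) = n

/-! Write Γ for the p-end group, `vec` for a vector over the vertex, and Ω for `dirCone`, the open
cone of leaf directions in the quotient of ℝ^{n+1} by `line`.

An element of Γ permutes the radial leaves and preserves their heights, which forces it to scale
`vec` by a positive number (`exists_apply_vec`). Either generation hypothesis makes this number 1
(`apply_vec`). Hence Γ acts on the quotient with determinant ±1. It preserves Ω, and acts there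
properly and, modulo scalars, cocompactly. Admissibility makes the closure of Ω a pointed closed
convex cone; cocompactness then gives that Ω is its interior (`IsCocompact.eq_interior_closure`).

Let H be the hyperplane spanned by the cone over D. If `vec` is not in H, then ℝ^{n+1} is the
invariant direct sum of the line and H, with an invariant coordinate `s` along the line. A cocompact
action leaves no smaller invariant closed cone meeting Ω (`IsCocompact.closure_subset`), so D
projects onto all of Ω, and the copy of Ω in H lies in the interior of the domain
(`exists_isSplitting`). Let f be the Koszul-Vinberg characteristic function of the closure of Ω and
F = f^(-1/n). F is invariant, homogeneous of degree one and superadditive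
(`IsClosedCone.exists_coneFunction`). The lens is {|s| ≤ εF}. Superadditivity makes it convex and
the positive Hessian of f makes its boundary strictly convex. The vertex lies on the side s > 0, so
the lens-cone is {s ≥ -εF} together with the vertex, and the top is {s = -εF}. Cocompactness puts
the cone without its vertex into the domain for small ε (`exists_region_subset`). It contains a
member of the end sequence because such a member is connected and far out it avoids the top
(`exists_nhd_subset_region`); this needs every direction of the interior of the domain to lie in Ω
(`mkQ_mem_dirCone_of_interior`).

The main obstacle is to exclude `vec` ∈ H (`vec_notMem_span`). In that case H is the kernel of an
eigenfunctional φ on the quotient, positive on Ω. By strict convexity of the join factors, the face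
of the closure of Ω in ker φ spans ker φ (`IsJoinAction.ker_le_span`): otherwise two group elements
would contract towards different points of one factor, and conjugating their commutator would
contradict properness (`IsJoinAction.fixed_eq`). Let multiples of g_j ∈ Γ push a compact part of Ω
to a relatively interior point y of that face. These maps stay uniformly invertible on ker φ
(`IsCocompact.exists_tendsto_boundary`). Since the closure of D misses the vertex, the fibres of D
along the line are bounded above. The images of a fibre's upper end under the g_j stay in a compact
part of the domain, so only finitely many g_j occur, and y would lie in Ω, where φ is positive. -/

section Sphere

/-! ### Cones over subsets of the projective sphere, and its topology. -/

variable {n : ℕ}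

theorem smul_mem_cone {A : Set (ProjSphere n)} {x : Vec n} (hx : x ∈ cone A) {t : ℝ} (ht : 0 < t) :
    t • x ∈ cone A := by
  obtain ⟨h0, hA⟩ := hx
  have h1 : t • x ≠ 0 := smul_ne_zero ht.ne' h0
  refine ⟨h1, ?_⟩
  rwa [ray_pos_smul h0 ht h1]

theorem smul_mem_cone_iff {A : Set (ProjSphere n)} {x : Vec n} {t : ℝ} (ht : 0 < t) :
    t • x ∈ cone A ↔ x ∈ cone A := by
  refine ⟨fun h => ?_, fun h => smul_mem_cone h ht⟩
  have := smul_mem_cone h (inv_pos.2 ht)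
  rwa [smul_smul, inv_mul_cancel₀ ht.ne', one_smul] at this

theorem cone_mono {A B : Set (ProjSphere n)} (h : A ⊆ B) : cone A ⊆ cone B :=
  fun _ hx => ⟨hx.1, h hx.2⟩

theorem exists_mem_cone (p : ProjSphere n) : ∃ x, x ∈ cone {p} := by
  induction p using Module.Ray.ind with
  | h v hv => exact ⟨v, hv, rfl⟩

theorem mem_cone_of_mem {A : Set (ProjSphere n)} {p : ProjSphere n} (hp : p ∈ A) {x : Vec n}
    (hx : x ∈ cone {p}) : x ∈ cone A :=
  cone_mono (singleton_subset_iff.2 hp) hx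

theorem mem_of_mem_cone {A : Set (ProjSphere n)} {p : ProjSphere n} {x : Vec n}
    (hx : x ∈ cone {p}) (hA : x ∈ cone A) : p ∈ A := by
  obtain ⟨_, h⟩ := hx
  obtain ⟨_, h'⟩ := hA
  rw [mem_singleton_iff] at h
  rwa [h] at h'

theorem mem_iff_mem_cone {A : Set (ProjSphere n)} {p : ProjSphere n} {x : Vec n}
    (hx : x ∈ cone {p}) : p ∈ A ↔ x ∈ cone A :=
  ⟨fun h => mem_cone_of_mem h hx, mem_of_mem_cone hx⟩

theorem subset_of_cone_subset {A B : Set (ProjSphere n)} (h : cone A ⊆ cone B) : A ⊆ B := by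
  intro p hp
  obtain ⟨x, hx⟩ := exists_mem_cone p
  exact mem_of_mem_cone hx (h (mem_cone_of_mem hp hx))

theorem cone_injective {A B : Set (ProjSphere n)} (h : cone A = cone B) : A = B :=
  (subset_of_cone_subset h.subset).antisymm (subset_of_cone_subset h.symm.subset)

theorem mem_cone_singleton_iff {p : ProjSphere n} {x y : Vec n} (hx : x ∈ cone {p}) :
    y ∈ cone {p} ↔ ∃ t : ℝ, 0 < t ∧ y = t • x := by
  obtain ⟨hx0, hxp⟩ := hx
  rw [mem_singleton_iff] at hxp
  constructor
  · rintro ⟨hy0, hyp⟩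
    rw [mem_singleton_iff, ← hxp, ray_eq_iff] at hyp
    obtain ⟨t, ht, h⟩ := hyp.exists_pos_right hy0 hx0
    exact ⟨t, ht, h⟩
  · rintro ⟨t, ht, rfl⟩
    exact smul_mem_cone ⟨hx0, hxp⟩ ht

theorem cone_singleton_rayOfNeZero {x : Vec n} (hx : x ≠ 0) : x ∈ cone {rayOfNeZero ℝ x hx} :=
  ⟨hx, rfl⟩

/-- The set of rays through the points of a set of vectors. -/
def raysOf (S : Set (Vec n)) : Set (ProjSphere n) := {p | ∃ x ∈ cone {p}, x ∈ S}

theorem cone_raysOf {S : Set (Vec n)} (h0 : (0 : Vec n) ∉ S)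
    (hS : ∀ x ∈ S, ∀ t : ℝ, 0 < t → t • x ∈ S) : cone (raysOf S) = S := by
  ext x
  constructor
  · rintro ⟨hx, y, hy, hyS⟩
    obtain ⟨t, ht, h⟩ := (mem_cone_singleton_iff hy).1 (cone_singleton_rayOfNeZero hx)
    rw [h]
    exact hS y hyS t ht
  · intro hx
    have hx0 : x ≠ 0 := fun h => h0 (h ▸ hx)
    exact ⟨hx0, x, cone_singleton_rayOfNeZero hx0, hx⟩

theorem smul_mem_cone_smul (g : LinAut n) {A : Set (ProjSphere n)} {x : Vec n} :
    g x ∈ cone (g • A) ↔ x ∈ cone A := by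
  constructor
  · rintro ⟨h0, h⟩
    have hx : x ≠ 0 := fun h => h0 (by simp [h])
    refine ⟨hx, ?_⟩
    have : rayOfNeZero ℝ (g x) h0 = g • rayOfNeZero ℝ x hx := rfl
    rwa [this, Set.smul_mem_smul_set_iff] at h
  · rintro ⟨h0, h⟩
    refine ⟨g.map_ne_zero_iff.2 h0, ?_⟩
    exact Set.smul_mem_smul_set h

theorem apply_mem_cone_of_smul_eq {g : LinAut n} {A : Set (ProjSphere n)} (hg : g • A = A)
    {x : Vec n} : g x ∈ cone A ↔ x ∈ cone A := by
  conv_lhs => rw [← hg]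
  exact smul_mem_cone_smul g

theorem apply_mem_cone_singleton (g : LinAut n) {p : ProjSphere n} {x : Vec n} :
    g x ∈ cone {g • p} ↔ x ∈ cone {p} := by
  rw [← Set.smul_set_singleton]; exact smul_mem_cone_smul g

theorem continuous_rayOfNeZero :
    Continuous fun x : {x : Vec n // x ≠ 0} => (rayOfNeZero ℝ x.1 x.2 : ProjSphere n) :=
  continuous_quotient_mk' (s := RayVector.Setoid ℝ (Vec n))

theorem isQuotientMap_rayOfNeZero :
    IsQuotientMap fun x : {x : Vec n // x ≠ 0} => (rayOfNeZero ℝ x.1 x.2 : ProjSphere n) :=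
  isQuotientMap_quotient_mk' (s := RayVector.Setoid ℝ (Vec n))

theorem isOpen_iff_isOpen_cone {A : Set (ProjSphere n)} : IsOpen A ↔ IsOpen (cone A) := by
  have hne : IsOpen {x : Vec n | x ≠ 0} := isOpen_ne
  rw [← isQuotientMap_rayOfNeZero.isOpen_preimage,
    hne.isOpenEmbedding_subtypeVal.isOpen_iff_image_isOpen]
  congr! 1
  ext x
  constructor
  · rintro ⟨y, hy, rfl⟩; exact ⟨y.2, hy⟩
  · rintro ⟨h0, h⟩; exact ⟨⟨x, h0⟩, h, rfl⟩

theorem isOpen_raysOf {S : Set (Vec n)} (h0 : (0 : Vec n) ∉ S)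
    (hS : ∀ x ∈ S, ∀ t : ℝ, 0 < t → t • x ∈ S) (ho : IsOpen S) : IsOpen (raysOf S) := by
  rw [isOpen_iff_isOpen_cone, cone_raysOf h0 hS]; exact ho

theorem isOpen_cone {A : Set (ProjSphere n)} (h : IsOpen A) : IsOpen (cone A) :=
  isOpen_iff_isOpen_cone.1 h

/-- The interior of a cone is again invariant under positive scaling, so it is the cone over an open
set of rays. -/
theorem cone_interior (A : Set (ProjSphere n)) : cone (interior A) = interior (cone A) := by
  apply subset_antisymm
  · exact interior_maximal (cone_mono interior_subset) (isOpen_cone isOpen_interior)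
  · have h0 : (0 : Vec n) ∉ interior (cone A) := fun h => (interior_subset h).1 rfl
    have hS : ∀ x ∈ interior (cone A), ∀ t : ℝ, 0 < t → t • x ∈ interior (cone A) := by
      intro x hx t ht
      have : t • x ∈ t • interior (cone A) := Set.smul_mem_smul_set hx
      rw [← interior_smul₀ ht.ne'] at this
      refine interior_mono ?_ this
      rintro _ ⟨y, hy, rfl⟩
      exact smul_mem_cone hy ht
    rw [← cone_raysOf h0 hS]
    apply cone_mono
    apply interior_maximal _ (isOpen_raysOf h0 hS isOpen_interior)
    apply subset_of_cone_subset
    rw [cone_raysOf h0 hS]; exact interior_subset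

theorem cone_compl (A : Set (ProjSphere n)) : cone Aᶜ = (cone A)ᶜ \ {0} := by
  ext x
  constructor
  · rintro ⟨h0, h⟩
    exact ⟨fun h' => h h'.2, h0⟩
  · rintro ⟨h, h0⟩
    exact ⟨h0, fun h' => h ⟨h0, h'⟩⟩

/-- Complementary to `cone_interior`. The origin is limit of any nonempty cone but lies over no ray,
so it has to be taken out. -/
theorem cone_closure (A : Set (ProjSphere n)) : cone (closure A) = closure (cone A) \ {0} := by
  have h1 : closure A = (interior Aᶜ)ᶜ := by rw [interior_compl, compl_compl]
  have h2 : interior ((cone A)ᶜ \ {0}) = (closure (cone A))ᶜ ∩ {0}ᶜ := by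
    change interior ((cone A)ᶜ ∩ {0}ᶜ) = _
    rw [interior_inter, interior_compl, isOpen_compl_singleton.interior_eq]
  rw [h1, cone_compl, cone_interior, cone_compl, h2]
  ext x
  simp only [Set.mem_sdiff, mem_compl_iff, mem_inter_iff, mem_singleton_iff]
  tauto

/-- The unit vector on a ray. -/
noncomputable def unitVec (p : ProjSphere n) : Vec n := (‖p.someVector‖⁻¹) • p.someVector

theorem unitVec_mem (p : ProjSphere n) : unitVec p ∈ cone {p} := by
  have h := p.someVector_ne_zero
  refine smul_mem_cone ⟨h, ?_⟩ (inv_pos.2 (norm_pos_iff.2 h))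
  rw [Module.Ray.someVector_ray]; rfl

theorem norm_unitVec (p : ProjSphere n) : ‖unitVec p‖ = 1 := by
  have h := norm_pos_iff.2 p.someVector_ne_zero
  rw [unitVec, norm_smul, norm_inv, norm_norm, inv_mul_cancel₀ h.ne']

theorem unitVec_rayOfNeZero {x : Vec n} (hx : x ≠ 0) :
    unitVec (rayOfNeZero ℝ x hx) = ‖x‖⁻¹ • x := by
  obtain ⟨t, ht, h⟩ := (mem_cone_singleton_iff (cone_singleton_rayOfNeZero hx)).1
    (unitVec_mem (rayOfNeZero ℝ x hx))
  have h1 := norm_unitVec (rayOfNeZero ℝ x hx)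
  rw [h, norm_smul, Real.norm_of_nonneg ht.le] at h1
  rw [h, eq_inv_of_mul_eq_one_left h1]

theorem continuous_unitVec : Continuous (unitVec : ProjSphere n → Vec n) := by
  rw [isQuotientMap_rayOfNeZero.continuous_iff]
  have : (unitVec ∘ fun x : {x : Vec n // x ≠ 0} => (rayOfNeZero ℝ x.1 x.2 : ProjSphere n)) =
      fun x => ‖x.1‖⁻¹ • x.1 := by
    ext1 x; exact unitVec_rayOfNeZero x.2
  rw [this]
  exact (continuous_subtype_val.norm.inv₀ fun x => norm_ne_zero_iff.2 x.2).smul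
    continuous_subtype_val

/-- The projective sphere is homeomorphic to the unit sphere. -/
noncomputable def sphereHomeo (n : ℕ) : ProjSphere n ≃ₜ Metric.sphere (0 : Vec n) 1 where
  toFun p := ⟨unitVec p, by simp [norm_unitVec]⟩
  invFun x := rayOfNeZero ℝ x.1 (by
    have := x.2; intro h; simp [h] at this)
  left_inv p := (unitVec_mem p).2
  right_inv x := by
    apply Subtype.ext
    have : ‖x.1‖ = 1 := by simp
    change unitVec _ = _
    rw [unitVec_rayOfNeZero, this, inv_one, one_smul]
  continuous_toFun := continuous_unitVec.subtype_mk _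
  continuous_invFun := by
    have : Continuous fun x : Metric.sphere (0 : Vec n) 1 =>
        (⟨x.1, by have := x.2; intro h; simp [h] at this⟩ : {x : Vec n // x ≠ 0}) :=
      continuous_subtype_val.subtype_mk _
    exact continuous_rayOfNeZero.comp this

instance : T2Space (ProjSphere n) := (sphereHomeo n).symm.t2Space
instance : CompactSpace (ProjSphere n) := (sphereHomeo n).symm.compactSpace

theorem isCompact_raysOf {K : Set (Vec n)} (hK : IsCompact K) (h0 : (0 : Vec n) ∉ K) :
    IsCompact (raysOf K) := by
  have h1 : IsCompact ((↑) ⁻¹' K : Set {x : Vec n // x ≠ 0}) := by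
    rw [Subtype.isCompact_iff]
    convert hK using 1
    ext x
    constructor
    · rintro ⟨y, hy, rfl⟩; exact hy
    · exact fun h => ⟨⟨x, fun h' => h0 (h' ▸ h)⟩, h, rfl⟩
  convert h1.image continuous_rayOfNeZero using 1
  ext p
  constructor
  · rintro ⟨x, hx, hK⟩
    exact ⟨⟨x, hx.1⟩, hK, hx.2⟩
  · rintro ⟨x, hx, rfl⟩
    exact ⟨x, cone_singleton_rayOfNeZero x.2, hx⟩

theorem raysOf_subset {K : Set (Vec n)} {A : Set (ProjSphere n)} (h : K ⊆ cone A) :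
    raysOf K ⊆ A := fun _ ⟨_, hx, hK⟩ => mem_of_mem_cone hx (h hK)

end Sphere

theorem exists_ball_subset_of_isCompact {E : Type*} [SeminormedAddCommGroup E] {K U : Set E}
    (hK : IsCompact K) (hU : IsOpen U)
    (h : K ⊆ U) : ∃ δ > 0, ∀ x ∈ K, ∀ y, ‖y‖ ≤ δ → x + y ∈ U := by
  obtain ⟨δ, hδ, hsub⟩ := hK.exists_cthickening_subset_open hU h
  refine ⟨δ, hδ, fun x hx y hy => hsub ?_⟩
  exact Metric.mem_cthickening_of_dist_le _ x _ _ hx (by simpa using hy)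

/-! ### Pointed closed cones and cocompact families of automorphisms. -/

section Cones

variable {E : Type*} [NormedAddCommGroup E] [NormedSpace ℝ E]

/-- A closed convex cone with apex at the origin. -/
structure IsClosedCone (C : Set E) : Prop where
  isClosed : IsClosed C
  zero_mem : (0 : E) ∈ C
  add_mem : ∀ {x y}, x ∈ C → y ∈ C → x + y ∈ C
  smul_mem : ∀ {x} {t : ℝ}, 0 ≤ t → x ∈ C → t • x ∈ C

theorem IsClosedCone.convex {C : Set E} (hC : IsClosedCone C) : Convex ℝ C :=
  fun _ hx _ hy _ _ ha hb _ => hC.add_mem (hC.smul_mem ha hx) (hC.smul_mem hb hy)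

theorem IsClosedCone.exists_separating {C : Set E} (hC : IsClosedCone C) {x : E} (hx : x ∉ C) :
    ∃ f : E →L[ℝ] ℝ, (∀ y ∈ C, 0 ≤ f y) ∧ f x < 0 := by
  obtain ⟨f, u, hu, huv⟩ := geometric_hahn_banach_point_closed hC.convex hC.isClosed hx
  have hu0 : u < 0 := by simpa using huv 0 hC.zero_mem
  refine ⟨f, fun y hy => ?_, hu.trans hu0⟩
  by_contra! hneg
  have := huv ((u * (f y)⁻¹) • y) (hC.smul_mem (mul_pos_of_neg_of_neg hu0 (inv_neg''.2 hneg)).le hy)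
  rw [map_smul, smul_eq_mul, mul_assoc, inv_mul_cancel₀ hneg.ne, mul_one] at this
  exact lt_irrefl _ this

theorem IsClosedCone.smul_add_mem_interior {C : Set E} (hC : IsClosedCone C) {x y : E}
    (hx : x ∈ interior C) (hy : y ∈ C) : x + y ∈ interior C := by
  have h1 : IsOpen ((fun z => z + y) '' interior C) :=
    (Homeomorph.addRight y).isOpenMap _ isOpen_interior
  refine interior_maximal ?_ h1 ⟨x, hx, rfl⟩
  rintro _ ⟨z, hz, rfl⟩
  exact hC.add_mem (interior_subset hz) hy

theorem IsClosedCone.smul_mem_interior {C : Set E} (hC : IsClosedCone C) {x : E}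
    (hx : x ∈ interior C) {t : ℝ} (ht : 0 < t) : t • x ∈ interior C := by
  have : t • x ∈ t • interior C := Set.smul_mem_smul_set hx
  rw [← interior_smul₀ ht.ne'] at this
  refine interior_mono ?_ this
  rintro _ ⟨y, hy, rfl⟩
  exact hC.smul_mem ht.le hy

/-- A nonnegative functional on a cone that vanishes at an interior point vanishes. -/
theorem eq_zero_of_nonneg_of_interior {C : Set E} {f : E →L[ℝ] ℝ} (hf : ∀ y ∈ C, 0 ≤ f y)
    {x : E} (hx : x ∈ interior C) (h0 : f x = 0) : f = 0 := by
  obtain ⟨δ, hδ, hball⟩ := Metric.isOpen_iff.1 isOpen_interior x hx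
  ext w
  by_cases hw : w = 0
  · simp [hw]
  have hwn : 0 < ‖w‖ := norm_pos_iff.2 hw
  have key : ∀ s : ℝ, |s| * ‖w‖ < δ → 0 ≤ s * f w := by
    intro s hs
    have : x + s • w ∈ C := interior_subset (hball (by
      simp [norm_smul, hs]))
    have := hf _ this
    simpa [h0] using this
  have hs : |δ / (2 * ‖w‖)| * ‖w‖ < δ := by
    rw [abs_of_pos (by positivity)]
    field_simp; norm_num
  have h1 := key _ hs
  have h2 := key (-(δ / (2 * ‖w‖))) (by rwa [abs_neg])
  have : 0 < δ / (2 * ‖w‖) := by positivity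
  have h3 : δ / (2 * ‖w‖) * f w = 0 := le_antisymm (by linarith) h1
  simpa [this.ne'] using h3

theorem IsClosedCone.pos_of_mem_interior {C : Set E} {f : E →L[ℝ] ℝ}
    (hf : ∀ y ∈ C, 0 ≤ f y) (hf0 : f ≠ 0) {x : E} (hx : x ∈ interior C) : 0 < f x :=
  (hf x (interior_subset hx)).lt_of_ne fun h => hf0 (eq_zero_of_nonneg_of_interior hf hx h.symm)

/-- For a set closed under scaling, x = 2x - x is a difference of two of its points, so the
direction of the affine span already contains the linear span. -/
theorem exists_ball_of_mem_intrinsicInterior {C : Set E}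
    (hC : ∀ x ∈ C, ∀ t : ℝ, 0 < t → t • x ∈ C) {a : E} (ha : a ∈ intrinsicInterior ℝ C) :
    ∃ δ > 0, ∀ s ∈ Submodule.span ℝ C, ‖s‖ < δ → a + s ∈ C := by
  obtain ⟨y, hy, rfl⟩ := mem_intrinsicInterior.1 ha
  obtain ⟨δ, hδ, hball⟩ := Metric.isOpen_iff.1 isOpen_interior y hy
  refine ⟨δ, hδ, fun s hs hsδ => ?_⟩
  have hle : Submodule.span ℝ C ≤ vectorSpan ℝ C := by
    rw [Submodule.span_le]
    intro x hx
    have := vsub_mem_vectorSpan ℝ (hC x hx 2 two_pos) hx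
    rwa [vsub_eq_sub, two_smul, add_sub_cancel_right] at this
  have hmem : s +ᵥ (y : E) ∈ affineSpan ℝ C :=
    AffineSubspace.vadd_mem_of_mem_direction (by rw [direction_affineSpan]; exact hle hs) y.2
  have : (⟨s +ᵥ (y : E), hmem⟩ : affineSpan ℝ C) ∈ Metric.ball y δ := by
    rw [Metric.mem_ball, Subtype.dist_eq]
    simpa using hsδ
  have h1 := interior_subset (hball this)
  change s +ᵥ (y : E) ∈ C at h1
  rwa [vadd_eq_add, add_comm] at h1

theorem map_mem_closure_iff {T : E ≃L[ℝ] E} {Ω : Set E} (h : ∀ x, T x ∈ Ω ↔ x ∈ Ω) (x : E) :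
    T x ∈ closure Ω ↔ x ∈ closure Ω := by
  have : Ω = T ⁻¹' Ω := by ext x; exact (h x).symm
  conv_rhs => rw [this]
  exact iff_of_eq (congrArg (x ∈ ·) (T.toHomeomorph.preimage_closure Ω))

variable [FiniteDimensional ℝ E]

/-- On a pointed closed cone some linear functional dominates the norm. -/
theorem IsClosedCone.exists_norm_le {C : Set E} (hC : IsClosedCone C)
    (hp : ∀ x ∈ C, -x ∈ C → x = 0) : ∃ ψ : E →L[ℝ] ℝ, ∀ x ∈ C, ‖x‖ ≤ ψ x := by
  have : ProperSpace E := FiniteDimensional.proper ℝ E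
  set S := C ∩ Metric.sphere (0 : E) 1 with hS
  have hSc : IsCompact S := (isCompact_sphere _ _).inter_left hC.isClosed
  have h1 : ∀ x ∈ S, ∃ f : E →L[ℝ] ℝ, (∀ y ∈ C, 0 ≤ f y) ∧ 0 < f x := by
    rintro x ⟨hx, hx1⟩
    have : -x ∉ C := fun h => by
      have := hp x hx h
      simp [this] at hx1
    obtain ⟨f, hf, hfx⟩ := hC.exists_separating this
    exact ⟨f, hf, by simpa using hfx⟩
  choose! f hf hfx using h1
  obtain ⟨t, htS, hcov⟩ := hSc.elim_nhds_subcover (fun x => {y | 0 < f x y}) fun x hx =>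
    (isOpen_lt continuous_const (f x).continuous).mem_nhds (hfx x hx)
  set ψ : E →L[ℝ] ℝ := ∑ x ∈ t, f x with hψ
  have hpos : ∀ y ∈ S, 0 < ψ y := by
    intro y hy
    obtain ⟨x, hxt, hxy⟩ := mem_iUnion₂.1 (hcov hy)
    rw [hψ, _root_.sum_apply]
    exact Finset.sum_pos' (fun z hz => hf z (htS z hz) y hy.1) ⟨x, hxt, hxy⟩
  obtain ⟨c, hc, hcS⟩ : ∃ c > 0, ∀ y ∈ S, c ≤ ψ y := by
    rcases S.eq_empty_or_nonempty with h | h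
    · exact ⟨1, one_pos, by simp [h]⟩
    · obtain ⟨z, hz, hmin⟩ := hSc.exists_isMinOn h ψ.continuous.continuousOn
      exact ⟨ψ z, hpos z hz, fun y hy => hmin hy⟩
  refine ⟨c⁻¹ • ψ, fun x hx => ?_⟩
  by_cases hx0 : x = 0
  · simp [hx0]
  have hn : 0 < ‖x‖ := norm_pos_iff.2 hx0
  have := hcS (‖x‖⁻¹ • x) ⟨hC.smul_mem (inv_nonneg.2 hn.le) hx, by
    simp [norm_smul, hn.ne']⟩
  rw [map_smul, smul_eq_mul] at this
  rw [_root_.smul_apply, smul_eq_mul]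
  rw [inv_mul_eq_div, le_div_iff₀ hn] at this
  rw [inv_mul_eq_div, le_div_iff₀ hc]
  linarith

/-- Maps preserving a pointed cone that move some point of a compact part of the interior a
bounded amount are uniformly bounded. -/
theorem IsClosedCone.exists_norm_map_le {C : Set E} (hC : IsClosedCone C)
    (hp : ∀ x ∈ C, -x ∈ C → x = 0) {F : Set E} (hF : IsCompact F) (hFC : F ⊆ interior C) (R : ℝ) :
    ∃ M : ℝ, ∀ T : E →L[ℝ] E, (∀ x ∈ C, T x ∈ C) → (∃ f ∈ F, ‖T f‖ ≤ R) → ‖T‖ ≤ M := by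
  obtain ⟨ψ, hψ⟩ := hC.exists_norm_le hp
  obtain ⟨δ, hδ, hball⟩ := exists_ball_subset_of_isCompact hF isOpen_interior hFC
  refine ⟨max 0 ((2 * ‖ψ‖ * R + R) / δ), fun T hT ⟨f, hf, hR⟩ => ?_⟩
  have hR0 : 0 ≤ R := (norm_nonneg _).trans hR
  -- T(f + u) and T(f - u) both lie in the cone and add up to 2T f. As ψ is nonnegative there, each
  -- is controlled by ψ(T f).
  have key : ∀ u : E, ‖u‖ ≤ δ → ‖T u‖ ≤ 2 * ‖ψ‖ * R + R := by
    intro u hu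
    have h1 := hT _ (interior_subset (hball f hf u hu))
    have h2 := hT _ (interior_subset (hball f hf (-u) (by simpa using hu)))
    have h3 := hψ _ h1
    have h4 := (norm_nonneg _).trans (hψ _ h2)
    have h5 : ψ (T (f + u)) + ψ (T (f + -u)) = 2 * ψ (T f) := by
      simp only [map_add, map_neg]; ring
    have h6 : ψ (T f) ≤ ‖ψ‖ * R := (le_abs_self _).trans ((ψ.le_opNorm _).trans (by gcongr))
    have h7 : ‖T u‖ ≤ ‖T (f + u)‖ + ‖T f‖ := by
      have : T u = T (f + u) - T f := by simp
      rw [this]; exact norm_sub_le _ _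
    linarith
  refine T.opNorm_le_bound (le_max_left _ _) fun x => ?_
  by_cases hx : x = 0
  · simp [hx]
  have hn : 0 < ‖x‖ := norm_pos_iff.2 hx
  have := key ((δ / ‖x‖) • x) (by
    rw [norm_smul, Real.norm_of_nonneg (by positivity), div_mul_cancel₀ _ hn.ne'])
  rw [map_smul, norm_smul, Real.norm_of_nonneg (by positivity)] at this
  refine le_trans ?_ (mul_le_mul_of_nonneg_right (le_max_right _ _) hn.le)
  rw [div_mul_eq_mul_div, div_le_iff₀ hn] at this
  rw [div_mul_eq_mul_div, le_div_iff₀ hδ]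
  linarith

/-- A family `𝒯` of linear automorphisms of an open set `Ω`, such that every point of `Ω` is
the image of a point of a compact subset of `Ω` under an element of `𝒯`. -/
structure IsCocompact (𝒯 : Set (E ≃L[ℝ] E)) (Ω : Set E) : Prop where
  isOpen : IsOpen Ω
  map_iff : ∀ T ∈ 𝒯, ∀ x, T x ∈ Ω ↔ x ∈ Ω
  exists_compact : ∃ F ⊆ Ω, IsCompact F ∧ ∀ y ∈ Ω, ∃ T ∈ 𝒯, ∃ f ∈ F, T f = y

/-- This yields convexity of Ω, of which only the closure is assumed convex. A point y interior to
the closure is approximated by y' = T f in Ω so closely that εy' ± (y - y') stay in the closure.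
Pulled back by T, the difference is small compared with the distance from F to the complement of Ω,
so f plus the pulled-back difference is in Ω, and y with it. -/
theorem IsCocompact.eq_interior_closure {𝒯 : Set (E ≃L[ℝ] E)} {Ω : Set E} (h : IsCocompact 𝒯 Ω)
    (hC : IsClosedCone (closure Ω)) (hp : ∀ x ∈ closure Ω, -x ∈ closure Ω → x = 0) :
    Ω = interior (closure Ω) := by
  refine subset_antisymm (interior_maximal subset_closure h.isOpen) fun y hy => ?_
  obtain ⟨F, hFΩ, hF, hco⟩ := h.exists_compact
  obtain ⟨ψ, hψ⟩ := hC.exists_norm_le hp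
  obtain ⟨η, hη, hball⟩ := exists_ball_subset_of_isCompact hF h.isOpen hFΩ
  obtain ⟨B, hB⟩ := hF.isBounded.exists_norm_le
  obtain ⟨ε, hε, hεη⟩ : ∃ ε > 0, ε * (2 * ‖ψ‖ * |B| + |B|) ≤ η := by
    refine ⟨η / (2 * ‖ψ‖ * |B| + |B| + 1), by positivity, ?_⟩
    rw [div_mul_eq_mul_div, div_le_iff₀ (by positivity)]
    nlinarith [hη.le]
  have hev : ∀ᶠ y' in 𝓝 y, ε • y' + (y - y') ∈ closure Ω ∧ ε • y' - (y - y') ∈ closure Ω := by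
    have hyε : ε • y ∈ interior (closure Ω) := hC.smul_mem_interior hy hε
    have h1 : Tendsto (fun y' => ε • y' + (y - y')) (𝓝 y) (𝓝 (ε • y)) := by
      have : Continuous fun y' : E => ε • y' + (y - y') := by fun_prop
      simpa using this.tendsto y
    have h2 : Tendsto (fun y' => ε • y' - (y - y')) (𝓝 y) (𝓝 (ε • y)) := by
      have : Continuous fun y' : E => ε • y' - (y - y') := by fun_prop
      simpa using this.tendsto y
    have hn : closure Ω ∈ 𝓝 (ε • y) := mem_interior_iff_mem_nhds.1 hyε
    exact (h1.eventually hn).and (h2.eventually hn)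
  obtain ⟨y', hy', hy'Ω⟩ := (mem_closure_iff_frequently.1 (interior_subset hy)).and_eventually hev
    |>.exists
  obtain ⟨T, hT, f, hf, rfl⟩ := hco y' hy'
  set z := T.symm (y - T f) with hz
  have hTz : T z = y - T f := T.apply_symm_apply _
  have hm := map_mem_closure_iff (h.map_iff T hT)
  have h1 : ε • f + z ∈ closure Ω := by
    rw [← hm, map_add, map_smul, hTz]; exact hy'Ω.1
  have h2 : ε • f - z ∈ closure Ω := by
    rw [← hm, map_sub, map_smul, hTz]; exact hy'Ω.2
  have hfB : ‖f‖ ≤ |B| := (hB f hf).trans (le_abs_self B)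
  have hzn : ‖z‖ ≤ η := by
    have h3 := hψ _ h1
    have h4 := (norm_nonneg _).trans (hψ _ h2)
    have h5 : ψ (ε • f + z) + ψ (ε • f - z) = 2 * (ε * ψ f) := by
      simp only [map_add, map_sub, map_smul, smul_eq_mul]; ring
    have h6 : ψ f ≤ ‖ψ‖ * |B| := (le_abs_self _).trans ((ψ.le_opNorm _).trans (by gcongr))
    have h7 : ‖z‖ ≤ ‖ε • f + z‖ + ‖ε • f‖ := by
      have : z = (ε • f + z) - ε • f := by simp
      conv_lhs => rw [this]
      exact norm_sub_le _ _
    have h8 : ‖ε • f‖ ≤ ε * |B| := by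
      rw [norm_smul, Real.norm_of_nonneg hε.le]; gcongr
    have h9 : ε * ψ f ≤ ε * (‖ψ‖ * |B|) := by gcongr
    linarith
  have := (h.map_iff T hT _).2 (hball f hf z hzn)
  rwa [map_add, hTz, add_sub_cancel] at this

/-- The slice ψ = 1 is a compact base of the cone; m is the minimum of φ on it. -/
theorem IsClosedCone.exists_isMinOn_base {C : Set E} (hC : IsClosedCone C) {ψ : E →L[ℝ] ℝ}
    (hψ : ∀ x ∈ C, ‖x‖ ≤ ψ x) (φ : E →L[ℝ] ℝ) {q : E} (hq : q ∈ C) (hφq : φ q < 0) :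
    ∃ m < 0, ∃ z ∈ C, ψ z = 1 ∧ φ z = m ∧ ∀ x ∈ C, m * ψ x ≤ φ x := by
  have : ProperSpace E := FiniteDimensional.proper ℝ E
  set B := C ∩ {x | ψ x = 1} with hB
  have hBc : IsCompact B := by
    refine Metric.isCompact_of_isClosed_isBounded
      (hC.isClosed.inter (isClosed_eq ψ.continuous continuous_const)) ?_
    refine (Metric.isBounded_closedBall (x := (0 : E)) (r := 1)).subset fun x hx => ?_
    have := hψ x hx.1
    rw [hx.2] at this
    simpa using this
  have hpos : ∀ x ∈ C, x ≠ 0 → 0 < ψ x := fun x hx h0 => (norm_pos_iff.2 h0).trans_le (hψ x hx)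
  have hnorm : ∀ x ∈ C, x ≠ 0 → (ψ x)⁻¹ • x ∈ B := fun x hx h0 =>
    ⟨hC.smul_mem (inv_nonneg.2 (hpos x hx h0).le) hx, by
      simp [(hpos x hx h0).ne']⟩
  have hq0 : q ≠ 0 := fun h => by simp [h] at hφq
  obtain ⟨z, hz, hmin⟩ := hBc.exists_isMinOn ⟨_, hnorm q hq hq0⟩ φ.continuous.continuousOn
  have hle : ∀ x ∈ C, φ z * ψ x ≤ φ x := by
    intro x hx
    by_cases h0 : x = 0
    · simp [h0]
    have h1 : φ z ≤ φ ((ψ x)⁻¹ • x) := hmin (hnorm x hx h0)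
    rw [map_smul, smul_eq_mul, inv_mul_eq_div, le_div_iff₀ (hpos x hx h0)] at h1
    exact h1
  refine ⟨φ z, ?_, z, hz.1, hz.2, rfl, hle⟩
  have h1 := hle q hq
  have h2 := hpos q hq hq0
  by_contra! h3
  nlinarith [mul_nonneg h3 h2.le]

/-- A closed convex cone that is invariant under a cocompact family and meets `Ω` contains `Ω`. -/
theorem IsCocompact.closure_subset {𝒯 : Set (E ≃L[ℝ] E)} {Ω : Set E} (h : IsCocompact 𝒯 Ω)
    (hQ : IsClosedCone (closure Ω)) (hp : ∀ x ∈ closure Ω, -x ∈ closure Ω → x = 0)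
    {C : Set E} (hC : IsClosedCone C) (hCT : ∀ T ∈ 𝒯, ∀ x ∈ C, T x ∈ C)
    (hne : (C ∩ Ω).Nonempty) : closure Ω ⊆ C := by
  intro q hq
  by_contra hqC
  obtain ⟨c, hcC, hcΩ⟩ := hne
  obtain ⟨φ, hφ, hφq⟩ := hC.exists_separating hqC
  obtain ⟨ψ, hψ⟩ := hQ.exists_norm_le hp
  obtain ⟨m, hm, z, hzQ, hψz, hφz, hle⟩ := hQ.exists_isMinOn_base hψ φ hq hφq
  obtain ⟨F, hFΩ, hF, hco⟩ := h.exists_compact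
  have hΩ := h.eq_interior_closure hQ hp
  obtain ⟨δ₁, hδ₁, hb₁⟩ := exists_ball_subset_of_isCompact hF h.isOpen hFΩ
  obtain ⟨δ₂, hδ₂, hb₂⟩ := exists_ball_subset_of_isCompact (isCompact_singleton (x := c)) h.isOpen
    (singleton_subset_iff.2 hcΩ)
  obtain ⟨B, hB⟩ := hF.isBounded.exists_norm_le
  -- With this δ both f - δc and c - δf lie in Ω for every f ∈ F: c and the points of F are
  -- uniformly comparable in the order of the cone.
  obtain ⟨δ, hδ, hδc, hδf⟩ : ∃ δ > 0, δ * ‖c‖ ≤ δ₁ ∧ ∀ f ∈ F, δ * ‖f‖ ≤ δ₂ := by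
    refine ⟨min (δ₁ / (‖c‖ + 1)) (δ₂ / (|B| + 1)), by positivity, ?_, fun f hf => ?_⟩
    · refine (mul_le_mul_of_nonneg_right (min_le_left _ _) (norm_nonneg _)).trans ?_
      rw [div_mul_eq_mul_div, div_le_iff₀ (by positivity)]
      nlinarith [hδ₁.le]
    · refine (mul_le_mul_of_nonneg_right (min_le_right _ _) (norm_nonneg _)).trans ?_
      rw [div_mul_eq_mul_div, div_le_iff₀ (by positivity)]
      have : ‖f‖ ≤ |B| := (hB f hf).trans (le_abs_self B)
      nlinarith [hδ₂.le]
  -- Comparability is preserved by T, and φ(T c) ≥ 0 by invariance of C. Together they improve the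
  -- optimal bound φ ≥ mψ by the definite amount δ²(-m)ψ, which fails at the minimum point z.
  have key : ∀ x ∈ Ω, 0 ≤ φ x - m * ψ x - δ * (δ * (-m * ψ x)) := by
    intro x hx
    obtain ⟨T, hT, f, hf, rfl⟩ := hco x hx
    have hm' := map_mem_closure_iff (h.map_iff T hT)
    have h1 : T f - δ • T c ∈ closure Ω := by
      rw [← map_smul, ← map_sub, hm', sub_eq_add_neg]
      exact subset_closure (hb₁ f hf _ (by
        rwa [norm_neg, norm_smul, Real.norm_of_nonneg hδ.le]))
    have h2 : T c - δ • T f ∈ closure Ω := by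
      rw [← map_smul, ← map_sub, hm', sub_eq_add_neg]
      exact subset_closure (hb₂ c rfl _ (by
        rw [norm_neg, norm_smul, Real.norm_of_nonneg hδ.le]; exact hδf f hf))
    have h3 := hφ _ (hCT T hT c hcC)
    have h4 := hle _ h1
    have h5 := (norm_nonneg _).trans (hψ _ h2)
    simp only [map_sub, map_smul, smul_eq_mul] at h4 h5
    have h6 : δ * (δ * (-m * ψ (T f))) ≤ δ * (-m * ψ (T c)) := by
      refine mul_le_mul_of_nonneg_left ?_ hδ.le
      have := mul_le_mul_of_nonneg_left (sub_nonneg.1 h5) (neg_pos.2 hm).le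
      linarith
    have h7 : 0 ≤ δ * φ (T c) := mul_nonneg hδ.le h3
    linarith
  have hcl : closure Ω ⊆ {x | 0 ≤ φ x - m * ψ x - δ * (δ * (-m * ψ x))} :=
    closure_minimal key (isClosed_le continuous_const (by fun_prop))
  have := hcl hzQ
  simp only [mem_ofPred_eq, hψz, hφz, mul_one, sub_self, zero_sub] at this
  have h2 : 0 < δ * (δ * -m) := by
    have : 0 < -m := by linarith
    positivity
  linarith

/-- An eigenfunctional of a cocompact family does not vanish on `Ω`. -/
theorem IsCocompact.ne_zero_of_eigen {𝒯 : Set (E ≃L[ℝ] E)} {Ω : Set E} (h : IsCocompact 𝒯 Ω)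
    (hQ : IsClosedCone (closure Ω)) (hp : ∀ x ∈ closure Ω, -x ∈ closure Ω → x = 0)
    {φ : E →L[ℝ] ℝ} (hφ0 : φ ≠ 0) (hφ : ∀ T ∈ 𝒯, ∃ χ : ℝ, ∀ x, φ (T x) = χ * φ x) {x : E}
    (hx : x ∈ Ω) : φ x ≠ 0 := by
  intro h0
  have hC : IsClosedCone {x | φ x = 0} :=
    ⟨isClosed_eq φ.continuous continuous_const, map_zero φ, fun hx hy => by
      simp only [mem_ofPred_eq] at *; simp [hx, hy], fun _ hx => by
      simp only [mem_ofPred_eq] at *; simp [hx]⟩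
  have hsub := h.closure_subset hQ hp hC (fun T hT x hx => by
    obtain ⟨χ, hχ⟩ := hφ T hT
    simp only [mem_ofPred_eq] at *
    rw [hχ, hx, mul_zero]) ⟨x, h0, hx⟩
  exact hφ0 (eq_zero_of_nonneg_of_interior (C := closure Ω) (fun y hy => (hsub hy).ge)
    (h.eq_interior_closure hQ hp ▸ hx) h0)

end Cones

/-! ### Linear maps that contract the kernel of an invariant functional. -/

section Contraction

variable {E : Type*} [NormedAddCommGroup E] [NormedSpace ℝ E]

/-- `A` preserves the subspace `S` and the functional `φ` on it, and contracts `S ∩ ker φ`. -/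
structure ContractsKer (S : Submodule ℝ E) (φ : E →L[ℝ] ℝ) (ε : ℝ) (A : E →L[ℝ] E) : Prop where
  nonneg : 0 ≤ ε
  lt_one : ε < 1
  map_mem : ∀ x ∈ S, A x ∈ S
  map_apply : ∀ x ∈ S, φ (A x) = φ x
  norm_le : ∀ x ∈ S, φ x = 0 → ‖A x‖ ≤ ε * ‖x‖

namespace ContractsKer

variable {S : Submodule ℝ E} {φ : E →L[ℝ] ℝ} {ε : ℝ} {A : E →L[ℝ] E}

theorem iterate_mem (h : ContractsKer S φ ε A) (m : ℕ) {x : E} (hx : x ∈ S) :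
    (A^[m]) x ∈ S ∧ φ ((A^[m]) x) = φ x := by
  induction m with
  | zero => exact ⟨hx, rfl⟩
  | succ m ih =>
    rw [Function.iterate_succ_apply']
    exact ⟨h.map_mem _ ih.1, (h.map_apply _ ih.1).trans ih.2⟩

theorem iterate_sub_le (h : ContractsKer S φ ε A) (m : ℕ) {x y : E} (hx : x ∈ S) (hy : y ∈ S)
    (hxy : φ x = φ y) : ‖(A^[m]) x - (A^[m]) y‖ ≤ ε ^ m * ‖x - y‖ := by
  induction m with
  | zero => simp
  | succ m ih =>
    rw [Function.iterate_succ_apply', Function.iterate_succ_apply', ← map_sub, pow_succ']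
    obtain ⟨h1, h2⟩ := h.iterate_mem m hx
    obtain ⟨h3, h4⟩ := h.iterate_mem m hy
    refine (h.norm_le _ (S.sub_mem h1 h3) (by rw [map_sub, h2, h4, hxy, sub_self])).trans ?_
    rw [mul_assoc]
    exact mul_le_mul_of_nonneg_left ih h.nonneg

theorem _root_.ContinuousLinearMap.iterate_eq_of_fixed {A : E →L[ℝ] E} {u : E} (hu : A u = u)
    (m : ℕ) :
    (A^[m]) u = u := Function.iterate_fixed hu m

theorem tendsto_iterate (h : ContractsKer S φ ε A) {u x : E} (hu : A u = u) (huS : u ∈ S)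
    (hx : x ∈ S) (hxu : φ x = φ u) : Tendsto (fun m => (A^[m]) x) atTop (𝓝 u) := by
  rw [tendsto_iff_norm_sub_tendsto_zero]
  have h1 : Tendsto (fun m => ε ^ m * ‖x - u‖) atTop (𝓝 0) := by
    simpa using (tendsto_pow_atTop_nhds_zero_of_lt_one h.nonneg h.lt_one).mul_const ‖x - u‖
  refine squeeze_zero (fun _ => norm_nonneg _) (fun m => ?_) h1
  have := h.iterate_sub_le m hx huS hxu
  rwa [A.iterate_eq_of_fixed hu] at this

/-- A coincidence between two iterates makes x periodic by injectivity, and a contraction has no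
periodic point besides its fixed point. -/
theorem eq_of_iterate_eq (h : ContractsKer S φ ε A) {u x : E} (hu : A u = u) (huS : u ∈ S)
    (hx : x ∈ S) (hxu : φ x = φ u) {m m' : ℕ} (hm : m < m')
    (heq : (A^[m]) x = (A^[m']) x) (hA : Function.Injective A) : x = u := by
  obtain ⟨r, rfl⟩ := Nat.exists_eq_add_of_lt hm
  rw [add_assoc, Function.iterate_add_apply] at heq
  have h1 : x = (A^[r + 1]) x := hA.iterate m heq
  have h2 := h.iterate_sub_le (r + 1) hx huS hxu
  rw [← h1, A.iterate_eq_of_fixed hu] at h2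
  have h3 : ε ^ (r + 1) < 1 := pow_lt_one₀ h.nonneg h.lt_one (by omega)
  have h4 : ‖x - u‖ = 0 := by
    by_contra hne
    have : 0 < ‖x - u‖ := (norm_nonneg _).lt_of_ne' hne
    nlinarith
  rwa [norm_eq_zero, sub_eq_zero] at h4

theorem eq_of_fixed (h : ContractsKer S φ ε A) {u x : E} (hu : A u = u) (huS : u ∈ S)
    (hx : x ∈ S) (hxu : φ x = φ u) (hAx : A x = x) : x = u := by
  have := h.tendsto_iterate hu huS hx hxu
  simp only [A.iterate_eq_of_fixed hAx] at this
  exact tendsto_nhds_unique tendsto_const_nhds this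

/-- Banach iteration on the level set of φ through u; the distance estimate keeps the fixed point
near the starting point. -/
theorem exists_fixed [CompleteSpace E] (h : ContractsKer S φ ε A) {C : Set E} (hC : IsClosed C)
    (hAC : ∀ x ∈ C, A x ∈ C) {u : E} (huS : u ∈ S) (huC : u ∈ C) :
    ∃ w ∈ C, A w = w ∧ φ w = φ u ∧ ‖u - w‖ ≤ ‖A u - u‖ / (1 - ε) := by
  have hstep : ∀ m, dist ((A^[m]) u) ((A^[m + 1]) u) ≤ ‖A u - u‖ * ε ^ m := by
    intro m
    rw [dist_comm, dist_eq_norm, Function.iterate_succ_apply, mul_comm]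
    exact h.iterate_sub_le m (h.map_mem _ huS) huS (h.map_apply _ huS)
  have hcau := cauchySeq_of_le_geometric ε _ h.lt_one hstep
  obtain ⟨w, hw⟩ := cauchySeq_tendsto_of_complete hcau
  refine ⟨w, ?_, ?_, ?_, ?_⟩
  · refine hC.mem_of_tendsto hw (Eventually.of_forall fun m => ?_)
    induction m with
    | zero => exact huC
    | succ m ih => rw [Function.iterate_succ_apply']; exact hAC _ ih
  · have h1 := (tendsto_add_atTop_iff_nat 1).2 hw
    simp only [Function.iterate_succ_apply'] at h1
    exact tendsto_nhds_unique ((A.continuous.tendsto w).comp hw) h1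
  · have h1 := (φ.continuous.tendsto w).comp hw
    have h2 : (φ ∘ fun m => (A^[m]) u) = fun _ => φ u := by
      ext m; exact (h.iterate_mem m huS).2
    rw [h2] at h1
    exact tendsto_nhds_unique tendsto_const_nhds h1 |>.symm
  · have := dist_le_of_le_geometric_of_tendsto₀ ε _ h.lt_one hstep hw
    simpa [dist_eq_norm] using this

end ContractsKer

end Contraction

/-! ### Strict joins of cones. -/

section Join

variable {E : Type*} [NormedAddCommGroup E] [NormedSpace ℝ E]

theorem DirectSum.IsInternal.exists_proj [FiniteDimensional ℝ E] {k : ℕ} {S : Fin k → Submodule ℝ E}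
    (hS : DirectSum.IsInternal S) : ∃ pr : Fin k → E →L[ℝ] E, (∀ i x, pr i x ∈ S i) ∧
      (∀ x, ∑ i, pr i x = x) ∧ ∀ c : Fin k → E, (∀ i, c i ∈ S i) → ∀ i, pr i (∑ j, c j) = c i := by
  classical
  let e : (DirectSum (Fin k) fun i => S i) ≃ₗ[ℝ] E :=
    LinearEquiv.ofBijective (DirectSum.coeLinearMap S) hS
  have he : ∀ d, e d = ∑ i, (d i : E) := fun d => by
    change DirectSum.coeLinearMap S d = _
    rw [DirectSum.coeLinearMap_eq_dfinsuppSum, DFinsupp.sum_eq_sum_fintype]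
    · rfl
    · intro i; rfl
  refine ⟨fun i => LinearMap.toContinuousLinearMap
    ((S i).subtype ∘ₗ DirectSum.component ℝ (Fin k) (fun i => S i) i ∘ₗ e.symm.toLinearMap),
    fun i x => ?_, fun x => ?_, fun c hc i => ?_⟩
  · exact (e.symm x i).2
  · exact (he (e.symm x)).symm.trans (e.apply_symm_apply x)
  · let d : DirectSum (Fin k) fun i => S i := DFinsupp.equivFunOnFintype.symm fun i => ⟨c i, hc i⟩
    have h1 : e d = ∑ j, c j := by rw [he]; rfl
    change ((e.symm (∑ j, c j)) i : E) = c i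
    rw [← h1, e.symm_apply_apply]; rfl

/-- The closed cone `Q` is a strict join of pointed strictly convex cones `C i` spanning
independent subspaces `S i` with projections `pr i`. -/
structure IsStrictJoin {k : ℕ} (S : Fin k → Submodule ℝ E) (C : Fin k → Set E)
    (pr : Fin k → E →L[ℝ] E) (Q : Set E) : Prop where
  span_eq : ∀ i, Submodule.span ℝ (C i) = S i
  isClosedCone : ∀ i, IsClosedCone (C i)
  pointed : ∀ i, ∀ x ∈ C i, -x ∈ C i → x = 0
  strict : ∀ i, ∀ x ∈ C i, ∀ y ∈ C i, ¬ SameRay ℝ x y →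
    ∃ δ > 0, ∀ s ∈ S i, ‖s‖ < δ → x + y + s ∈ C i
  mem_iff : ∀ x, x ∈ Q ↔ ∀ i, pr i x ∈ C i
  pr_mem : ∀ i x, pr i x ∈ S i
  sum_pr : ∀ x, ∑ i, pr i x = x
  pr_same : ∀ i, ∀ x ∈ S i, pr i x = x
  pr_other : ∀ i j, i ≠ j → ∀ x ∈ S j, pr i x = 0

namespace IsStrictJoin

variable {k : ℕ} {S : Fin k → Submodule ℝ E} {C : Fin k → Set E} {pr : Fin k → E →L[ℝ] E}
  {Q : Set E}

theorem subset (h : IsStrictJoin S C pr Q) (i : Fin k) : C i ⊆ S i := fun x hx => by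
  rw [SetLike.mem_coe, ← h.span_eq i]; exact Submodule.subset_span hx

theorem factor_subset (h : IsStrictJoin S C pr Q) (i : Fin k) : C i ⊆ Q := fun x hx => by
  rw [h.mem_iff]
  intro j
  by_cases hj : j = i
  · subst hj; rwa [h.pr_same j x (h.subset j hx)]
  · rw [h.pr_other j i hj x (h.subset i hx)]; exact (h.isClosedCone j).zero_mem

theorem isClosedCone' (h : IsStrictJoin S C pr Q) : IsClosedCone Q where
  isClosed := by
    have : Q = ⋂ i, pr i ⁻¹' C i := by ext x; simp [h.mem_iff]
    rw [this]
    exact isClosed_iInter fun i => (h.isClosedCone i).isClosed.preimage (pr i).continuous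
  zero_mem := by rw [h.mem_iff]; intro i; simpa using (h.isClosedCone i).zero_mem
  add_mem hx hy := by
    rw [h.mem_iff] at *
    intro i; rw [map_add]; exact (h.isClosedCone i).add_mem (hx i) (hy i)
  smul_mem ht hx := by
    rw [h.mem_iff] at *
    intro i; rw [map_smul]; exact (h.isClosedCone i).smul_mem ht (hx i)

theorem pointed' (h : IsStrictJoin S C pr Q) : ∀ x ∈ Q, -x ∈ Q → x = 0 := fun x hx hx' => by
  rw [h.mem_iff] at hx hx'
  rw [← h.sum_pr x]
  refine Finset.sum_eq_zero fun i _ => h.pointed i _ (hx i) ?_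
  have := hx' i
  rwa [map_neg] at this

theorem sub_pr_mem (h : IsStrictJoin S C pr Q) {x : E} (hx : x ∈ Q) (i : Fin k) :
    x - pr i x ∈ Q := by
  rw [h.mem_iff] at *
  intro j
  by_cases hj : j = i
  · subst hj
    rw [map_sub, h.pr_same j _ (h.pr_mem j x), sub_self]; exact (h.isClosedCone j).zero_mem
  · rw [map_sub, h.pr_other j i hj _ (h.pr_mem i x), sub_zero]; exact hx j

theorem pr_sub_pr (h : IsStrictJoin S C pr Q) (x : E) (i : Fin k) : pr i (x - pr i x) = 0 := by
  rw [map_sub, h.pr_same i _ (h.pr_mem i x), sub_self]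

theorem map_pr (h : IsStrictJoin S C pr Q) {T : E →L[ℝ] E} (hT : ∀ i, ∀ x ∈ S i, T x ∈ S i)
    (i : Fin k) (x : E) : pr i (T x) = T (pr i x) := by
  conv_lhs => rw [← h.sum_pr x, map_sum, map_sum]
  rw [Finset.sum_eq_single i]
  · exact h.pr_same i _ (hT i _ (h.pr_mem i x))
  · intro j _ hj; exact h.pr_other i j hj.symm _ (hT j _ (h.pr_mem j x))
  · simp

end IsStrictJoin

end Join

/-! ### Group actions on strict joins: attracting boundary points. -/

section JoinGroup

variable {E : Type*} [NormedAddCommGroup E] [NormedSpace ℝ E]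

/-- The positive multiples of the elements of a group of linear automorphisms. -/
def posMultiples (N : Subgroup (E ≃L[ℝ] E)) : Set (E ≃L[ℝ] E) :=
  {T | ∃ g ∈ N, ∃ t : ℝ, 0 < t ∧ ∀ x, T x = t • g x}

/-- Groups `𝒢 i` acting on the factors of a strict join: `𝒢 i` preserves `C i` and acts by
positive scalars on the other factors. The functional `φ` is an eigenfunctional, positive on the
interior of the join, and the product of the groups acts cocompactly and properly there. -/
structure IsJoinAction {k : ℕ} (S : Fin k → Submodule ℝ E) (C : Fin k → Set E)
    (pr : Fin k → E →L[ℝ] E) (𝒢 : Fin k → Subgroup (E ≃L[ℝ] E)) (Ω : Set E) (φ : E →L[ℝ] ℝ) :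
    Prop where
  join : IsStrictJoin S C pr (closure Ω)
  mem_iff : ∀ i, ∀ g ∈ 𝒢 i, ∀ x, g x ∈ C i ↔ x ∈ C i
  scalar : ∀ i j, j ≠ i → ∀ g ∈ 𝒢 i, ∃ c : ℝ, 0 < c ∧ ∀ x ∈ S j, g x = c • x
  eigen : ∀ i, ∀ g ∈ 𝒢 i, ∃ χ : ℝ, 0 < χ ∧ ∀ x, φ (g x) = χ * φ x
  pos : ∀ x ∈ Ω, 0 < φ x
  nonempty : Ω.Nonempty
  cocompact : IsCocompact (posMultiples (⨆ i, 𝒢 i)) Ω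
  proper : ∀ K ⊆ Ω, IsCompact K → {g | g ∈ ⨆ i, 𝒢 i ∧ ∃ x ∈ K, g x ∈ K}.Finite

namespace IsJoinAction

variable {k : ℕ} {S : Fin k → Submodule ℝ E} {C : Fin k → Set E} {pr : Fin k → E →L[ℝ] E}
  {𝒢 : Fin k → Subgroup (E ≃L[ℝ] E)} {Ω : Set E} {φ : E →L[ℝ] ℝ}

theorem map_mem (h : IsJoinAction S C pr 𝒢 Ω φ) {i : Fin k} {g : E ≃L[ℝ] E} (hg : g ∈ 𝒢 i)
    {x : E} (hx : x ∈ S i) : g x ∈ S i := by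
  rw [← h.join.span_eq i] at hx ⊢
  have : Submodule.span ℝ (C i) ≤ (Submodule.span ℝ (C i)).comap (g : E →ₗ[ℝ] E) := by
    rw [Submodule.span_le]
    exact fun y hy => Submodule.subset_span ((h.mem_iff i g hg y).2 hy)
  exact this hx

/-- On a given factor the groups belonging to the other factors act by positive scalars, so only the
component in `𝒢 i` matters there, up to scaling. -/
theorem iSup_component (h : IsJoinAction S C pr 𝒢 Ω φ) {g : E ≃L[ℝ] E} (hg : g ∈ ⨆ i, 𝒢 i) :
    (∀ i, ∃ g' ∈ 𝒢 i, ∃ c : ℝ, 0 < c ∧ ∀ x ∈ S i, g x = c • g' x) ∧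
      ∃ χ : ℝ, 0 < χ ∧ ∀ x, φ (g x) = χ * φ x := by
  induction hg using Subgroup.iSup_induction' with
  | hp i g hg =>
    refine ⟨fun j => ?_, h.eigen i g hg⟩
    by_cases hj : j = i
    · subst hj; exact ⟨g, hg, 1, one_pos, fun x _ => (one_smul ℝ _).symm⟩
    · obtain ⟨c, hc, hcx⟩ := h.scalar i j hj g hg
      exact ⟨1, (𝒢 j).one_mem, c, hc, hcx⟩
  | h1 =>
    exact ⟨fun j => ⟨1, (𝒢 j).one_mem, 1, one_pos, fun x _ => (one_smul ℝ _).symm⟩,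
      1, one_pos, fun x => (one_mul _).symm⟩
  | hmul g₁ g₂ _ _ ih₁ ih₂ =>
    refine ⟨fun i => ?_, ?_⟩
    · obtain ⟨a₁, ha₁, c₁, hc₁, h₁⟩ := ih₁.1 i
      obtain ⟨a₂, ha₂, c₂, hc₂, h₂⟩ := ih₂.1 i
      refine ⟨a₁ * a₂, (𝒢 i).mul_mem ha₁ ha₂, c₁ * c₂, mul_pos hc₁ hc₂, fun x hx => ?_⟩
      change g₁ (g₂ x) = (c₁ * c₂) • a₁ (a₂ x)
      rw [h₂ x hx, map_smul, h₁ _ (h.map_mem ha₂ hx), smul_smul, mul_comm]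
    · obtain ⟨χ₁, hχ₁, e₁⟩ := ih₁.2
      obtain ⟨χ₂, hχ₂, e₂⟩ := ih₂.2
      refine ⟨χ₁ * χ₂, mul_pos hχ₁ hχ₂, fun x => ?_⟩
      change φ (g₁ (g₂ x)) = _
      rw [e₁, e₂, mul_assoc]

theorem posMultiples_component (h : IsJoinAction S C pr 𝒢 Ω φ) {T : E ≃L[ℝ] E}
    (hT : T ∈ posMultiples (⨆ i, 𝒢 i)) :
    (∀ i, ∃ g' ∈ 𝒢 i, ∃ c : ℝ, 0 < c ∧ ∀ x ∈ S i, T x = c • g' x) ∧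
      ∃ χ : ℝ, 0 < χ ∧ ∀ x, φ (T x) = χ * φ x := by
  obtain ⟨g, hg, t, ht, hTx⟩ := hT
  obtain ⟨h1, χ, hχ, h2⟩ := h.iSup_component hg
  refine ⟨fun i => ?_, t * χ, mul_pos ht hχ, fun x => ?_⟩
  · obtain ⟨g', hg', c, hc, hx⟩ := h1 i
    exact ⟨g', hg', t * c, mul_pos ht hc, fun x hxS => by rw [hTx, hx x hxS, smul_smul]⟩
  · rw [hTx, map_smul, h2, smul_eq_mul, mul_assoc]

theorem posMultiples_map_mem (h : IsJoinAction S C pr 𝒢 Ω φ) {T : E ≃L[ℝ] E}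
    (hT : T ∈ posMultiples (⨆ i, 𝒢 i)) (i : Fin k) : ∀ x ∈ S i, T x ∈ S i := by
  obtain ⟨g', hg', _, _, hx⟩ := (h.posMultiples_component hT).1 i
  intro x hxS
  rw [hx x hxS]
  exact (S i).smul_mem _ (h.map_mem hg' hxS)

theorem nonneg (h : IsJoinAction S C pr 𝒢 Ω φ) : ∀ x ∈ closure Ω, 0 ≤ φ x :=
  fun _ hx => closure_minimal (t := {y | 0 ≤ φ y}) (fun y hy => (h.pos y hy).le)
    (isClosed_le continuous_const φ.continuous) hx

/-- The component of a point of `Ω` is interior to the factor. -/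
theorem exists_sub_smul_mem (h : IsJoinAction S C pr 𝒢 Ω φ) {p : E} (hp : p ∈ Ω) (i : Fin k)
    (c : E) (hc : c ∈ S i) : ∃ δ : ℝ, 0 < δ ∧ pr i p - δ • c ∈ C i := by
  obtain ⟨δ, hδ, hball⟩ := Metric.isOpen_iff.1 h.cocompact.isOpen p hp
  refine ⟨δ / (‖c‖ + 1) / 2, by positivity, ?_⟩
  have h1 : p - (δ / (‖c‖ + 1) / 2) • c ∈ Ω := hball (by
    rw [Metric.mem_ball, dist_eq_norm, sub_sub_cancel_left, norm_neg, norm_smul,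
      Real.norm_of_nonneg (by positivity), div_div, div_mul_eq_mul_div, div_lt_iff₀ (by positivity)]
    nlinarith [norm_nonneg c])
  have := (h.join.mem_iff _).1 (subset_closure h1) i
  rwa [map_sub, map_smul, h.join.pr_same i c hc] at this

variable [FiniteDimensional ℝ E]

theorem eq_interior (h : IsJoinAction S C pr 𝒢 Ω φ) : Ω = interior (closure Ω) :=
  h.cocompact.eq_interior_closure h.join.isClosedCone' h.join.pointed'

theorem add_mem (h : IsJoinAction S C pr 𝒢 Ω φ) {x y : E} (hx : x ∈ Ω) (hy : y ∈ closure Ω) :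
    x + y ∈ Ω := by
  rw [h.eq_interior] at hx ⊢
  exact h.join.isClosedCone'.smul_add_mem_interior hx hy

theorem smul_mem (h : IsJoinAction S C pr 𝒢 Ω φ) {x : E} (hx : x ∈ Ω) {t : ℝ} (ht : 0 < t) :
    t • x ∈ Ω := by
  rw [h.eq_interior] at hx ⊢
  exact h.join.isClosedCone'.smul_mem_interior hx ht

/-- The functional `φ` is supported on a single factor. -/
theorem eq_zero_of_ne (h : IsJoinAction S C pr 𝒢 Ω φ) {i j : Fin k} (hij : i ≠ j)
    {x : E} (hx : x ∈ S i) (hφx : φ x ≠ 0) {y : E} (hy : y ∈ S j) : φ y = 0 := by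
  by_contra hφy
  obtain ⟨w, hw⟩ := h.nonempty
  have hpos : 0 < (φ.comp (pr j)) w := by
    have hne : φ.comp (pr j) ≠ 0 := fun h0 => hφy (by
      have := DFunLike.congr_fun h0 y
      simpa [h.join.pr_same j y hy] using this)
    refine IsClosedCone.pos_of_mem_interior (C := closure Ω) (fun z hz => ?_) hne
      (h.eq_interior ▸ hw)
    exact h.nonneg _ (h.join.factor_subset j ((h.join.mem_iff z).1 hz j))
  -- If φ were nonzero on two factors, its two components would be eigenfunctionals with the same
  -- eigenvalue, so this combination is one too. The coefficient is chosen to make it vanish at w ∈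
  -- Ω, which `ne_zero_of_eigen` forbids.
  set Ψ : E →L[ℝ] ℝ := φ.comp (pr i) - (φ (pr i w) / φ (pr j w)) • φ.comp (pr j) with hΨ
  have hpos' : 0 < φ (pr j w) := hpos
  have hΨ0 : Ψ ≠ 0 := fun h0 => hφx (by
    have := DFunLike.congr_fun h0 x
    simpa [hΨ, h.join.pr_same i x hx, h.join.pr_other j i hij.symm x hx] using this)
  refine h.cocompact.ne_zero_of_eigen h.join.isClosedCone' h.join.pointed' hΨ0 ?_ hw ?_
  · intro T hT
    obtain ⟨_, χ, _, hχ⟩ := h.posMultiples_component hT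
    have hcomm := h.join.map_pr (T := (T : E →L[ℝ] E)) (h.posMultiples_map_mem hT)
    refine ⟨χ, fun z => ?_⟩
    have h1 : pr i (T z) = T (pr i z) := hcomm i z
    have h2 : pr j (T z) = T (pr j z) := hcomm j z
    simp only [hΨ, _root_.sub_apply, ContinuousLinearMap.comp_apply, _root_.smul_apply, h1, h2, hχ,
      smul_eq_mul]
    ring
  · simp only [hΨ, _root_.sub_apply, ContinuousLinearMap.comp_apply, _root_.smul_apply, smul_eq_mul]
    field_simp
    ring

/-- Boundary points of a factor are attractors of group elements. -/
theorem exists_attracting (h : IsJoinAction S C pr 𝒢 Ω φ) {i : Fin k} {u : E} (huC : u ∈ C i)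
    (hφu : φ u = 1) (hu : ¬ ∃ δ > 0, ∀ s ∈ S i, ‖s‖ < δ → u + s ∈ C i) {ε : ℝ} (hε : 0 < ε) :
    ∃ g ∈ 𝒢 i, ∃ χ : ℝ, 0 < χ ∧ (∀ x, φ (g x) = χ * φ x) ∧
      ∀ x ∈ S i, ‖χ⁻¹ • g x - φ x • u‖ ≤ ε * ‖x‖ := by
  have hQ := h.join.isClosedCone'
  have : ProperSpace E := FiniteDimensional.proper ℝ E
  obtain ⟨p, hp⟩ := h.nonempty
  obtain ⟨F, hFΩ, hF, hco⟩ := h.cocompact.exists_compact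
  -- Complete u by the other components of p, approach y from inside Ω, and extract a limit T₀ of
  -- the automorphisms that bring the points of F there.
  set y : E := u + (p - pr i p) with hy
  have hyQ : y ∈ closure Ω :=
    hQ.add_mem (h.join.factor_subset i huC) (h.join.sub_pr_mem (subset_closure hp) i)
  have hxΩ : ∀ j : ℕ, y + (1 / ((j : ℝ) + 1)) • p ∈ Ω := fun j => by
    rw [add_comm]; exact h.add_mem (h.smul_mem hp (by positivity)) hyQ
  choose T hT f hf hTf using fun j => hco _ (hxΩ j)
  have hlim : Tendsto (fun j : ℕ => y + (1 / ((j : ℝ) + 1)) • p) atTop (𝓝 y) := by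
    have := (tendsto_one_div_add_atTop_nhds_zero_nat (𝕜 := ℝ)).smul_const p
    simpa using this.const_add y
  have hTQ : ∀ j, ∀ x ∈ closure Ω, T j x ∈ closure Ω := fun j x hx =>
    (map_mem_closure_iff (h.cocompact.map_iff _ (hT j)) x).2 hx
  obtain ⟨M, hM⟩ := hQ.exists_norm_map_le h.join.pointed' hF (h.eq_interior ▸ hFΩ)
    (‖y‖ + ‖p‖)
  have hTM : ∀ j, ((T j : E →L[ℝ] E)) ∈ Metric.closedBall (0 : E →L[ℝ] E) M := fun j => by
    rw [mem_closedBall_zero_iff]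
    refine hM _ (hTQ j) ⟨f j, hf j, ?_⟩
    rw [ContinuousLinearEquiv.coe_coe, hTf j]
    refine (norm_add_le _ _).trans (add_le_add_right ?_ _)
    rw [norm_smul, Real.norm_of_nonneg (by positivity)]
    refine mul_le_of_le_one_left (norm_nonneg _) ?_
    rw [div_le_one (by positivity)]
    have : (0 : ℝ) ≤ j := j.cast_nonneg
    linarith
  obtain ⟨⟨f₀, T₀⟩, ⟨hf₀, -⟩, s, hs, hconv⟩ := (hF.prod (isCompact_closedBall (0 : E →L[ℝ] E) M)).tendsto_subseq
    (x := fun j => (f j, (T j : E →L[ℝ] E))) fun j => ⟨hf j, hTM j⟩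
  have hcf : Tendsto (fun j => f (s j)) atTop (𝓝 f₀) := (continuous_fst.tendsto _).comp hconv
  have hcT : Tendsto (fun j => (T (s j) : E →L[ℝ] E)) atTop (𝓝 T₀) :=
    (continuous_snd.tendsto _).comp hconv
  have hcTx : ∀ x, Tendsto (fun j => T (s j) x) atTop (𝓝 (T₀ x)) := fun x =>
    ((ContinuousLinearMap.apply ℝ E x).continuous.tendsto _).comp hcT
  have hT₀f : T₀ f₀ = y := by
    have h1 : Tendsto (fun j => (T (s j) : E →L[ℝ] E) (f (s j))) atTop (𝓝 (T₀ f₀)) := by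
      have : Continuous fun q : E × (E →L[ℝ] E) => q.2 q.1 := by fun_prop
      exact (this.tendsto _).comp hconv
    have h2 := hlim.comp hs.tendsto_atTop
    refine tendsto_nhds_unique h1 ?_
    convert h2 using 1
    ext j
    exact hTf (s j)
  have hT₀S : ∀ l, ∀ x ∈ S l, T₀ x ∈ S l := fun l x hx =>
    (Submodule.closed_of_finiteDimensional (S l)).mem_of_tendsto (hcTx x)
      (Eventually.of_forall fun j => h.posMultiples_map_mem (hT (s j)) l x hx)
  have hT₀Q : ∀ x ∈ closure Ω, T₀ x ∈ closure Ω := fun x hx =>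
    isClosed_closure.mem_of_tendsto (hcTx x) (Eventually.of_forall fun j => hTQ (s j) x hx)
  have hT₀C : ∀ x ∈ C i, T₀ x ∈ C i := fun x hx => by
    have h1 := (h.join.mem_iff _).1 (hT₀Q x (h.join.factor_subset i hx)) i
    rwa [h.join.pr_same i _ (hT₀S i x (h.join.subset i hx))] at h1
  have hT₀pf : T₀ (pr i f₀) = u := by
    rw [← h.join.map_pr hT₀S, hT₀f, hy, map_add, h.join.pr_sub_pr, add_zero,
      h.join.pr_same i u (h.join.subset i huC)]
  choose lam hlam hφT using fun j => (h.posMultiples_component (hT j)).2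
  have hφp := h.pos p hp
  have hclam : Tendsto (fun j => lam (s j)) atTop (𝓝 (φ (T₀ p) / φ p)) := by
    have h1 := (((φ.continuous.tendsto _).comp (hcTx p)).div_const (φ p))
    convert h1 using 1
    ext j
    simp only [Function.comp_apply, hφT]
    field_simp
  set L := φ (T₀ p) / φ p with hL
  have hφT₀ : ∀ x, φ (T₀ x) = L * φ x := fun x => by
    refine tendsto_nhds_unique ((φ.continuous.tendsto _).comp (hcTx x)) ?_
    convert hclam.mul_const (φ x) using 1
    ext j; exact hφT (s j) x
  have hL0 : 0 ≤ L := ge_of_tendsto' hclam fun j => (hlam (s j)).le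
  -- L is the limit of the eigenvalues on φ. It does not vanish, since T₀ reaches u and φ u = 1.
  have hLpos : 0 < L := hL0.lt_of_ne fun h0 => by
    have := hφT₀ (pr i f₀)
    rw [hT₀pf, hφu, ← h0, zero_mul] at this
    exact one_ne_zero this
  -- For x in C i, some pr i f₀ - δx is still in C i, so u is the sum of two images of points of C
  -- i. As u is not relatively interior, strict convexity puts both on the ray of u. Thus T₀ has
  -- rank one on S i.
  have hrank : ∀ x ∈ S i, T₀ x = (L * φ x) • u := by
    have hC : ∀ x ∈ C i, T₀ x = (L * φ x) • u := by
      intro x hx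
      obtain ⟨δ, hδ, hδx⟩ := h.exists_sub_smul_mem (hFΩ hf₀) i x (h.join.subset i hx)
      have h1 := hT₀C _ hδx
      have h2 := (h.join.isClosedCone i).smul_mem hδ.le (hT₀C _ hx)
      have h3 : T₀ (pr i f₀ - δ • x) + δ • T₀ x = u := by
        rw [map_sub, map_smul, hT₀pf, sub_add_cancel]
      have h4 : SameRay ℝ (T₀ (pr i f₀ - δ • x)) (δ • T₀ x) := by
        by_contra hn
        obtain ⟨η, hη, hball⟩ := h.join.strict i _ h1 _ h2 hn
        rw [h3] at hball
        exact hu ⟨η, hη, hball⟩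
      obtain ⟨a, b, -, -, -, -, hb⟩ := h4.exists_eq_smul_add
      rw [h3] at hb
      have h5 : T₀ x = (δ⁻¹ * b) • u := by
        rw [mul_smul, ← hb, smul_smul, inv_mul_cancel₀ hδ.ne', one_smul]
      have h6 := hφT₀ x
      rw [h5, map_smul, hφu, smul_eq_mul, mul_one] at h6
      rw [h5, h6]
    intro x hx
    rw [← h.join.span_eq i] at hx
    induction hx using Submodule.span_induction with
    | mem x hx => exact hC x hx
    | zero => simp
    | add x y _ _ hx hy => rw [map_add, hx, hy, map_add, mul_add, add_smul]
    | smul a x _ hx => rw [map_smul, hx, map_smul, smul_smul, smul_eq_mul]; congr 1; ring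
  have hconv' : Tendsto (fun j => (lam (s j))⁻¹ • (T (s j) : E →L[ℝ] E)) atTop (𝓝 (L⁻¹ • T₀)) :=
    (hclam.inv₀ hLpos.ne').smul hcT
  obtain ⟨j, hj⟩ := ((tendsto_iff_norm_sub_tendsto_zero.1 hconv').eventually
    (gt_mem_nhds hε)).exists
  obtain ⟨g, hg, c, hc, hgx⟩ := (h.posMultiples_component (hT (s j))).1 i
  obtain ⟨χ, hχ, hχg⟩ := h.eigen i g hg
  refine ⟨g, hg, χ, hχ, hχg, fun x hx => ?_⟩
  -- The component g differs from T on S i by an unknown scalar c; dividing by the eigenvalue on φ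
  -- cancels it.
  have h1 : lam (s j) = c * χ := by
    have h2 := hφT (s j) u
    rw [hgx u (h.join.subset i huC), map_smul, hχg, hφu, smul_eq_mul] at h2
    linarith
  have h2 : χ⁻¹ • g x = ((lam (s j))⁻¹ • (T (s j) : E →L[ℝ] E)) x := by
    rw [_root_.smul_apply, ContinuousLinearEquiv.coe_coe, hgx x hx, smul_smul, h1]
    congr 1
    field_simp
  have h3 : φ x • u = (L⁻¹ • T₀) x := by
    rw [_root_.smul_apply, hrank x hx, smul_smul]
    congr 1
    field_simp
  rw [h2, h3, ← _root_.sub_apply]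
  refine (ContinuousLinearMap.le_opNorm _ _).trans ?_
  exact mul_le_mul_of_nonneg_right hj.le (norm_nonneg _)

end IsJoinAction

end JoinGroup

/-! ### The kernel of an eigenfunctional on a strict join. -/

section JoinGroup

variable {E : Type*} [NormedAddCommGroup E] [NormedSpace ℝ E]

/-- A ray from a point of a closed cone in a direction outside of the cone leaves the cone. -/
theorem IsClosedCone.exists_exit {C : Set E} (hC : IsClosedCone C) {p d : E} (hp : p ∈ C)
    (hd : d ∉ C) : ∃ a : ℝ, 0 ≤ a ∧ p + a • d ∈ C ∧ ∀ b > a, p + b • d ∉ C := by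
  set A : Set ℝ := {t | 0 ≤ t ∧ p + t • d ∈ C} with hA
  have hcl : IsClosed A := (isClosed_le continuous_const continuous_id).inter
    (hC.isClosed.preimage (by fun_prop : Continuous fun t : ℝ => p + t • d))
  have h0 : (0 : ℝ) ∈ A := ⟨le_rfl, by simpa using hp⟩
  have hbdd : BddAbove A := by
    -- If the ray stayed in C, rescaling p + t d by 1/t and letting t grow would put d into C.
    by_contra hnb
    rw [not_bddAbove_iff] at hnb
    choose t ht htn using fun m : ℕ => hnb m
    refine hd (hC.isClosed.mem_of_tendsto (f := fun m : ℕ => (t m)⁻¹ • (p + t m • d)) (b := atTop)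
      ?_ (Eventually.of_forall fun m => hC.smul_mem (inv_nonneg.2 (ht m).1) (ht m).2))
    have htop : Tendsto t atTop atTop :=
      tendsto_atTop_mono (fun m => (htn m).le) tendsto_natCast_atTop_atTop
    have h1 : Tendsto (fun m => (t m)⁻¹ • p + d) atTop (𝓝 ((0 : ℝ) • p + d)) :=
      ((tendsto_inv_atTop_zero.comp htop).smul_const p).add_const d
    rw [zero_smul, zero_add] at h1
    refine h1.congr' ?_
    filter_upwards [htop.eventually_gt_atTop 0] with m hm
    rw [smul_add, smul_smul, inv_mul_cancel₀ hm.ne', one_smul]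
  have hmem : sSup A ∈ A := hcl.csSup_mem ⟨0, h0⟩ hbdd
  exact ⟨sSup A, hmem.1, hmem.2, fun b hb hbC =>
    (not_lt.2 (le_csSup hbdd ⟨hmem.1.trans hb.le, hbC⟩)) hb⟩

namespace IsJoinAction

variable {k : ℕ} {S : Fin k → Submodule ℝ E} {C : Fin k → Set E} {pr : Fin k → E →L[ℝ] E}
  {𝒢 : Fin k → Subgroup (E ≃L[ℝ] E)} {Ω : Set E} {φ : E →L[ℝ] ℝ}

/-- By strict convexity, x + y would otherwise be relatively interior in C i, and φ ≥ 0 vanishing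
there would vanish on S i. So the face of C i in ker φ is at most a ray. -/
theorem sameRay_of_mem_ker (h : IsJoinAction S C pr 𝒢 Ω φ) {i : Fin k} {x y : E} (hx : x ∈ C i)
    (hy : y ∈ C i) (hφx : φ x = 0) (hφy : φ y = 0) {w : E} (hw : w ∈ S i) (hφw : φ w ≠ 0) :
    SameRay ℝ x y := by
  by_contra hn
  obtain ⟨δ, hδ, hball⟩ := h.join.strict i x hx y hy hn
  have key : ∀ s : ℝ, |s| * ‖w‖ < δ → 0 ≤ s * φ w := fun s hs => by
    have := h.nonneg _ (h.join.factor_subset i (hball (s • w) ((S i).smul_mem s hw) (by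
      rwa [norm_smul])))
    simpa [hφx, hφy] using this
  have hwn : 0 < ‖w‖ := norm_pos_iff.2 fun h0 => hφw (by simp [h0])
  have hs : |δ / (2 * ‖w‖)| * ‖w‖ < δ := by
    rw [abs_of_pos (by positivity)]
    field_simp; norm_num
  have h1 := key _ hs
  have h2 := key (-(δ / (2 * ‖w‖))) (by rwa [abs_neg])
  have : 0 < δ / (2 * ‖w‖) := by positivity
  have h3 : δ / (2 * ‖w‖) * φ w = 0 := le_antisymm (by linarith) h1
  exact hφw (by simpa [this.ne'] using h3)

variable [FiniteDimensional ℝ E]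

/-- Near a boundary point of a factor there is a point fixed by a group element that contracts
the kernel of the functional. -/
theorem exists_contracting (h : IsJoinAction S C pr 𝒢 Ω φ) {i : Fin k} {u : E} (huC : u ∈ C i)
    (hφu : φ u = 1) (hu : ¬ ∃ δ > 0, ∀ s ∈ S i, ‖s‖ < δ → u + s ∈ C i) {η : ℝ} (hη : 0 < η) :
    ∃ g ∈ 𝒢 i, ∃ χ : ℝ, 0 < χ ∧ (∀ x, φ (g x) = χ * φ x) ∧
      ∃ ε, ContractsKer (S i) φ ε (χ⁻¹ • (g : E →L[ℝ] E)) ∧ 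
      ∃ w ∈ C i, g w = χ • w ∧ φ w = 1 ∧ ‖u - w‖ < η := by
  -- The fixed point is within ε‖u‖/(1 - ε) of u, at most 2ε‖u‖ once ε ≤ 1/2.
  obtain ⟨ε, hε, hε1, hεη⟩ : ∃ ε : ℝ, 0 < ε ∧ ε ≤ 1 / 2 ∧ 2 * (ε * ‖u‖) < η := by
    refine ⟨min (1 / 2) (η / (2 * ‖u‖ + 1)), by positivity, min_le_left _ _, ?_⟩
    have h1 : min (1 / 2) (η / (2 * ‖u‖ + 1)) * ‖u‖ ≤ η / (2 * ‖u‖ + 1) * ‖u‖ :=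
      mul_le_mul_of_nonneg_right (min_le_right _ _) (norm_nonneg _)
    have h2 : 2 * (η / (2 * ‖u‖ + 1) * ‖u‖) < η := by
      rw [div_mul_eq_mul_div, ← mul_div_assoc, div_lt_iff₀ (by positivity)]
      nlinarith
    linarith
  obtain ⟨g, hg, χ, hχ, hφg, hle⟩ := h.exists_attracting huC hφu hu hε
  have huS := h.join.subset i huC
  have hA : ContractsKer (S i) φ ε (χ⁻¹ • (g : E →L[ℝ] E)) :=
    { nonneg := hε.le
      lt_one := by linarith
      map_mem := fun x hx => (S i).smul_mem _ (h.map_mem hg hx)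
      map_apply := fun x _ => by
        simp only [_root_.smul_apply, ContinuousLinearEquiv.coe_coe, map_smul, hφg, smul_eq_mul]
        field_simp
      norm_le := fun x hx hφx => by
        have := hle x hx
        rwa [hφx, zero_smul, sub_zero] at this }
  obtain ⟨w, hwC, hAw, hφw, hdist⟩ := hA.exists_fixed (h.join.isClosedCone i).isClosed
    (fun x hx => (h.join.isClosedCone i).smul_mem (inv_nonneg.2 hχ.le) ((h.mem_iff i g hg x).2 hx))
    huS huC
  refine ⟨g, hg, χ, hχ, hφg, ε, hA, w, hwC, ?_, hφw.trans hφu, ?_⟩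
  · have : χ⁻¹ • g w = w := hAw
    have h1 := congrArg (χ • ·) this
    simpa [smul_smul, hχ.ne'] using h1
  · have h1 : ‖(χ⁻¹ • (g : E →L[ℝ] E)) u - u‖ ≤ ε * ‖u‖ := by
      have := hle u huS
      rwa [hφu, one_smul] at this
    refine hdist.trans_lt ?_
    rw [div_lt_iff₀ (by linarith)]
    nlinarith

/-- If C i met ker φ only in 0, the slices φ = const of C i would be bounded. The normalised g maps
such a slice onto itself while contracting it, so the slice would be the single point w. -/
theorem exists_kernel_ray (h : IsJoinAction S C pr 𝒢 Ω φ) {i : Fin k} {ε χ : ℝ} {g : E ≃L[ℝ] E}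
    (hg : g ∈ 𝒢 i) (hχ : 0 < χ) (hφg : ∀ x, φ (g x) = χ * φ x)
    (hA : ContractsKer (S i) φ ε (χ⁻¹ • (g : E →L[ℝ] E))) {w x : E}
    (hwC : w ∈ C i) (hw : g w = χ • w) (hxC : x ∈ C i) (hφx : φ x = φ w) (hxw : x ≠ w) :
    ∃ z ∈ C i, φ z = 0 ∧ z ≠ 0 := by
  by_contra! hno
  have : ProperSpace E := FiniteDimensional.proper ℝ E
  set A : E →L[ℝ] E := χ⁻¹ • (g : E →L[ℝ] E) with hAdef
  obtain ⟨c, hc, hcle⟩ : ∃ c > 0, ∀ y ∈ C i, c * ‖y‖ ≤ φ y := by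
    have hK : IsCompact (C i ∩ Metric.sphere 0 1) :=
      (isCompact_sphere _ _).inter_left (h.join.isClosedCone i).isClosed
    have hpos : ∀ y ∈ C i ∩ Metric.sphere 0 1, 0 < φ y := fun y hy =>
      (h.nonneg y (h.join.factor_subset i hy.1)).lt_of_ne fun h0 => by
        have := hno y hy.1 h0.symm
        simp [this] at hy
    obtain ⟨c, hc, hcy⟩ : ∃ c > 0, ∀ y ∈ C i ∩ Metric.sphere 0 1, c ≤ φ y := by
      rcases (C i ∩ Metric.sphere 0 1).eq_empty_or_nonempty with he | hne
      · exact ⟨1, one_pos, by simp [he]⟩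
      · obtain ⟨y, hy, hmin⟩ := hK.exists_isMinOn hne φ.continuous.continuousOn
        exact ⟨φ y, hpos y hy, fun y' hy' => hmin hy'⟩
    refine ⟨c, hc, fun y hy => ?_⟩
    by_cases hy0 : y = 0
    · simp [hy0]
    have hn : 0 < ‖y‖ := norm_pos_iff.2 hy0
    have := hcy (‖y‖⁻¹ • y) ⟨(h.join.isClosedCone i).smul_mem (inv_nonneg.2 hn.le) hy, by
      simp [norm_smul, hn.ne']⟩
    rwa [map_smul, smul_eq_mul, inv_mul_eq_div, le_div_iff₀ hn] at this
  have hpre : ∀ m : ℕ, ∃ y ∈ C i, φ y = φ x ∧ (A^[m]) y = x := by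
    intro m
    induction m with
    | zero => exact ⟨x, hxC, rfl, rfl⟩
    | succ m ih =>
      obtain ⟨y, hy, hφy, hAy⟩ := ih
      refine ⟨χ • g.symm y, (h.join.isClosedCone i).smul_mem hχ.le ?_, ?_, ?_⟩
      · rwa [← h.mem_iff i g hg, g.apply_symm_apply]
      · have := hφg (g.symm y)
        rw [g.apply_symm_apply] at this
        rw [map_smul, smul_eq_mul, ← this, hφy]
      · rw [Function.iterate_succ_apply]
        convert hAy using 2
        simp [hAdef, hχ.ne']
  have hwA : A w = w := by
    simp [hAdef, hw, smul_smul, hχ.ne']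
  have hwS := h.join.subset i hwC
  have hbound : ∀ m : ℕ, ‖x - w‖ ≤ ε ^ m * (φ x / c + ‖w‖) := by
    intro m
    obtain ⟨y, hy, hφy, hAy⟩ := hpre m
    have h1 := hA.iterate_sub_le m (h.join.subset i hy) hwS (hφy.trans hφx)
    rw [hAy, A.iterate_eq_of_fixed hwA] at h1
    refine h1.trans (mul_le_mul_of_nonneg_left ?_ (pow_nonneg hA.nonneg m))
    refine (norm_sub_le _ _).trans (add_le_add_left ?_ _)
    rw [le_div_iff₀ hc, ← hφy, mul_comm]
    exact hcle y hy
  have hlim : Tendsto (fun m : ℕ => ε ^ m * (φ x / c + ‖w‖)) atTop (𝓝 0) := by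
    simpa using (tendsto_pow_atTop_nhds_zero_of_lt_one hA.nonneg hA.lt_one).mul_const
      (φ x / c + ‖w‖)
  have := ge_of_tendsto' hlim hbound
  exact hxw (sub_eq_zero.1 (norm_le_zero_iff.1 this))

/-- Two contracting elements have the same fixed point. -/
theorem fixed_eq (h : IsJoinAction S C pr 𝒢 Ω φ) {i : Fin k} {ε χ : ℝ} {g : E ≃L[ℝ] E}
    (hg : g ∈ 𝒢 i) (hχ : 0 < χ) (hφg : ∀ x, φ (g x) = χ * φ x)
    (hA : ContractsKer (S i) φ ε (χ⁻¹ • (g : E →L[ℝ] E))) {w : E}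
    (hwC : w ∈ C i) (hw : g w = χ • w) (hφw : φ w = 1)
    {ε' χ' : ℝ} {g' : E ≃L[ℝ] E}
    (hg' : g' ∈ 𝒢 i) (hχ' : 0 < χ') (hφg' : ∀ x, φ (g' x) = χ' * φ x)
    (hA' : ContractsKer (S i) φ ε' (χ'⁻¹ • (g' : E →L[ℝ] E))) {w' : E}
    (hwC' : w' ∈ C i) (hw' : g' w' = χ' • w') (hφw' : φ w' = 1) : w = w' := by
  by_contra hne
  have hwS := h.join.subset i hwC
  obtain ⟨z, hzC, hφz, hz0⟩ := h.exists_kernel_ray hg hχ hφg hA hwC hw hwC' (hφw'.trans hφw.symm)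
    (Ne.symm hne)
  -- The face of C i in ker φ is the single ray of z, so z is an eigenvector of all of 𝒢 i.
  have hzscal : ∀ a ∈ 𝒢 i, ∃ c : ℝ, c ≠ 0 ∧ a z = c • z := fun a ha => by
    obtain ⟨χa, hχa, hφa⟩ := h.eigen i a ha
    have h1 : a z ∈ C i := (h.mem_iff i a ha z).2 hzC
    have h2 : a z ≠ 0 := fun h0 => hz0 (by simpa using h0)
    obtain ⟨r, hr, hrz⟩ := (h.sameRay_of_mem_ker hzC h1 hφz (by rw [hφa, hφz, mul_zero]) hwS
      (by rw [hφw]; exact one_ne_zero)).exists_pos_left hz0 h2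
    exact ⟨r, hr.ne', hrz.symm⟩
  set A : E →L[ℝ] E := χ⁻¹ • (g : E →L[ℝ] E) with hAdef
  -- The commutator fixes z, the other factors and the values of φ. Its conjugates `cm m` by powers
  -- of g still do, and they send w to A^m (c w), which tends to w.
  set c : E ≃L[ℝ] E := g' * g * g'⁻¹ * g⁻¹ with hc
  have hcapp : ∀ x, c x = g' (g (g'.symm (g.symm x))) := fun x => rfl
  set cm : ℕ → E ≃L[ℝ] E := fun m => g ^ m * c * (g ^ m)⁻¹ with hcm
  have hpow : ∀ (m : ℕ) (x : E), (g ^ m : E ≃L[ℝ] E) x = (g^[m]) x := by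
    intro m
    induction m with
    | zero => intro x; rfl
    | succ m ih => intro x; rw [pow_succ, Function.iterate_succ_apply]; exact ih (g x)
  have hcmapp : ∀ m x, cm m x = (g^[m]) (c ((g ^ m : E ≃L[ℝ] E).symm x)) := fun m x =>
    hpow m _
  have hcmem : c ∈ 𝒢 i := (𝒢 i).mul_mem ((𝒢 i).mul_mem ((𝒢 i).mul_mem hg' hg)
    ((𝒢 i).inv_mem hg')) ((𝒢 i).inv_mem hg)
  have hcmmem : ∀ m, cm m ∈ 𝒢 i := fun m => (𝒢 i).mul_mem ((𝒢 i).mul_mem ((𝒢 i).pow_mem hg m)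
    hcmem) ((𝒢 i).inv_mem ((𝒢 i).pow_mem hg m))
  have hsymm : ∀ (a : E ≃L[ℝ] E) (r : ℝ) (x : E), r ≠ 0 → a x = r • x → a.symm x = r⁻¹ • x := by
    intro a r x hr hax
    rw [a.symm_apply_eq, map_smul, hax, smul_smul, inv_mul_cancel₀ hr, one_smul]
  have hiter : ∀ (r : ℝ) (x : E), g x = r • x → ∀ m : ℕ, (g^[m]) x = r ^ m • x := by
    intro r x hgx m
    induction m with
    | zero => simp
    | succ m ih => rw [Function.iterate_succ_apply', ih, map_smul, hgx, smul_smul, pow_succ]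
  have hpsymm : ∀ (r : ℝ) (x : E), r ≠ 0 → g x = r • x → ∀ m : ℕ,
      (g ^ m : E ≃L[ℝ] E).symm x = (r ^ m)⁻¹ • x := fun r x hr hgx m =>
    hsymm _ _ _ (pow_ne_zero m hr) (by rw [hpow, hiter r x hgx])
  have hfix : ∀ x, (∃ r : ℝ, r ≠ 0 ∧ g x = r • x) → (∃ r : ℝ, r ≠ 0 ∧ g' x = r • x) →
      ∀ m, cm m x = x := by
    rintro x ⟨r, hr, hgx⟩ ⟨r', hr', hgx'⟩ m
    have h1 : c x = x := by
      rw [hcapp, hsymm g r x hr hgx, map_smul, hsymm g' r' x hr' hgx']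
      simp only [map_smul, hgx, hgx', smul_smul]
      rw [show r⁻¹ * r'⁻¹ * r * r' = 1 by field_simp, one_smul]
    rw [hcmapp, hpsymm r x hr hgx, map_smul, h1, ← hpow, map_smul, hpow, hiter r x hgx, smul_smul,
      inv_mul_cancel₀ (pow_ne_zero m hr), one_smul]
  have hAiter : ∀ (m : ℕ) (x : E), (A^[m]) x = (χ ^ m)⁻¹ • (g^[m]) x := by
    intro m
    induction m with
    | zero => intro x; simp
    | succ m ih =>
      intro x
      rw [Function.iterate_succ_apply', ih, Function.iterate_succ_apply', pow_succ, mul_inv,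
        mul_comm, mul_smul]
      change χ⁻¹ • g _ = _
      rw [map_smul]
  have hcmw : ∀ m, cm m w = (A^[m]) (c w) := fun m => by
    rw [hcmapp, hpsymm χ w hχ.ne' hw, map_smul, ← hpow, map_smul, hAiter, hpow]
  have hAw : A w = w := by simp [hAdef, hw, smul_smul, hχ.ne']
  have hcwS : c w ∈ S i := h.map_mem hcmem hwS
  have hφsymm : ∀ (a : E ≃L[ℝ] E) (r : ℝ), r ≠ 0 → (∀ x, φ (a x) = r * φ x) →
      ∀ x, φ (a.symm x) = r⁻¹ * φ x := by
    intro a r hr ha x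
    have := ha (a.symm x)
    rw [a.apply_symm_apply] at this
    rw [this]; field_simp
  have hφcw : φ (c w) = φ w := by
    rw [hcapp, hφg', hφg, hφsymm g' χ' hχ'.ne' hφg', hφsymm g χ hχ.ne' hφg]
    field_simp
  have hlim : Tendsto (fun m => cm m w) atTop (𝓝 w) := by
    simp only [hcmw]
    exact hA.tendsto_iterate hAw hwS hcwS hφcw
  -- a point of `Ω` moved by a bounded amount
  obtain ⟨p, hp⟩ := h.nonempty
  set q := w + z + (p - pr i p) with hq
  -- w + z is relatively interior in C i by strict convexity, and the remaining components are those
  -- of p ∈ Ω.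
  have hqΩ : q ∈ Ω := by
    have hnr : ¬ SameRay ℝ w z := fun hs => by
      obtain ⟨r, hr, hrz⟩ := hs.exists_pos_left (fun h0 => by simp [h0] at hφw) hz0
      rw [← hrz, map_smul, hφw, smul_eq_mul, mul_one] at hφz
      exact hr.ne' hφz
    obtain ⟨δ, hδ, hball⟩ := h.join.strict i w hwC z hzC hnr
    set r := min 1 (δ / (‖pr i p‖ + 1) / 2) with hr
    have hr0 : 0 < r := by positivity
    have h1 : w + z + -(r • pr i p) ∈ C i := hball _
      ((S i).neg_mem ((S i).smul_mem _ (h.join.pr_mem i p))) (by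
        rw [norm_neg, norm_smul, Real.norm_of_nonneg hr0.le]
        have h2 : r * ‖pr i p‖ ≤ δ / (‖pr i p‖ + 1) / 2 * ‖pr i p‖ :=
          mul_le_mul_of_nonneg_right (min_le_right _ _) (norm_nonneg _)
        have h3 : δ / (‖pr i p‖ + 1) / 2 * ‖pr i p‖ < δ := by
          rw [div_div, div_mul_eq_mul_div, div_lt_iff₀ (by positivity)]
          nlinarith [norm_nonneg (pr i p)]
        linarith)
    have h2 : (1 - r) • (p - pr i p) ∈ closure Ω := h.join.isClosedCone'.smul_mem
      (sub_nonneg.2 (min_le_left _ _)) (h.join.sub_pr_mem (subset_closure hp) i)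
    have h3 : q = r • p + ((w + z + -(r • pr i p)) + (1 - r) • (p - pr i p)) := by
      rw [hq]; module
    rw [h3]
    exact h.add_mem (h.smul_mem hp hr0)
      (h.join.isClosedCone'.add_mem (h.join.factor_subset i h1) h2)
  have hcmq : ∀ m, cm m q = cm m w + z + (p - pr i p) := by
    intro m
    rw [hq, map_add, map_add, hfix z (hzscal g hg) (hzscal g' hg')]
    congr 1
    have h1 : p - pr i p = ∑ l ∈ Finset.univ.erase i, pr l p := by
      rw [sub_eq_iff_eq_add, Finset.sum_erase_add _ _ (Finset.mem_univ i), h.join.sum_pr]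
    rw [h1, map_sum]
    refine Finset.sum_congr rfl fun l hl => hfix _ ?_ ?_ m
    · obtain ⟨r, hr, hx⟩ := h.scalar i l (Finset.ne_of_mem_erase hl) g hg
      exact ⟨r, hr.ne', hx _ (h.join.pr_mem l p)⟩
    · obtain ⟨r, hr, hx⟩ := h.scalar i l (Finset.ne_of_mem_erase hl) g' hg'
      exact ⟨r, hr.ne', hx _ (h.join.pr_mem l p)⟩
  have hqlim : Tendsto (fun m => cm m q) atTop (𝓝 q) := by
    simp only [hcmq]
    exact (hlim.add_const z).add_const _
  have : ProperSpace E := FiniteDimensional.proper ℝ E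
  obtain ⟨δ, hδ, hball⟩ := Metric.isOpen_iff.1 h.cocompact.isOpen q hqΩ
  have hKΩ : Metric.closedBall q (δ / 2) ⊆ Ω :=
    (Metric.closedBall_subset_ball (by linarith)).trans hball
  have hfin := h.proper _ hKΩ (isCompact_closedBall _ _)
  have hev : ∀ᶠ m in atTop, cm m q ∈ Metric.closedBall q (δ / 2) :=
    hqlim.eventually (Metric.closedBall_mem_nhds q (by positivity))
  obtain ⟨m₀, hm₀⟩ := eventually_atTop.1 hev
  -- The conjugates move q ∈ Ω to points near q, so properness makes two of them equal. Then c w is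
  -- a periodic point of the contraction, that is, c w = w.
  obtain ⟨m, -, m', -, hmm, heq⟩ := Set.Infinite.exists_lt_map_eq_of_mapsTo (Set.Ici_infinite m₀)
    (f := cm) (t := {a | a ∈ ⨆ i, 𝒢 i ∧
      ∃ x ∈ Metric.closedBall q (δ / 2), a x ∈ Metric.closedBall q (δ / 2)})
    (fun m hm => ⟨Subgroup.mem_iSup_of_mem i (hcmmem m), q,
      Metric.mem_closedBall_self (by positivity), hm₀ m hm⟩) hfin
  have hAinj : Function.Injective A := by
    intro x y hxy
    have : χ⁻¹ • g x = χ⁻¹ • g y := hxy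
    exact g.injective (smul_right_injective E (inv_ne_zero hχ.ne') this)
  have hcw : c w = w := by
    refine hA.eq_of_iterate_eq hAw hwS hcwS hφcw hmm ?_ hAinj
    rw [← hcmw, ← hcmw, heq]
  -- hence `g'` fixes the fixed point of `g`
  have hfixg : g (g'.symm w) = χ • g'.symm w := by
    have h1 := hcapp w
    rw [hcw, hsymm g χ w hχ.ne' hw] at h1
    simp only [map_smul] at h1
    have h2 : χ • g'.symm w = g (g'.symm w) := by
      rw [← g'.symm_apply_apply (g (g'.symm w)), ← map_smul]
      congr 1
      conv_lhs => rw [h1]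
      rw [smul_smul, mul_inv_cancel₀ hχ.ne', one_smul]
    exact h2.symm
  have hinv : g'.symm ∈ 𝒢 i := (𝒢 i).inv_mem hg'
  have h1 : χ' • g'.symm w = w := by
    refine hA.eq_of_fixed hAw hwS ((S i).smul_mem _ (h.map_mem hinv hwS)) ?_ ?_
    · rw [map_smul, hφsymm g' χ' hχ'.ne' hφg', smul_eq_mul]; field_simp
    · change χ⁻¹ • g _ = _
      rw [map_smul, hfixg, smul_smul, smul_smul]
      congr 1
      field_simp
  have h2 : g' w = χ' • w := by
    conv_lhs => rw [← h1]
    rw [map_smul, g'.apply_symm_apply]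
  refine hne (hA'.eq_of_fixed (u := w') ?_ (h.join.subset i hwC') hwS (hφw.trans hφw'.symm) ?_)
  · simp [hw', smul_smul, hχ'.ne']
  · simp [h2, smul_smul, hχ'.ne']

/-- The part of the join in the kernel of an eigenfunctional spans the kernel. -/
theorem ker_le_span (h : IsJoinAction S C pr 𝒢 Ω φ) {e : E} (he : φ e = 0) :
    e ∈ Submodule.span ℝ (closure Ω ∩ {x | φ x = 0}) := by
  set P := Submodule.span ℝ (closure Ω ∩ {x | φ x = 0}) with hP
  obtain ⟨p, hp⟩ := h.nonempty
  have hφp := h.pos p hp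
  obtain ⟨i, hi⟩ : ∃ i, φ (pr i p) ≠ 0 := by
    by_contra! hall
    rw [← h.join.sum_pr p, map_sum, Finset.sum_eq_zero fun i _ => hall i] at hφp
    exact lt_irrefl _ hφp
  have hprC : ∀ j, pr j p ∈ C j := (h.join.mem_iff p).1 (subset_closure hp)
  have hipos : 0 < φ (pr i p) :=
    (h.nonneg _ (h.join.factor_subset i (hprC i))).lt_of_ne' hi
  -- φ lives on the factor i alone, so the other factors lie in the face and only S i remains.
  have hother : ∀ j, j ≠ i → S j ≤ P := fun j hj => by
    rw [← h.join.span_eq j]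
    refine Submodule.span_mono fun x hx => ⟨h.join.factor_subset j hx, ?_⟩
    exact h.eq_zero_of_ne hj.symm (h.join.pr_mem i p) hi (h.join.subset j hx)
  have hφe : φ (pr i e) = 0 := by
    have h1 := congrArg φ (h.join.sum_pr e)
    rw [map_sum, Finset.sum_eq_single i, he] at h1
    · exact h1
    · intro j _ hj
      exact h.eq_zero_of_ne hj.symm (h.join.pr_mem i p) hi (h.join.pr_mem j e)
    · simp
  suffices hmain : pr i e ∈ P by
    rw [← h.join.sum_pr e]
    refine P.sum_mem fun j _ => ?_
    by_cases hj : j = i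
    · rw [hj]; exact hmain
    · exact hother j hj (h.join.pr_mem j e)
  by_contra hd
  set d := pr i e with hdd
  have hdS : d ∈ S i := h.join.pr_mem i e
  -- Neither d nor -d is in C i, so the line through p₁ in the direction d leaves C i on both sides,
  -- at two boundary points on the level φ = 1.
  have hdC : ∀ b : ℝ, b ≠ 0 → b • d ∉ C i := fun b hb hbC => hd (by
    have : b • d ∈ P := Submodule.subset_span ⟨h.join.factor_subset i hbC, by
      change φ (b • d) = 0; rw [map_smul, hφe, smul_zero]⟩
    exact (P.smul_mem_iff hb).1 this)
  set p₁ := (φ (pr i p))⁻¹ • pr i p with hp₁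
  have hp₁C : p₁ ∈ C i := (h.join.isClosedCone i).smul_mem (inv_nonneg.2 hipos.le) (hprC i)
  have hφp₁ : φ p₁ = 1 := by rw [hp₁, map_smul, smul_eq_mul, inv_mul_cancel₀ hi]
  have hboundary : ∀ (d' : E), d' ∈ S i → ∀ a : ℝ, (∀ b > a, p₁ + b • d' ∉ C i) →
      ¬ ∃ δ > 0, ∀ s ∈ S i, ‖s‖ < δ → p₁ + a • d' + s ∈ C i := by
    rintro d' hd' a ha ⟨δ, hδ, hball⟩
    have h1 := hball ((δ / (‖d'‖ + 1) / 2) • d') ((S i).smul_mem _ hd') (by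
      rw [norm_smul, Real.norm_of_nonneg (by positivity), div_div, div_mul_eq_mul_div,
        div_lt_iff₀ (by positivity)]
      nlinarith [norm_nonneg d'])
    refine ha (a + δ / (‖d'‖ + 1) / 2) (by have : 0 < δ / (‖d'‖ + 1) / 2 := by positivity
                                           linarith) ?_
    rwa [add_smul, ← add_assoc]
  obtain ⟨a, ha0, haC, hamax⟩ := (h.join.isClosedCone i).exists_exit hp₁C
    (d := d) (by simpa using hdC 1 one_ne_zero)
  obtain ⟨b, hb0, hbC, hbmax⟩ := (h.join.isClosedCone i).exists_exit hp₁C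
    (d := -d) (by simpa using hdC (-1) (by norm_num))
  -- p₁ is relatively interior in C i. One positive length suffices to keep the two exit points
  -- apart.
  have hapos : 0 < a := by
    refine ha0.lt_of_ne fun h0 => ?_
    obtain ⟨δ, hδ, hδC⟩ := h.exists_sub_smul_mem hp i (-d) ((S i).neg_mem hdS)
    refine hamax ((φ (pr i p))⁻¹ * δ) (by rw [← h0]; positivity) ?_
    have h1 := (h.join.isClosedCone i).smul_mem (inv_nonneg.2 hipos.le) hδC
    rwa [smul_neg, sub_neg_eq_add, smul_add, smul_smul] at h1
  have hne : p₁ + a • d ≠ p₁ + b • -d := fun heq => by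
    have h1 : (a + b) • d = 0 := by
      have h2 := add_left_cancel heq
      rw [add_smul, h2, smul_neg, neg_add_cancel]
    have h3 : d = 0 := (smul_eq_zero.1 h1).resolve_left (by linarith)
    exact hd (h3 ▸ P.zero_mem)
  have hdist : 0 < ‖(p₁ + a • d) - (p₁ + b • -d)‖ := norm_pos_iff.2 (sub_ne_zero.2 hne)
  obtain ⟨g, hg, χ, hχ, hφg, ε, hA, w, hwC, hw, hφw, hwu⟩ := h.exists_contracting haC
    (by rw [map_add, map_smul φ a d, hφe, hφp₁, smul_zero, add_zero]) (hboundary d hdS a hamax)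
    (half_pos hdist)
  obtain ⟨g', hg', χ', hχ', hφg', ε', hA', w', hwC', hw', hφw', hwu'⟩ := h.exists_contracting hbC
    (by rw [map_add, map_smul φ b (-d), map_neg, hφe, hφp₁, neg_zero, smul_zero, add_zero])
    (hboundary (-d) ((S i).neg_mem hdS) b hbmax) (half_pos hdist)
  -- The common fixed point would be closer to each exit point than half of their distance.
  have hww := h.fixed_eq hg hχ hφg hA hwC hw hφw hg' hχ' hφg' hA' hwC' hw' hφw'
  rw [← hww] at hwu'
  have h1 : ‖(p₁ + a • d) - (p₁ + b • -d)‖ ≤ ‖p₁ + a • d - w‖ + ‖p₁ + b • -d - w‖ := by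
    have : (p₁ + a • d) - (p₁ + b • -d) = (p₁ + a • d - w) - (p₁ + b • -d - w) := by abel
    rw [this]
    exact norm_sub_le _ _
  linarith

end IsJoinAction

end JoinGroup

/-! ### Laplace transforms over the dual cone. -/

section KoszulVinberg

open MeasureTheory

variable {E : Type} [NormedAddCommGroup E] [NormedSpace ℝ E]

/-- The dual cone, in the dual space. -/
def dualCone (Q : Set E) : Set (StrongDual ℝ E) := {ξ | ∀ x ∈ Q, 0 ≤ ξ x}

theorem isClosed_dualCone (Q : Set E) : IsClosed (dualCone Q) := by
  have : dualCone Q = ⋂ x ∈ Q, {ξ : StrongDual ℝ E | 0 ≤ ξ x} := by ext ξ; simp [dualCone]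
  rw [this]
  exact isClosed_biInter fun x _ => isClosed_le continuous_const
    (ContinuousLinearMap.apply ℝ ℝ x).continuous

/-- Coercivity at interior points: ξ is nonnegative on the whole ball around x, so ξ x bounds |ξ| on
vectors of length δ. This makes all the integrals below converge. -/
theorem norm_le_of_mem_dualCone {Q : Set E} {x : E} {δ : ℝ} (hδ : 0 < δ)
    (hx : ∀ u : E, ‖u‖ ≤ δ → x + u ∈ Q) {ξ : StrongDual ℝ E} (hξ : ξ ∈ dualCone Q) :
    δ * ‖ξ‖ ≤ ξ x := by
  have hx0 : 0 ≤ ξ x := by simpa using hξ _ (hx 0 (by simpa using hδ.le))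
  have key : ∀ u : E, ‖u‖ ≤ δ → |ξ u| ≤ ξ x := by
    intro u hu
    have h1 := hξ _ (hx u hu)
    have h2 := hξ _ (hx (-u) (by rwa [norm_neg]))
    rw [map_add] at h1 h2
    rw [map_neg] at h2
    exact abs_le.2 ⟨by linarith, by linarith⟩
  have : ‖ξ‖ ≤ ξ x / δ := by
    refine ξ.opNorm_le_bound (by positivity) fun y => ?_
    by_cases hy : y = 0
    · simp [hy]
    have hn : 0 < ‖y‖ := norm_pos_iff.2 hy
    have h1 := key ((δ / ‖y‖) • y) (by
      rw [norm_smul, Real.norm_of_nonneg (by positivity), div_mul_cancel₀ _ hn.ne'])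
    rw [map_smul, smul_eq_mul, abs_mul, abs_of_pos (by positivity), div_mul_eq_mul_div,
      div_le_iff₀ hn] at h1
    rw [Real.norm_eq_abs, div_mul_eq_mul_div, le_div_iff₀ hδ]
    linarith
  rw [le_div_iff₀ hδ] at this
  linarith

variable {Y : Type} [NormedAddCommGroup Y] [NormedSpace ℝ Y]
  {Q : Set E} {w : StrongDual ℝ E → Y} {m : ℕ} {B : ℝ}

/-- The weight of the derivative of a Laplace transform. -/
noncomputable def laplaceWeight (w : StrongDual ℝ E → Y) (ξ : StrongDual ℝ E) : E →L[ℝ] Y :=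
  -(ContinuousLinearMap.smulRightL ℝ E Y ξ (w ξ))

theorem exists_pos_ball {E : Type*} [SeminormedAddCommGroup E] {Q : Set E} {x : E}
    (hx : x ∈ interior Q) :
    ∃ δ > 0, ∀ y ∈ Metric.ball x δ, ∀ u : E, ‖u‖ ≤ δ → y + u ∈ Q := by
  obtain ⟨δ, hδ, hball⟩ := Metric.isOpen_iff.1 isOpen_interior x hx
  refine ⟨δ / 2, half_pos hδ, fun y hy u hu => interior_subset (hball ?_)⟩
  rw [Metric.mem_ball, dist_eq_norm] at *
  have : y + u - x = (y - x) + u := by abel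
  rw [this]
  exact (norm_add_le _ _).trans_lt (by linarith)

theorem exp_le_of_mem {x : E} {δ : ℝ} (hδ : 0 < δ)
    (hx : ∀ u : E, ‖u‖ ≤ δ → x + u ∈ Q) (hB : ∀ ξ, ‖w ξ‖ ≤ B * ‖ξ‖ ^ m)
    {ξ : StrongDual ℝ E} (hξ : ξ ∈ dualCone Q) :
    ‖Real.exp (-(ξ x)) • w ξ‖ ≤ B * (Real.exp (-(δ * ‖ξ‖)) * ‖ξ‖ ^ m) := by
  rw [norm_smul, Real.norm_of_nonneg (Real.exp_nonneg _)]
  have h1 : Real.exp (-(ξ x)) ≤ Real.exp (-(δ * ‖ξ‖)) :=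
    Real.exp_le_exp.2 (neg_le_neg (norm_le_of_mem_dualCone hδ hx hξ))
  calc _ ≤ Real.exp (-(δ * ‖ξ‖)) * (B * ‖ξ‖ ^ m) :=
        mul_le_mul h1 (hB ξ) (norm_nonneg _) (Real.exp_nonneg _)
    _ = _ := by ring

theorem continuous_laplaceWeight (hw : Continuous w) : Continuous (laplaceWeight w) := by
  unfold laplaceWeight; fun_prop

theorem norm_laplaceWeight_le (hB : ∀ ξ, ‖w ξ‖ ≤ B * ‖ξ‖ ^ m) (ξ : StrongDual ℝ E) :
    ‖laplaceWeight w ξ‖ ≤ B * ‖ξ‖ ^ (m + 1) := by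
  rw [laplaceWeight, norm_neg]
  change ‖ContinuousLinearMap.smulRight ξ (w ξ)‖ ≤ _
  rw [ContinuousLinearMap.norm_smulRight_apply]
  calc ‖ξ‖ * ‖w ξ‖ ≤ ‖ξ‖ * (B * ‖ξ‖ ^ m) := mul_le_mul_of_nonneg_left (hB ξ) (norm_nonneg _)
    _ = _ := by ring

/-- A functional dominating the norm on Q remains positive under perturbations of norm less than 1.
The open set supplies the strict positivity of the integrals. -/
theorem exists_open_subset_dualCone [FiniteDimensional ℝ E] (hQ : IsClosedCone Q)
    (hp : ∀ x ∈ Q, -x ∈ Q → x = 0) :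
    ∃ U : Set (StrongDual ℝ E), IsOpen U ∧ U.Nonempty ∧ U ⊆ dualCone Q ∧
      ∀ ξ ∈ U, ∀ x ∈ Q, x ≠ 0 → 0 < ξ x := by
  obtain ⟨ψ, hψ⟩ := hQ.exists_norm_le hp
  have key : ∀ ξ ∈ Metric.ball ψ 1, ∀ x ∈ Q, x ≠ 0 → 0 < ξ x := by
    intro ξ hξ x hx hx0
    rw [Metric.mem_ball, dist_eq_norm] at hξ
    have h1 : |(ξ - ψ) x| ≤ ‖ξ - ψ‖ * ‖x‖ := (ξ - ψ).le_opNorm x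
    have h2 := (abs_le.1 h1).1
    rw [_root_.sub_apply] at h2
    have h3 := hψ x hx
    have hn : 0 < ‖x‖ := norm_pos_iff.2 hx0
    nlinarith
  refine ⟨Metric.ball ψ 1, Metric.isOpen_ball, ⟨ψ, Metric.mem_ball_self one_pos⟩,
    fun ξ hξ x hx => ?_, key⟩
  by_cases hx0 : x = 0
  · simp [hx0]
  · exact (key ξ hξ x hx hx0).le

variable [FiniteDimensional ℝ E] [MeasurableSpace (StrongDual ℝ E)] [BorelSpace (StrongDual ℝ E)]
  (μ : Measure (StrongDual ℝ E)) [μ.IsAddHaarMeasure]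

theorem integrable_exp_neg_norm_mul_pow {δ : ℝ} (hδ : 0 < δ) (m : ℕ) :
    Integrable (fun ξ : StrongDual ℝ E => Real.exp (-(δ * ‖ξ‖)) * ‖ξ‖ ^ m) μ := by
  obtain ⟨N, hN⟩ : ∃ N, N = Module.finrank ℝ (StrongDual ℝ E) + 1 := ⟨_, rfl⟩
  have h1 : Integrable (fun ξ : StrongDual ℝ E => (1 + ‖ξ‖) ^ (-(N : ℝ))) μ :=
    integrable_one_add_norm (by rw [hN]; push_cast; linarith)
  set k := m + N with hk
  -- From y^k / k! ≤ exp y at y = δ(1 + ‖ξ‖): the integrand is at most c(1 + ‖ξ‖)^(-N), integrable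
  -- because N exceeds the dimension.
  set c : ℝ := Real.exp δ * k.factorial / δ ^ k with hc
  refine (h1.const_mul c).mono' (by fun_prop) (Eventually.of_forall fun ξ => ?_)
  rw [Real.norm_of_nonneg (by positivity), Real.rpow_neg (by positivity), Real.rpow_natCast,
    ← div_eq_mul_inv, le_div_iff₀ (by positivity)]
  have h2 : ‖ξ‖ ^ m ≤ (1 + ‖ξ‖) ^ m := pow_le_pow_left₀ (norm_nonneg _) (by linarith) m
  have h3 := Real.pow_div_factorial_le_exp (x := δ * (1 + ‖ξ‖)) (by positivity) k
  rw [div_le_iff₀ (by positivity), mul_pow] at h3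
  have h4 : Real.exp (-(δ * ‖ξ‖)) * ‖ξ‖ ^ m * (1 + ‖ξ‖) ^ N ≤
      Real.exp (-(δ * ‖ξ‖)) * (1 + ‖ξ‖) ^ k := by
    rw [hk, pow_add, mul_assoc]
    exact mul_le_mul_of_nonneg_left (mul_le_mul_of_nonneg_right h2 (by positivity))
      (Real.exp_nonneg _)
  refine h4.trans ?_
  rw [hc, le_div_iff₀ (by positivity)]
  calc Real.exp (-(δ * ‖ξ‖)) * (1 + ‖ξ‖) ^ k * δ ^ k
      = Real.exp (-(δ * ‖ξ‖)) * (δ ^ k * (1 + ‖ξ‖) ^ k) := by ring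
    _ ≤ Real.exp (-(δ * ‖ξ‖)) * (Real.exp (δ * (1 + ‖ξ‖)) * k.factorial) := by gcongr
    _ = Real.exp δ * k.factorial := by
      rw [← mul_assoc, ← Real.exp_add]; ring_nf

/-- The Laplace transform of a vector-valued weight over the dual cone. -/
noncomputable def laplace (Q : Set E) (w : StrongDual ℝ E → Y) (x : E) : Y :=
  ∫ ξ in dualCone Q, Real.exp (-(ξ x)) • w ξ ∂μ

theorem integrable_laplace (hw : Continuous w) (hB : ∀ ξ, ‖w ξ‖ ≤ B * ‖ξ‖ ^ m) {x : E}
    (hx : x ∈ interior Q) :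
    IntegrableOn (fun ξ : StrongDual ℝ E => Real.exp (-(ξ x)) • w ξ) (dualCone Q) μ := by
  obtain ⟨δ, hδ, hball⟩ := exists_pos_ball hx
  refine Integrable.mono' (((integrable_exp_neg_norm_mul_pow μ hδ m).const_mul B).restrict) ?_ ?_
  · have : Continuous fun ξ : StrongDual ℝ E => Real.exp (-(ξ x)) • w ξ := by fun_prop
    exact this.aestronglyMeasurable
  · refine (ae_restrict_iff' (isClosed_dualCone Q).measurableSet).2 (Eventually.of_forall ?_)
    intro ξ hξ
    exact exp_le_of_mem hδ (hball x (Metric.mem_ball_self hδ)) hB hξ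

/-- Differentiation under the integral. The derivative is again a Laplace transform, with a weight
growing one degree faster, so the statement can be iterated; this is why weights are vector-valued.
-/
theorem hasFDerivAt_laplace (hw : Continuous w) (hB : ∀ ξ, ‖w ξ‖ ≤ B * ‖ξ‖ ^ m) {x : E}
    (hx : x ∈ interior Q) :
    HasFDerivAt (laplace μ Q w) (laplace μ Q (laplaceWeight w) x) x := by
  obtain ⟨δ, hδ, hball⟩ := exists_pos_ball hx
  refine hasFDerivAt_integral_of_dominated_of_fderiv_le (𝕜 := ℝ) (s := Metric.ball x δ)
    (F := fun y (ξ : StrongDual ℝ E) => Real.exp (-(ξ y)) • w ξ)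
    (F' := fun y (ξ : StrongDual ℝ E) => Real.exp (-(ξ y)) • laplaceWeight w ξ)
    (bound := fun ξ => B * (Real.exp (-(δ * ‖ξ‖)) * ‖ξ‖ ^ (m + 1)))
    (Metric.ball_mem_nhds x hδ) (Eventually.of_forall fun y => ?_)
    (integrable_laplace μ hw hB hx) ?_ ?_
    (((integrable_exp_neg_norm_mul_pow μ hδ (m + 1)).const_mul B).restrict) ?_
  · have : Continuous fun ξ : StrongDual ℝ E => Real.exp (-(ξ y)) • w ξ := by fun_prop
    exact this.aestronglyMeasurable
  · have hw' := continuous_laplaceWeight hw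
    have : Continuous fun ξ : StrongDual ℝ E => Real.exp (-(ξ x)) • laplaceWeight w ξ := by
      fun_prop
    exact this.aestronglyMeasurable
  · refine (ae_restrict_iff' (isClosed_dualCone Q).measurableSet).2 (Eventually.of_forall ?_)
    intro ξ hξ y hy
    exact exp_le_of_mem hδ (hball y hy) (norm_laplaceWeight_le hB) hξ
  · refine Eventually.of_forall fun ξ y _ => ?_
    have h1 : HasFDerivAt (fun y => Real.exp (-(ξ y))) (Real.exp (-(ξ y)) • (-ξ)) y :=
      (ξ.hasFDerivAt.neg).exp
    convert h1.smul_const (w ξ) using 1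
    ext v
    simp [laplaceWeight, smul_smul]

theorem contDiffOn_laplace (hw : Continuous w) (hB : ∀ ξ, ‖w ξ‖ ≤ B * ‖ξ‖ ^ m) :
    ContDiffOn ℝ ∞ (laplace μ Q w) (interior Q) := by
  rw [contDiffOn_infty]
  intro k
  -- The target space and the growth degree change with each derivative.
  induction k generalizing Y m with
  | zero =>
    rw [Nat.cast_zero, contDiffOn_zero]
    exact fun x hx => (hasFDerivAt_laplace μ hw hB hx).continuousAt.continuousWithinAt
  | succ k ih =>
    rw [Nat.cast_succ, contDiffOn_succ_iff_fderiv_of_isOpen isOpen_interior]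
    refine ⟨fun x hx =>
      (hasFDerivAt_laplace μ hw hB hx).differentiableAt.differentiableWithinAt, by simp, ?_⟩
    exact (ih (continuous_laplaceWeight hw) (norm_laplaceWeight_le hB)).congr fun x hx =>
      (hasFDerivAt_laplace μ hw hB hx).fderiv

theorem setIntegral_pos_of_pos_on_open {D : Type*} [TopologicalSpace D] [MeasurableSpace D]
    [OpensMeasurableSpace D] {μ : Measure D} [μ.IsOpenPosMeasure] {S U : Set D} {h : D → ℝ}
    (hS : MeasurableSet S) (hi : IntegrableOn h S μ) (h0 : ∀ ξ ∈ S, 0 ≤ h ξ) (hU : IsOpen U)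
    (hne : U.Nonempty) (hUS : U ⊆ S) (hpos : ∀ ξ ∈ U, 0 < h ξ) : 0 < ∫ ξ in S, h ξ ∂μ := by
  rw [setIntegral_pos_iff_support_of_nonneg_ae
    ((ae_restrict_iff' hS).2 (Eventually.of_forall h0)) hi]
  refine (hU.measure_pos μ hne).trans_le (measure_mono fun ξ hξ => ⟨(hpos ξ hξ).ne', hUS hξ⟩)

end KoszulVinberg

/-! ### The Koszul-Vinberg characteristic function. -/

section KoszulVinberg

open MeasureTheory

variable {E : Type} [NormedAddCommGroup E] [NormedSpace ℝ E] {Q : Set E}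

theorem kvChar_weight_le (ξ : StrongDual ℝ E) : ‖(1 : ℝ)‖ ≤ 1 * ‖ξ‖ ^ 0 := by simp

variable [MeasurableSpace (StrongDual ℝ E)] (μ : Measure (StrongDual ℝ E))

/-- The Koszul-Vinberg characteristic function of a cone. -/
noncomputable def kvChar (Q : Set E) : E → ℝ := laplace μ Q fun _ => (1 : ℝ)

theorem kvChar_apply (x : E) : kvChar μ Q x = ∫ ξ in dualCone Q, Real.exp (-(ξ x)) ∂μ := by
  simp [kvChar, laplace]

variable [FiniteDimensional ℝ E] [BorelSpace (StrongDual ℝ E)] [μ.IsAddHaarMeasure]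

theorem contDiffOn_kvChar : ContDiffOn ℝ ∞ (kvChar μ Q) (interior Q) :=
  contDiffOn_laplace μ continuous_const kvChar_weight_le

theorem integrableOn_kvChar {x : E} (hx : x ∈ interior Q) :
    IntegrableOn (fun ξ : StrongDual ℝ E => Real.exp (-(ξ x))) (dualCone Q) μ := by
  have := integrable_laplace μ (w := fun _ => (1 : ℝ)) continuous_const kvChar_weight_le hx
  simpa using this

theorem kvChar_pos (hQ : IsClosedCone Q) (hp : ∀ x ∈ Q, -x ∈ Q → x = 0) {x : E}
    (hx : x ∈ interior Q) : 0 < kvChar μ Q x := by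
  obtain ⟨U, hU, hne, hUQ, -⟩ := exists_open_subset_dualCone hQ hp
  rw [kvChar_apply]
  exact setIntegral_pos_of_pos_on_open (isClosed_dualCone Q).measurableSet
    (integrableOn_kvChar μ hx) (fun ξ _ => Real.exp_nonneg _) hU hne hUQ fun ξ _ => Real.exp_pos _

theorem fderiv_kvChar_apply {x : E} (hx : x ∈ interior Q) (v : E) :
    fderiv ℝ (kvChar μ Q) x v = -∫ ξ in dualCone Q, Real.exp (-(ξ x)) * ξ v ∂μ := by
  have h1 := hasFDerivAt_laplace μ (w := fun _ => (1 : ℝ)) continuous_const kvChar_weight_le hx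
  have hi := integrable_laplace μ (continuous_laplaceWeight (w := fun _ => (1 : ℝ)) continuous_const)
    (norm_laplaceWeight_le kvChar_weight_le) hx
  rw [kvChar, h1.fderiv, laplace, ContinuousLinearMap.integral_apply hi, ← integral_neg]
  congr 1
  ext ξ
  simp [laplaceWeight]

theorem fderiv_fderiv_kvChar_apply {x : E} (hx : x ∈ interior Q) (v : E) :
    fderiv ℝ (fderiv ℝ (kvChar μ Q)) x v v =
      ∫ ξ in dualCone Q, Real.exp (-(ξ x)) * (ξ v) ^ 2 ∂μ := by
  have hw := continuous_laplaceWeight (E := E) (w := fun _ => (1 : ℝ)) continuous_const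
  have hB := norm_laplaceWeight_le (E := E) (w := fun _ => (1 : ℝ)) kvChar_weight_le
  have h1 := hasFDerivAt_laplace μ hw hB hx
  have hi := integrable_laplace μ (continuous_laplaceWeight hw) (norm_laplaceWeight_le hB) hx
  have h2 : fderiv ℝ (kvChar μ Q) =ᶠ[𝓝 x] laplace μ Q (laplaceWeight fun _ => (1 : ℝ)) := by
    filter_upwards [isOpen_interior.mem_nhds hx] with y hy
    exact (hasFDerivAt_laplace μ (w := fun _ => (1 : ℝ)) continuous_const kvChar_weight_le hy).fderiv
  rw [h2.fderiv_eq, h1.fderiv, laplace, ContinuousLinearMap.integral_apply hi,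
    ContinuousLinearMap.integral_apply (hi.apply_continuousLinearMap v)]
  congr 1
  ext ξ
  simp [laplaceWeight]
  ring

theorem fderiv_kvChar_self_neg (hQ : IsClosedCone Q) (hp : ∀ x ∈ Q, -x ∈ Q → x = 0) {x : E}
    (hx : x ∈ interior Q) (hx0 : x ≠ 0) : fderiv ℝ (kvChar μ Q) x x < 0 := by
  obtain ⟨U, hU, hne, hUQ, hpos⟩ := exists_open_subset_dualCone hQ hp
  rw [fderiv_kvChar_apply μ hx, neg_lt_zero]
  refine setIntegral_pos_of_pos_on_open (isClosed_dualCone Q).measurableSet ?_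
    (fun ξ hξ => mul_nonneg (Real.exp_nonneg _) (hξ x (interior_subset hx))) hU hne hUQ
    fun ξ hξ => mul_pos (Real.exp_pos _) (hpos ξ hξ x (interior_subset hx) hx0)
  have := integrable_laplace μ (w := fun ξ : StrongDual ℝ E => ξ x) (B := ‖x‖) (m := 1)
    (by fun_prop) (fun ξ => by rw [pow_one, mul_comm]; exact ξ.le_opNorm x) hx
  simpa using this

theorem fderiv_fderiv_kvChar_pos (hQ : IsClosedCone Q) (hp : ∀ x ∈ Q, -x ∈ Q → x = 0) {x : E}
    (hx : x ∈ interior Q) {v : E} (hv : v ≠ 0) : 0 < fderiv ℝ (fderiv ℝ (kvChar μ Q)) x v v := by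
  obtain ⟨U, hU, ⟨ψ, hψ⟩, hUQ, -⟩ := exists_open_subset_dualCone hQ hp
  rw [fderiv_fderiv_kvChar_apply μ hx]
  obtain ⟨η, hη⟩ : ∃ η : StrongDual ℝ E, η v ≠ 0 := by
    obtain ⟨η, -, h⟩ := exists_dual_vector ℝ v (norm_ne_zero_iff.2 hv)
    exact ⟨η, by rw [h]; exact_mod_cast (norm_ne_zero_iff.2 hv)⟩
  have hUv : IsOpen (U ∩ {ξ : StrongDual ℝ E | ξ v ≠ 0}) :=
    hU.inter (isOpen_ne_fun (by fun_prop) continuous_const)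
  refine setIntegral_pos_of_pos_on_open (isClosed_dualCone Q).measurableSet ?_
    (fun ξ _ => mul_nonneg (Real.exp_nonneg _) (sq_nonneg _)) hUv ?_
    (inter_subset_left.trans hUQ) fun ξ hξ => mul_pos (Real.exp_pos _) (sq_pos_iff.2 hξ.2)
  · have := integrable_laplace μ (w := fun ξ : StrongDual ℝ E => (ξ v) ^ 2) (B := ‖v‖ ^ 2) (m := 2)
      (by fun_prop) (fun ξ => by
        rw [Real.norm_of_nonneg (sq_nonneg _), ← mul_pow, ← sq_abs, mul_comm]
        exact pow_le_pow_left₀ (abs_nonneg _) (ξ.le_opNorm v) 2) hx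
    simpa using this
  -- The open set of functionals is not inside the hyperplane ξ v = 0: a zero at ψ is removed by a
  -- small perturbation along η.
  · by_cases h0 : ψ v = 0
    · have hc : Tendsto (fun t : ℝ => ψ + t • η) (𝓝[≠] 0) (𝓝 ψ) := by
        have : Continuous fun t : ℝ => ψ + t • η := by fun_prop
        have h1 := this.tendsto 0
        rw [zero_smul, add_zero] at h1
        exact h1.mono_left nhdsWithin_le_nhds
      obtain ⟨t, htU, ht0⟩ := ((hc.eventually (hU.mem_nhds hψ)).and
        self_mem_nhdsWithin).exists
      refine ⟨_, htU, ?_⟩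
      change (ψ + t • η) v ≠ 0
      simpa [h0] using ⟨ht0, hη⟩
    · exact ⟨ψ, hψ, h0⟩

/-- Substitute ξ ↦ tξ, which preserves the dual cone and scales Haar measure. -/
theorem kvChar_smul (x : E) {t : ℝ} (ht : 0 < t) :
    kvChar μ Q (t • x) = (t ^ Module.finrank ℝ E)⁻¹ * kvChar μ Q x := by
  have hm := (isClosed_dualCone Q).measurableSet
  simp only [kvChar_apply, ← integral_indicator hm]
  have h1 := Measure.integral_comp_smul μ
    ((dualCone Q).indicator fun ξ : StrongDual ℝ E => Real.exp (-(ξ x))) t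
  have hfr : Module.finrank ℝ (StrongDual ℝ E) = Module.finrank ℝ E := by
    rw [← (LinearMap.toContinuousLinearMap (𝕜 := ℝ) (E := E) (F' := ℝ)).finrank_eq]
    exact Subspace.dual_finrank_eq
  rw [hfr, abs_of_pos (by positivity), smul_eq_mul] at h1
  rw [← h1]
  congr 1
  ext ξ
  have hiff : t • ξ ∈ dualCone Q ↔ ξ ∈ dualCone Q := by
    constructor
    · intro h y hy
      have := h y hy
      rw [_root_.smul_apply, smul_eq_mul] at this
      exact nonneg_of_mul_nonneg_right this ht
    · intro h y hy
      exact mul_nonneg ht.le (h y hy)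
  by_cases hξ : ξ ∈ dualCone Q
  · rw [indicator_of_mem hξ, indicator_of_mem (hiff.2 hξ)]; simp
  · rw [indicator_of_notMem hξ, indicator_of_notMem (mt hiff.1 hξ)]

/-- Substitute ξ ↦ ξ ∘ g. The transpose preserves the dual cone, and determinant ±1 makes it
preserve Haar measure. -/
theorem kvChar_map (g : E ≃L[ℝ] E) (hg : ∀ x, g x ∈ Q ↔ x ∈ Q)
    (hdet : |LinearMap.det (g : E →ₗ[ℝ] E)| = 1) (x : E) :
    kvChar μ Q (g x) = kvChar μ Q x := by
  have hm := (isClosed_dualCone Q).measurableSet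
  simp only [kvChar_apply, ← integral_indicator hm]
  let e : Module.Dual ℝ E ≃ₗ[ℝ] StrongDual ℝ E :=
    LinearMap.toContinuousLinearMap (𝕜 := ℝ) (E := E) (F' := ℝ)
  let L : StrongDual ℝ E →ₗ[ℝ] StrongDual ℝ E :=
    e.toLinearMap ∘ₗ (g : E →ₗ[ℝ] E).dualMap ∘ₗ e.symm.toLinearMap
  have hL : ∀ ξ y, L ξ y = ξ (g y) := fun ξ y => rfl
  have hLdet : LinearMap.det L = LinearMap.det (g : E →ₗ[ℝ] E) := by
    exact (LinearMap.det_conj _ e).trans (LinearMap.det_dualMap _)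
  have hne : LinearMap.det L ≠ 0 := fun h0 => by
    rw [hLdet] at h0; rw [h0, abs_zero] at hdet; exact zero_ne_one hdet
  have hmap := Measure.map_linearMap_addHaar_eq_smul_addHaar μ hne
  rw [abs_inv, hLdet, hdet, inv_one, ENNReal.ofReal_one, one_smul] at hmap
  have hLc : Continuous L := L.continuous_of_finiteDimensional
  have hmeas : Measurable ((dualCone Q).indicator fun ξ : StrongDual ℝ E => Real.exp (-(ξ x))) :=
    Measurable.indicator (by
      have : Continuous fun ξ : StrongDual ℝ E => Real.exp (-(ξ x)) := by fun_prop
      exact this.measurable) hm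
  conv_rhs => rw [← hmap, integral_map hLc.aemeasurable hmeas.aestronglyMeasurable]
  congr 1
  ext ξ
  have hiff : L ξ ∈ dualCone Q ↔ ξ ∈ dualCone Q := by
    constructor
    · intro h y hy
      have h1 := h (g.symm y) ((hg _).1 (by rwa [g.apply_symm_apply]))
      rwa [hL, g.apply_symm_apply] at h1
    · intro h y hy
      rw [hL]
      exact h _ ((hg y).2 hy)
  by_cases hξ : ξ ∈ dualCone Q
  · rw [indicator_of_mem hξ, indicator_of_mem (hiff.2 hξ), hL]
  · rw [indicator_of_notMem hξ, indicator_of_notMem (mt hiff.1 hξ)]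

theorem kvChar_convex {x y : E} (hx : x ∈ interior Q) (hy : y ∈ interior Q) {a b : ℝ}
    (ha : 0 ≤ a) (hb : 0 ≤ b) (hab : a + b = 1) (hxy : a • x + b • y ∈ interior Q) :
    kvChar μ Q (a • x + b • y) ≤ a * kvChar μ Q x + b * kvChar μ Q y := by
  simp only [kvChar_apply]
  rw [← integral_const_mul, ← integral_const_mul,
    ← integral_add ((integrableOn_kvChar μ hx).const_mul a) ((integrableOn_kvChar μ hy).const_mul b)]
  refine integral_mono (integrableOn_kvChar μ hxy)
    (((integrableOn_kvChar μ hx).const_mul a).add ((integrableOn_kvChar μ hy).const_mul b))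
    fun ξ => ?_
  have := convexOn_exp.2 (mem_univ (-(ξ x))) (mem_univ (-(ξ y))) ha hb hab
  simp only [smul_eq_mul] at this
  change Real.exp (-(ξ (a • x + b • y))) ≤ a * Real.exp (-(ξ x)) + b * Real.exp (-(ξ y))
  have he : -(ξ (a • x + b • y)) = a * -(ξ x) + b * -(ξ y) := by
    rw [map_add, map_smul, map_smul]
    simp only [smul_eq_mul]
    ring
  rwa [he]

end KoszulVinberg

/-- The smooth function `f`, strictly convex on the cone over a properly convex domain, and the
superadditive positively homogeneous function `F` with `{F ≥ 1} = {f ≤ 1}`, are invariant under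
the automorphisms of the cone of determinant `±1`. -/
structure IsConeFunction {E : Type} [NormedAddCommGroup E] [NormedSpace ℝ E] (Q : Set E)
    (f F : E → ℝ) : Prop where
  contDiffOn : ContDiffOn ℝ ∞ f (interior Q)
  hess_pos : ∀ x ∈ interior Q, ∀ v ≠ 0, 0 < fderiv ℝ (fderiv ℝ f) x v v
  fderiv_self_neg : ∀ x ∈ interior Q, fderiv ℝ f x x < 0
  pos : ∀ x ∈ interior Q, 0 < F x
  smul : ∀ x ∈ interior Q, ∀ t : ℝ, 0 < t → F (t • x) = t * F x
  superadd : ∀ x ∈ interior Q, ∀ y ∈ interior Q, F x + F y ≤ F (x + y)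
  continuousOn : ContinuousOn F (interior Q)
  one_le_iff : ∀ x ∈ interior Q, 1 ≤ F x ↔ f x ≤ 1
  eq_one : ∀ x ∈ interior Q, F x = 1 → f x = 1
  map : ∀ g : E ≃L[ℝ] E, (∀ x, g x ∈ Q ↔ x ∈ Q) → |LinearMap.det (g : E →ₗ[ℝ] E)| = 1 →
    ∀ x, F (g x) = F x

/-- f is the characteristic function, homogeneous of degree -d with d the dimension, so F = f^(-1/d)
is homogeneous of degree one. Smoothness and the Hessian are read off f; superadditivity is a
property of F. -/
theorem IsClosedCone.exists_coneFunction {E : Type} [NormedAddCommGroup E] [NormedSpace ℝ E]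
    [FiniteDimensional ℝ E] [Nontrivial E] {Q : Set E} (hQ : IsClosedCone Q)
    (hp : ∀ x ∈ Q, -x ∈ Q → x = 0) : ∃ f F : E → ℝ, IsConeFunction Q f F := by
  let _ : MeasurableSpace (StrongDual ℝ E) := borel _
  have _ : BorelSpace (StrongDual ℝ E) := ⟨rfl⟩
  let μ : MeasureTheory.Measure (StrongDual ℝ E) := MeasureTheory.Measure.addHaar
  set d := Module.finrank ℝ E with hd
  have hd0 : 0 < d := Module.finrank_pos
  have hdr : (0 : ℝ) < d := by exact_mod_cast hd0
  have h0 : (0 : E) ∉ interior Q := fun h => by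
    obtain ⟨x, hx⟩ := exists_ne (0 : E)
    obtain ⟨δ, hδ, hb⟩ := Metric.isOpen_iff.1 isOpen_interior _ h
    have key : ∀ s : ℝ, |s| * ‖x‖ < δ → s • x ∈ Q := fun s hs => interior_subset (hb (by
      simpa [norm_smul] using hs))
    have hn : 0 < ‖x‖ := norm_pos_iff.2 hx
    have hs : |δ / (2 * ‖x‖)| * ‖x‖ < δ := by
      rw [abs_of_pos (by positivity)]
      field_simp; norm_num
    have h1 := hp _ (key _ hs) (by rw [← neg_smul]; exact key _ (by rwa [abs_neg]))
    have : δ / (2 * ‖x‖) ≠ 0 := by positivity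
    exact hx ((smul_eq_zero.1 h1).resolve_left this)
  set f := kvChar μ Q with hf
  have hfpos : ∀ x ∈ interior Q, 0 < f x := fun x hx => kvChar_pos μ hQ hp hx
  set F : E → ℝ := fun x => f x ^ (-(d : ℝ)⁻¹) with hF
  have hFpos : ∀ x ∈ interior Q, 0 < F x := fun x hx => Real.rpow_pos_of_pos (hfpos x hx) _
  have hFsmul : ∀ x ∈ interior Q, ∀ t : ℝ, 0 < t → F (t • x) = t * F x := by
    intro x hx t ht
    simp only [hF, hf]
    rw [kvChar_smul μ x ht, Real.mul_rpow (by positivity) (hfpos x hx).le]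
    congr 1
    rw [Real.inv_rpow (by positivity), Real.rpow_neg (by positivity), inv_inv]
    exact Real.pow_rpow_inv_natCast ht.le hd0.ne'
  have hone : ∀ x ∈ interior Q, 1 ≤ F x ↔ f x ≤ 1 := by
    intro x hx
    simp only [hF]
    have hp := Real.rpow_pos_of_pos (hfpos x hx) (d : ℝ)⁻¹
    rw [Real.rpow_neg (hfpos x hx).le, one_le_inv₀ hp]
    rw [Real.rpow_le_one_iff_of_pos (hfpos x hx)]
    have h1 : ¬ (d : ℝ)⁻¹ ≤ 0 := not_le.2 (inv_pos.2 hdr)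
    have h2 : 0 ≤ (d : ℝ)⁻¹ := (inv_pos.2 hdr).le
    simp only [h1, h2, and_false, and_true, false_or]
  refine ⟨f, F, contDiffOn_kvChar μ, fun x hx v hv => fderiv_fderiv_kvChar_pos μ hQ hp hx hv,
    fun x hx => fderiv_kvChar_self_neg μ hQ hp hx fun h => h0 (h ▸ hx), hFpos, hFsmul, ?_, ?_, hone,
    fun x hx h1 => ?_, fun g hg hdet x => ?_⟩
  -- Normalise x and y to the level F = 1. The set {f ≤ 1} = {F ≥ 1} is convex, and (x + y)/(F x + F
  -- y) is a convex combination of the normalised points.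
  · intro x hx y hy
    have hax := hFpos x hx
    have hby := hFpos y hy
    have hxy : x + y ∈ interior Q := hQ.smul_add_mem_interior hx (interior_subset hy)
    have hx1 : (F x)⁻¹ • x ∈ interior Q := hQ.smul_mem_interior hx (inv_pos.2 hax)
    have hy1 : (F y)⁻¹ • y ∈ interior Q := hQ.smul_mem_interior hy (inv_pos.2 hby)
    have hfx : f ((F x)⁻¹ • x) ≤ 1 := by
      rw [← hone _ hx1, hFsmul x hx _ (inv_pos.2 hax), inv_mul_cancel₀ hax.ne']
    have hfy : f ((F y)⁻¹ • y) ≤ 1 := by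
      rw [← hone _ hy1, hFsmul y hy _ (inv_pos.2 hby), inv_mul_cancel₀ hby.ne']
    have hsum : 0 < F x + F y := add_pos hax hby
    have heq : (F x / (F x + F y)) • (F x)⁻¹ • x + (F y / (F x + F y)) • (F y)⁻¹ • y =
        (F x + F y)⁻¹ • (x + y) := by
      rw [smul_smul, smul_smul, smul_add]
      congr 2 <;> field_simp
    have hmem : (F x + F y)⁻¹ • (x + y) ∈ interior Q := hQ.smul_mem_interior hxy (inv_pos.2 hsum)
    have hab : F x / (F x + F y) + F y / (F x + F y) = 1 := by
      rw [← add_div, div_self hsum.ne']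
    have hconv := kvChar_convex μ hx1 hy1 (div_nonneg hax.le hsum.le) (div_nonneg hby.le hsum.le)
      hab (heq ▸ hmem)
    rw [heq] at hconv
    have hle : f ((F x + F y)⁻¹ • (x + y)) ≤ 1 := by
      refine hconv.trans ?_
      rw [← hab]
      exact add_le_add (mul_le_of_le_one_right (div_nonneg hax.le hsum.le) hfx)
        (mul_le_of_le_one_right (div_nonneg hby.le hsum.le) hfy)
    rw [← hone _ hmem, hFsmul _ hxy _ (inv_pos.2 hsum), inv_mul_eq_div, le_div_iff₀ hsum,
      one_mul] at hle
    exact hle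
  · exact (contDiffOn_kvChar μ).continuousOn.rpow_const fun x hx => Or.inl (hfpos x hx).ne'
  · simp only [hF] at h1
    rw [Real.rpow_neg (hfpos x hx).le, inv_eq_one] at h1
    rw [← Real.rpow_inv_natCast_pow (hfpos x hx).le hd0.ne', h1, one_pow]
  · simp only [hF, hf]
    rw [kvChar_map μ g hg hdet]

section Actions

variable {n : ℕ}

theorem continuous_smul_projSphere (g : LinAut n) : Continuous fun p : ProjSphere n => g • p := by
  rw [isQuotientMap_rayOfNeZero.continuous_iff]
  have h : Continuous fun x : {x : Vec n // x ≠ 0} =>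
      (⟨g x.1, by simpa using x.2⟩ : {x : Vec n // x ≠ 0}) :=
    ((g : Vec n →ₗ[ℝ] Vec n).continuous_of_finiteDimensional.comp continuous_subtype_val).subtype_mk _
  exact continuous_rayOfNeZero.comp h

instance : ContinuousConstSMul (LinAut n) (ProjSphere n) := ⟨continuous_smul_projSphere⟩

end Actions

/-! ### Slabs of a product end neighborhood. -/

namespace ProductStructure

variable {n : ℕ} {G : Subgroup (LinAut n)} {W : Set (ProjSphere n)} (P : ProductStructure G W)

/-- The part of a product `X × (0,1)` where the second coordinate lies in `J`. -/
def slab (J : Set ℝ) : Set (ProjSphere n) := {p | ∃ h : p ∈ W, ((P.homeo ⟨p, h⟩).2 : ℝ) ∈ J}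

theorem slab_subset (J : Set ℝ) : P.slab J ⊆ W := fun _ h => h.1

theorem slab_mono {I J : Set ℝ} (h : I ⊆ J) : P.slab I ⊆ P.slab J := fun _ ⟨h1, h2⟩ => ⟨h1, h h2⟩

theorem symm_mem (x : P.X) (t : Ioo (0 : ℝ) 1) : (P.homeo.symm (x, t) : ProjSphere n) ∈ W :=
  (P.homeo.symm (x, t)).2

theorem symm_mem_slab {J : Set ℝ} (x : P.X) (t : Ioo (0 : ℝ) 1) (h : (t : ℝ) ∈ J) :
    (P.homeo.symm (x, t) : ProjSphere n) ∈ P.slab J :=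
  ⟨P.symm_mem x t, by simpa using h⟩

theorem slab_eq_image (J : Set ℝ) :
    P.slab J = (fun q : P.X × Ioo (0 : ℝ) 1 => (P.homeo.symm q : ProjSphere n)) ''
      (univ ×ˢ ((↑) ⁻¹' J)) := by
  ext p
  constructor
  · rintro ⟨h, hJ⟩
    exact ⟨P.homeo ⟨p, h⟩, ⟨mem_univ _, hJ⟩, by simp⟩
  · rintro ⟨q, ⟨-, hq⟩, rfl⟩
    exact P.symm_mem_slab q.1 q.2 hq

theorem continuous_symm : Continuous fun q : P.X × Ioo (0 : ℝ) 1 =>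
    (P.homeo.symm q : ProjSphere n) := continuous_subtype_val.comp P.homeo.symm.continuous

theorem isOpen_slab (hW : IsOpen W) {J : Set ℝ} (hJ : IsOpen J) : IsOpen (P.slab J) := by
  rw [slab_eq_image]
  exact (hW.isOpenMap_subtype_val.comp P.homeo.symm.isOpenMap) _
    (isOpen_univ.prod (hJ.preimage continuous_subtype_val))

theorem isPreconnected_slab (hW : IsPreconnected W) {J : Set ℝ} (hJ : IsPreconnected J)
    (hJ1 : J ⊆ Ioo 0 1) : IsPreconnected (P.slab J) := by
  rw [slab_eq_image]
  refine IsPreconnected.image (IsPreconnected.prod ?_ ?_) _ P.continuous_symm.continuousOn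
  · have h1 : IsPreconnected (univ : Set W) :=
      isPreconnected_iff_preconnectedSpace.1 hW |>.isPreconnected_univ
    rcases isEmpty_or_nonempty P.X with h | h
    · rw [univ_eq_empty_iff.2 h]; exact isPreconnected_empty
    · convert h1.image (fun w => (P.homeo w).1) (by fun_prop)
      refine (image_univ_of_surjective fun x => ?_).symm
      exact ⟨P.homeo.symm (x, ⟨1 / 2, by norm_num, by norm_num⟩), by simp⟩
  · refine IsInducing.subtypeVal.isPreconnected_image.1 ?_
    rwa [Subtype.image_preimage_coe, inter_eq_right.2 hJ1]

theorem smul_mem_slab (hG : ∀ g ∈ G, g • W = W) {J : Set ℝ} {g : LinAut n} (hg : g ∈ G)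
    {p : ProjSphere n} (hp : p ∈ P.slab J) : g • p ∈ P.slab J := by
  obtain ⟨h, hJ⟩ := hp
  have h' : g • p ∈ W := hG g hg ▸ Set.smul_mem_smul_set h
  refine ⟨h', ?_⟩
  rw [P.equivariant ⟨g, hg⟩ ⟨p, h⟩ ⟨g • p, h'⟩ rfl]
  exact hJ

theorem smul_mem_slab_iff (hG : ∀ g ∈ G, g • W = W) {J : Set ℝ} {g : LinAut n} (hg : g ∈ G)
    {p : ProjSphere n} : g • p ∈ P.slab J ↔ p ∈ P.slab J := by
  refine ⟨fun h => ?_, P.smul_mem_slab hG hg⟩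
  rw [← inv_smul_smul g p]
  exact P.smul_mem_slab hG (G.inv_mem hg) h

/-- The group is cocompact on X and trivial on the interval, so one g serves all heights of a leaf
at once. -/
theorem exists_isCompact_subset_slab {J : Set ℝ} (hJ : IsCompact J) (hJ1 : J ⊆ Ioo 0 1)
    (hG : ∀ g ∈ G, g • W = W) : ∃ Z ⊆ P.slab J, IsCompact Z ∧
      ∀ p ∈ W, ∃ g ∈ G, ∀ q ∈ P.slab J,
        (∀ (hp : p ∈ W) (hq : q ∈ W), (P.homeo ⟨p, hp⟩).1 = (P.homeo ⟨q, hq⟩).1) → g • q ∈ Z := by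
  obtain ⟨C, hC, hco⟩ := P.cocompact
  have hJc : IsCompact ((↑) ⁻¹' J : Set (Ioo (0 : ℝ) 1)) := by
    rw [Subtype.isCompact_iff, Subtype.image_preimage_coe, inter_eq_right.2 hJ1]; exact hJ
  refine ⟨_, ?_, (hC.prod hJc).image P.continuous_symm, fun p hp => ?_⟩
  · rintro _ ⟨q, ⟨-, hq⟩, rfl⟩
    exact P.symm_mem_slab q.1 q.2 hq
  · obtain ⟨g, hg⟩ := hco (P.homeo ⟨p, hp⟩).1
    refine ⟨g, g.2, fun q ⟨hq, hqJ⟩ he => ?_⟩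
    have h' : (g : LinAut n) • q ∈ W := hG g g.2 ▸ Set.smul_mem_smul_set hq
    have h2 := P.equivariant g ⟨q, hq⟩ ⟨(g : LinAut n) • q, h'⟩ rfl
    refine ⟨P.homeo ⟨(g : LinAut n) • q, h'⟩, ?_, by simp⟩
    rw [h2, ← he hp hq]
    exact ⟨hg, hqJ⟩

end ProductStructure

/-! ### Proper p-end neighborhoods and the end group as stabilizer of the radial neighborhood. -/

namespace ConvexProjOrbifold

variable {n : ℕ} {O : ConvexProjOrbifold n}

theorem continuous_proj : Continuous O.proj := continuous_quotient_mk'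

theorem proj_smul {g : LinAut n} (hg : g ∈ O.grp) (p : ProjSphere n) :
    O.proj (g • p) = O.proj p :=
  Quotient.sound ⟨⟨g, hg⟩, rfl⟩

theorem IsProperPEndNhd.subset_dom {W : Set (ProjSphere n)} (h : O.IsProperPEndNhd W) :
    W ⊆ O.dom := by
  obtain ⟨-, ⟨U, -, x, -, rfl⟩, -⟩ := h
  exact (connectedComponentIn_subset _ _).trans inter_subset_left

theorem IsProperPEndNhd.subset_interior {W : Set (ProjSphere n)} (h : O.IsProperPEndNhd W) :
    W ⊆ interior O.dom := interior_maximal h.subset_dom h.1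

theorem IsProperPEndNhd.isPreconnected {W : Set (ProjSphere n)} (h : O.IsProperPEndNhd W) :
    IsPreconnected W := by
  obtain ⟨-, ⟨U, -, x, -, rfl⟩, -⟩ := h
  exact isPreconnected_connectedComponentIn

theorem IsProperPEndNhd.nonempty {W : Set (ProjSphere n)} (h : O.IsProperPEndNhd W) :
    W.Nonempty := by
  obtain ⟨-, ⟨U, -, x, hx, rfl⟩, -⟩ := h
  exact ⟨x, mem_connectedComponentIn hx⟩

/-- A deck transformation that maps a point of a proper p-end neighborhood into it preserves it. -/
theorem IsProperPEndNhd.mem_stab {W : Set (ProjSphere n)} (h : O.IsProperPEndNhd W)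
    {g : LinAut n} (hg : g ∈ O.grp) {p : ProjSphere n} (hp : p ∈ W) (hgp : g • p ∈ W) :
    g ∈ O.stab W := by
  obtain ⟨-, ⟨U, -, x, hx, rfl⟩, -⟩ := h
  refine ⟨hg, ?_⟩
  have hinv : g • (O.dom ∩ O.proj ⁻¹' U) = O.dom ∩ O.proj ⁻¹' U := by
    rw [Set.smul_set_inter, O.invariant g hg]
    congr 1
    ext q
    rw [Set.mem_smul_set_iff_inv_smul_mem]
    simp only [mem_preimage, proj_smul (O.grp.inv_mem hg)]
  have himg : g • connectedComponentIn (O.dom ∩ O.proj ⁻¹' U) p =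
      connectedComponentIn (O.dom ∩ O.proj ⁻¹' U) (g • p) := by
    have := (Homeomorph.smul g : ProjSphere n ≃ₜ ProjSphere n).image_connectedComponentIn
      (connectedComponentIn_subset _ _ hp)
    change g • _ = connectedComponentIn (g • _) _ at this
    rwa [hinv] at this
  change g • _ = _
  rw [connectedComponentIn_eq hp, himg, ← connectedComponentIn_eq hgp, ← connectedComponentIn_eq hp]

/-- The end sequence is exiting in the quotient, so far enough out it avoids all translates of a
compact set simultaneously. -/
theorem PEnd.exists_disjoint (E : O.PEnd) {B : Set (ProjSphere n)} (hB : IsCompact B)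
    (hBd : B ⊆ O.dom) : ∃ i, ∀ g ∈ O.grp, ∀ p ∈ B, g • p ∉ E.nhd i := by
  have hfin := E.exiting (O.proj '' B) (image_mono hBd) (hB.image continuous_proj)
  obtain ⟨i, hi⟩ := hfin.exists_notMem
  refine ⟨i, fun g hg p hp hgp => hi ⟨g • p, hgp, ?_⟩⟩
  rw [mem_preimage, proj_smul hg]
  exact mem_image_of_mem _ hp

namespace PREnd

variable (E : O.PREnd)

theorem smul_rad {g : LinAut n} (hg : g ∈ O.stab E.rad) : g • E.rad = E.rad := hg.2

theorem exists_nhd_slab (i : ℕ) : ∃ ε : ℝ, 0 < ε ∧ ε < 1 ∧ E.prod.slab (Iic ε) ⊆ E.nhd i := by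
  obtain ⟨ε, hε, h⟩ := E.leaf_toEnd i
  refine ⟨min (ε / 2) (1 / 2), by positivity, by
    exact (min_le_right _ _).trans_lt (by norm_num), fun p ⟨hp, ht⟩ => h ⟨p, hp⟩ ?_⟩
  exact lt_of_le_of_lt (le_trans ht (min_le_left _ _)) (by linarith)

/-- The truncations of a radial end neighborhood are closed in the interior of the domain. -/
theorem mem_slab_of_mem_closure {ε : ℝ} (hε1 : ε < 1) {p : ProjSphere n}
    (hp : p ∈ closure (E.prod.slab (Iic ε))) (hpd : p ∈ interior O.dom) :
    p ∈ E.prod.slab (Iic ε) := by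
  obtain ⟨B, hB, hBp, hBd⟩ := exists_compact_subset isOpen_interior hpd
  obtain ⟨i, hi⟩ := E.toPEnd.exists_disjoint hB (hBd.trans interior_subset)
  obtain ⟨η, hη, -, hηi⟩ := E.exists_nhd_slab i
  -- Near p only the heights in [η, ε] occur, since lower ones lie in a member of the end sequence
  -- that B avoids. This slab is, near p, a finite union of translates of the compact Z, hence
  -- closed.
  have hsub : Icc η ε ⊆ Ioo 0 1 := fun t ht => ⟨hη.trans_le ht.1, ht.2.trans_lt hε1⟩
  obtain ⟨Z, hZ, hZc, hco⟩ := E.prod.exists_isCompact_subset_slab isCompact_Icc hsub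
    fun g hg => E.smul_rad hg
  have hZd : Z ⊆ O.dom := (hZ.trans (E.prod.slab_subset _)).trans E.rad_proper.subset_dom
  have hfin := O.properlyDiscontinuous (Z ∪ B) (union_subset hZd (hBd.trans interior_subset))
    (hZc.union hB)
  set T := {g : LinAut n | g ∈ O.stab E.rad ∧ ((g • (Z ∪ B)) ∩ (Z ∪ B)).Nonempty} with hT
  have hTfin : T.Finite := hfin.subset fun g hg => ⟨hg.1.1, hg.2⟩
  have hcl : IsClosed (⋃ g ∈ T, (fun q : ProjSphere n => g • q) ⁻¹' Z) :=
    hTfin.isClosed_biUnion fun g _ => hZc.isClosed.preimage (continuous_smul_projSphere g)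
  have hmem : p ∈ closure (E.prod.slab (Iic ε) ∩ interior B) := by
    rw [inter_comm]; exact isOpen_interior.inter_closure ⟨hBp, hp⟩
  have := closure_minimal (fun q hq => ?_) hcl hmem
  · simp only [mem_iUnion] at this
    obtain ⟨g, hg, hgp⟩ := this
    rw [← E.prod.smul_mem_slab_iff (fun g hg => E.smul_rad hg) hg.1]
    exact E.prod.slab_mono Icc_subset_Iic_self (hZ hgp)
  · obtain ⟨hqs, hqB⟩ := hq
    have hqB' := interior_subset hqB
    have hq2 : q ∈ E.prod.slab (Icc η ε) := by
      refine ⟨hqs.1, ?_, hqs.2⟩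
      by_contra! hlt
      have := hi 1 O.grp.one_mem q hqB'
      rw [one_smul] at this
      exact this (hηi ⟨hqs.1, hlt.le⟩)
    obtain ⟨g, hg, hgZ⟩ := hco q hqs.1
    have hgq := hgZ q hq2 fun _ _ => rfl
    refine mem_biUnion (x := g) ⟨hg, g • q, Set.smul_mem_smul_set (Or.inr hqB'), Or.inl hgq⟩ hgq

end PREnd

end ConvexProjOrbifold

namespace ConvexProjOrbifold.PREnd

variable {n : ℕ} {O : ConvexProjOrbifold n} (E : O.PREnd)

theorem exists_mem_slab (hne : E.rad.Nonempty) {t : ℝ} (ht : t ∈ Ioo (0 : ℝ) 1) :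
    (E.prod.slab {t}).Nonempty := by
  obtain ⟨p, hp⟩ := hne
  exact ⟨_, E.prod.symm_mem_slab (E.prod.homeo ⟨p, hp⟩).1 ⟨t, ht⟩ rfl⟩

/-- Low points of the leaves lie in `nhd 0`, and the stabilizer of `rad` keeps heights; so it sends
some point of `nhd 0` into `nhd 0`. -/
theorem stab_rad_le_grp : O.stab E.rad ≤ E.toPEnd.grp := by
  obtain ⟨ε, hε, hε1, hsub⟩ := E.exists_nhd_slab 0
  obtain ⟨p, hp⟩ := E.exists_mem_slab E.rad_proper.nonempty ⟨hε, hε1⟩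
  have hp' := E.prod.slab_mono (singleton_subset_iff.2 (mem_Iic.2 le_rfl)) hp
  intro g hg
  exact (E.proper 0).mem_stab hg.1 (hsub hp') (hsub
    (E.prod.smul_mem_slab (fun g hg => E.smul_rad hg) hg hp'))

/-- The group of the end is the stabilizer of the radial end neighborhood. -/
theorem grp_eq : E.toPEnd.grp = O.stab E.rad := by
  refine le_antisymm (fun g hg => ?_) E.stab_rad_le_grp
  have hGr : ∀ g ∈ O.stab E.rad, g • E.rad = E.rad := fun g hg => E.smul_rad hg
  obtain ⟨P⟩ := (E.proper 0).2.2
  have hG : ∀ g ∈ O.stab (E.nhd 0), g • E.nhd 0 = E.nhd 0 := fun g hg => hg.2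
  obtain ⟨ε, hε, hε1, hsub⟩ := E.exists_nhd_slab 0
  -- the cross section `{t = ε}` lies in a compact part of the product
  obtain ⟨Z, hZ, hZc, hco⟩ := E.prod.exists_isCompact_subset_slab (J := {ε}) isCompact_singleton
    (singleton_subset_iff.2 ⟨hε, hε1⟩) hGr
  have hZ0 : Z ⊆ E.nhd 0 := fun p hp =>
    hsub (E.prod.slab_mono (singleton_subset_iff.2 (mem_Iic.2 le_rfl)) (hZ hp))
  obtain ⟨J, hJ, hJ1, hZJ⟩ : ∃ J : Set ℝ, IsCompact J ∧ J ⊆ Ioo 0 1 ∧ Z ⊆ P.slab J := by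
    have hc : IsCompact ((↑) ⁻¹' Z : Set (E.nhd 0)) := by
      rw [Subtype.isCompact_iff, Subtype.image_preimage_coe, inter_eq_right.2 hZ0]; exact hZc
    refine ⟨_, hc.image (f := fun w => ((P.homeo w).2 : ℝ)) (by fun_prop), ?_,
      fun p hp => ⟨hZ0 hp, ⟨p, hZ0 hp⟩, hp, rfl⟩⟩
    rintro _ ⟨w, -, rfl⟩
    exact (P.homeo w).2.2
  obtain ⟨a, b, hab, ha, hb, hJab⟩ : ∃ a b : ℝ, a < b ∧ 0 < a ∧ b < 1 ∧ J ⊆ Icc a b := by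
    rcases J.eq_empty_or_nonempty with rfl | hne
    · exact ⟨1 / 3, 1 / 2, by norm_num, by norm_num, by norm_num, empty_subset _⟩
    · obtain ⟨a, haJ, ha⟩ := hJ.exists_isMinOn hne continuousOn_id
      obtain ⟨b, hbJ, hb⟩ := hJ.exists_isMaxOn hne continuousOn_id
      have h1 := hJ1 haJ
      have h2 := hJ1 hbJ
      have h3 : a ≤ b := ha hbJ
      refine ⟨a / 2, (b + 1) / 2, by linarith [h1.1], by linarith [h1.1], by linarith [h2.2],
        fun t ht => ⟨?_, ?_⟩⟩
      · have : a ≤ t := ha ht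
        linarith [h1.1]
      · have : t ≤ b := hb ht
        linarith [h2.2]
  have hS : E.prod.slab {ε} ⊆ P.slab (Icc a b) := by
    intro p hp
    obtain ⟨h, hh, hhZ⟩ := hco p hp.1
    have h1 := P.slab_mono hJab (hZJ (hhZ p hp fun _ _ => rfl))
    exact (P.smul_mem_slab_iff hG (E.stab_rad_le_grp hh)).1 h1
  -- a complementary part of the product meets the truncation
  have hpre := (E.proper 0).isPreconnected
  have habI : Icc a b ⊆ Ioo (0 : ℝ) 1 := fun t ht => ⟨ha.trans_le ht.1, ht.2.trans_lt hb⟩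
  obtain ⟨p, I, hI1, hIc, hId, hpI, hpA⟩ : ∃ p, ∃ I ⊆ Ioo (0 : ℝ) 1, IsPreconnected I ∧
      Disjoint I (Icc a b) ∧ p ∈ P.slab I ∧ p ∈ E.prod.slab (Iio ε) := by
    -- Deep points avoid all translates of Z', hence the slab [a, b] of the second product
    -- structure. It is not known on which side of [a, b] they are; both cases give an interval I.
    obtain ⟨Z', hZ', hZc', hco'⟩ := P.exists_isCompact_subset_slab (J := Icc a b) isCompact_Icc
      habI hG
    obtain ⟨i, hi⟩ := E.toPEnd.exists_disjoint hZc'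
      ((hZ'.trans (P.slab_subset _)).trans (E.proper 0).subset_dom)
    obtain ⟨η, hη, hη1, hηi⟩ := E.exists_nhd_slab i
    obtain ⟨p, hp⟩ := E.exists_mem_slab E.rad_proper.nonempty (t := min η (ε / 2))
      ⟨by positivity, (min_le_left _ _).trans_lt hη1⟩
    have hpA : p ∈ E.prod.slab (Iio ε) := E.prod.slab_mono (singleton_subset_iff.2
      (mem_Iio.2 ((min_le_right _ _).trans_lt (by linarith)))) hp
    have hpi : p ∈ E.nhd i := hηi (E.prod.slab_mono (singleton_subset_iff.2
      (mem_Iic.2 (min_le_left _ _))) hp)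
    have hp0 : p ∈ E.nhd 0 := hsub (E.prod.slab_mono Iio_subset_Iic_self hpA)
    have hpab : ((P.homeo ⟨p, hp0⟩).2 : ℝ) ∉ Icc a b := fun h => by
      obtain ⟨h, hh, hhZ⟩ := hco' p hp0
      have := hi h⁻¹ (O.grp.inv_mem hh.1) _ (hhZ p ⟨hp0, ‹_›⟩ fun _ _ => rfl)
      rw [inv_smul_smul] at this
      exact this hpi
    have h01 := (P.homeo ⟨p, hp0⟩).2.2
    rcases lt_or_ge ((P.homeo ⟨p, hp0⟩).2 : ℝ) a with h | h
    · refine ⟨p, Ioo 0 a, fun t ht => ⟨ht.1, by linarith [ht.2]⟩, isPreconnected_Ioo, ?_,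
        ⟨hp0, h01.1, h⟩, hpA⟩
      exact disjoint_left.2 fun t h1 h2 => absurd h2.1 (not_le.2 h1.2)
    · refine ⟨p, Ioo b 1, fun t ht => ⟨by linarith [ht.1], ht.2⟩, isPreconnected_Ioo, ?_,
        ⟨hp0, lt_of_not_ge fun h' => hpab ⟨h, h'⟩, h01.2⟩, hpA⟩
      exact disjoint_left.2 fun t h1 h2 => absurd h2.2 (not_le.2 h1.1)
  -- Inside the domain, the truncation {t < ε} can only be left through the cross section {t = ε}.
  -- This lies in the slab [a, b], disjoint from the connected slab over I, so the latter stays in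
  -- the truncation. Being invariant under g, it shows that g sends a point of `rad` into `rad`.
  have hsubI : P.slab I ⊆ E.prod.slab (Iio ε) := by
    have ho1 : IsOpen (E.prod.slab (Iio ε)) := E.prod.isOpen_slab E.rad_proper.1 isOpen_Iio
    have ho2 : IsOpen (closure (E.prod.slab (Iic ε)))ᶜ := isClosed_closure.isOpen_compl
    refine (P.isPreconnected_slab hpre hIc hI1).subset_left_of_subset_union ho1 ho2
      (disjoint_left.2 fun q h1 h2 => h2 (subset_closure
        (E.prod.slab_mono Iio_subset_Iic_self h1))) (fun q hq => ?_) ⟨p, hpI, hpA⟩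
    by_cases hc : q ∈ closure (E.prod.slab (Iic ε))
    · left
      obtain ⟨hqr, hqε⟩ := E.mem_slab_of_mem_closure hε1 hc ((E.proper 0).subset_interior hq.1)
      refine ⟨hqr, mem_Iio.2 (lt_of_le_of_ne hqε fun he => ?_)⟩
      obtain ⟨h1, h2⟩ := hS ⟨hqr, he⟩
      exact disjoint_left.1 hId hq.2 h2
    · exact Or.inr hc
  exact E.rad_proper.mem_stab hg.1 (hsubI hpI).1 (hsubI (P.smul_mem_slab hG hg hpI)).1

theorem smul_rad_of_mem_grp {g : LinAut n} (hg : g ∈ E.toPEnd.grp) : g • E.rad = E.rad := by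
  rw [E.grp_eq] at hg; exact hg.2

theorem apply_mem_cone_rad {g : LinAut n} (hg : g ∈ E.toPEnd.grp) {x : Vec n} :
    g x ∈ cone E.rad ↔ x ∈ cone E.rad :=
  apply_mem_cone_of_smul_eq (E.smul_rad_of_mem_grp hg)

end ConvexProjOrbifold.PREnd

/-! ### Radial leaves in the vector space, and the action on the vector over the vertex. -/

namespace ConvexProjOrbifold.PREnd

variable {n : ℕ} {O : ConvexProjOrbifold n} (E : O.PREnd)

/-- A vector over the p-end vertex. -/
noncomputable def vec : Vec n := unitVec E.vertex

theorem vec_mem : E.vec ∈ cone {E.vertex} := unitVec_mem _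

theorem vec_ne_zero : E.vec ≠ 0 := E.vec_mem.1

theorem line_eq : E.line = Submodule.span ℝ {E.vec} := by
  apply le_antisymm
  · rw [line, Submodule.span_le]
    intro x hx
    obtain ⟨t, -, rfl⟩ := (mem_cone_singleton_iff E.vec_mem).1 hx
    exact Submodule.smul_mem _ _ (Submodule.mem_span_singleton_self _)
  · exact Submodule.span_mono (singleton_subset_iff.2 E.vec_mem)

theorem mem_line_iff {x : Vec n} : x ∈ E.line ↔ ∃ c : ℝ, c • E.vec = x := by
  rw [line_eq, Submodule.mem_span_singleton]

theorem mkQ_eq_iff {x y : Vec n} : E.line.mkQ x = E.line.mkQ y ↔ ∃ c : ℝ, x = y + c • E.vec := by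
  rw [Submodule.mkQ_apply, Submodule.mkQ_apply, Submodule.Quotient.eq, mem_line_iff]
  exact exists_congr fun c => by rw [eq_comm, sub_eq_iff_eq_add']

theorem mkQ_vec : E.line.mkQ E.vec = 0 := by
  rw [← map_zero E.line.mkQ, mkQ_eq_iff]
  exact ⟨1, by simp⟩

theorem mem_cone_rad_iff {w : Vec n} : w ∈ cone E.rad ↔
    ∃ x t, w ∈ cone {(E.prod.homeo.symm (x, t) : ProjSphere n)} := by
  constructor
  · rintro ⟨h0, h⟩
    refine ⟨(E.prod.homeo ⟨_, h⟩).1, (E.prod.homeo ⟨_, h⟩).2, h0, ?_⟩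
    simp
  · rintro ⟨x, t, h⟩
    exact mem_cone_of_mem (E.prod.symm_mem x t) h

theorem mem_cone_slab_iff {J : Set ℝ} {w : Vec n} : w ∈ cone (E.prod.slab J) ↔
    ∃ x, ∃ t : Ioo (0 : ℝ) 1, (t : ℝ) ∈ J ∧ w ∈ cone {(E.prod.homeo.symm (x, t) : ProjSphere n)} := by
  constructor
  · rintro ⟨h0, h, hJ⟩
    refine ⟨(E.prod.homeo ⟨_, h⟩).1, (E.prod.homeo ⟨_, h⟩).2, hJ, h0, ?_⟩
    simp
  · rintro ⟨x, t, ht, h⟩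
    exact mem_cone_of_mem (E.prod.symm_mem_slab x t ht) h

theorem leaf_unique {w : Vec n} {x x' : E.prod.X} {t t' : Ioo (0 : ℝ) 1}
    (h : w ∈ cone {(E.prod.homeo.symm (x, t) : ProjSphere n)})
    (h' : w ∈ cone {(E.prod.homeo.symm (x', t') : ProjSphere n)}) : x = x' ∧ t = t' := by
  obtain ⟨_, h⟩ := h
  obtain ⟨_, h'⟩ := h'
  rw [mem_singleton_iff] at h h'
  have := E.prod.homeo.symm.injective (Subtype.ext (h.symm.trans h'))
  exact ⟨congrArg Prod.fst this, congrArg Prod.snd this⟩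

theorem exists_add_mem_leaf {w : Vec n} {x : E.prod.X} {s t : Ioo (0 : ℝ) 1} (hst : s < t)
    (h : w ∈ cone {(E.prod.homeo.symm (x, t) : ProjSphere n)}) :
    ∃ c : ℝ, 0 < c ∧ w + c • E.vec ∈ cone {(E.prod.homeo.symm (x, s) : ProjSphere n)} := by
  have h1 : (E.prod.homeo.symm (x, s) : ProjSphere n) ∈
      openSeg E.vertex (E.prod.homeo.symm (x, t) : ProjSphere n) := by
    rw [← E.leaf_radial]; exact ⟨s, hst, rfl⟩
  obtain ⟨u, hu, w', hw', hy⟩ := h1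
  obtain ⟨a, ha, rfl⟩ := (mem_cone_singleton_iff E.vec_mem).1 hu
  obtain ⟨b, hb, rfl⟩ := (mem_cone_singleton_iff h).1 hw'
  refine ⟨b⁻¹ * a, by positivity, ?_⟩
  have := smul_mem_cone hy (inv_pos.2 hb)
  rwa [smul_add, smul_smul, smul_smul, inv_mul_cancel₀ hb.ne', one_smul,
    add_comm _ w] at this

/-- A leaf through a point of the line would consist, below that point, of multiples of `vec`. They
have the same sign because a functional is positive on the domain, so two heights would give one
ray. -/
theorem notMem_line {w : Vec n} (hw : w ∈ cone E.rad) : w ∉ E.line := by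
  rw [mem_line_iff]
  rintro ⟨a, rfl⟩
  obtain ⟨x, t, h⟩ := E.mem_cone_rad_iff.1 hw
  obtain ⟨φ, hφ⟩ := O.convex.2
  have ht := t.2
  have key : ∀ s : Ioo (0 : ℝ) 1, s < t → ∃ d : ℝ, 0 < d * φ E.vec ∧
      d • E.vec ∈ cone {(E.prod.homeo.symm (x, s) : ProjSphere n)} := by
    intro s hs
    obtain ⟨c, -, hc⟩ := E.exists_add_mem_leaf hs h
    rw [← add_smul] at hc
    refine ⟨a + c, ?_, hc⟩
    have := hφ _ (mem_cone_of_mem (E.rad_proper.subset_dom (E.prod.symm_mem x s)) hc)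
    rwa [map_smul, smul_eq_mul] at this
  have m1 : (t : ℝ) / 2 ∈ Ioo (0 : ℝ) 1 := ⟨by linarith [ht.1], by linarith [ht.2, ht.1]⟩
  have m2 : (t : ℝ) / 3 ∈ Ioo (0 : ℝ) 1 := ⟨by linarith [ht.1], by linarith [ht.2, ht.1]⟩
  obtain ⟨d₁, h1, hd1⟩ := key ⟨t / 2, m1⟩ (by
    change (t : ℝ) / 2 < t; linarith [ht.1])
  obtain ⟨d₂, h2, hd2⟩ := key ⟨t / 3, m2⟩ (by
    change (t : ℝ) / 3 < t; linarith [ht.1])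
  have hpos : 0 < d₁ / d₂ := by
    have h3 : d₁ * φ E.vec / (d₂ * φ E.vec) = d₁ / d₂ := by
      refine mul_div_mul_right _ _ fun h0 => ?_
      rw [h0, mul_zero] at h1
      exact lt_irrefl _ h1
    rw [← h3]; exact div_pos h1 h2
  have hd20 : d₂ ≠ 0 := fun h0 => by rw [h0, zero_mul] at h2; exact lt_irrefl _ h2
  have h3 := smul_mem_cone hd2 hpos
  rw [smul_smul, div_mul_cancel₀ _ hd20] at h3
  have h4 := congrArg Subtype.val (E.leaf_unique hd1 h3).2
  simp only at h4
  linarith [ht.1]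

/-- Adding positive multiples of `vec` moves towards the vertex along the leaf, that is, lowers the
height. The sum is a nonzero vector because w is off the line. -/
theorem add_mem_leaf {w : Vec n} {x : E.prod.X} {t : Ioo (0 : ℝ) 1}
    (h : w ∈ cone {(E.prod.homeo.symm (x, t) : ProjSphere n)}) {c : ℝ} (hc : 0 < c) :
    ∃ s < t, w + c • E.vec ∈ cone {(E.prod.homeo.symm (x, s) : ProjSphere n)} := by
  have h0 : w + c • E.vec ≠ 0 := fun h0 => by
    refine E.notMem_line (E.mem_cone_rad_iff.2 ⟨x, t, h⟩) (E.mem_line_iff.2 ⟨-c, ?_⟩)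
    rw [neg_smul, eq_comm]; exact eq_neg_of_add_eq_zero_left h0
  have h1 : rayOfNeZero ℝ _ h0 ∈ openSeg E.vertex (E.prod.homeo.symm (x, t) : ProjSphere n) :=
    ⟨c • E.vec, smul_mem_cone E.vec_mem hc, w, h, by
      rw [add_comm _ w]; exact cone_singleton_rayOfNeZero h0⟩
  rw [← E.leaf_radial] at h1
  obtain ⟨s, hs, he⟩ := h1
  exact ⟨s, hs, h0, he.symm⟩

theorem add_mem_cone_slab {ε : ℝ} {w : Vec n} (h : w ∈ cone (E.prod.slab (Iic ε))) {c : ℝ}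
    (hc : 0 ≤ c) : w + c • E.vec ∈ cone (E.prod.slab (Iic ε)) := by
  rcases hc.eq_or_lt with rfl | hc
  · simpa using h
  obtain ⟨x, t, ht, h⟩ := E.mem_cone_slab_iff.1 h
  obtain ⟨s, hs, h'⟩ := E.add_mem_leaf h hc
  exact E.mem_cone_slab_iff.2 ⟨x, s, le_trans (Subtype.coe_le_coe.2 hs.le) ht, h'⟩

theorem add_mem_cone_rad {w : Vec n} (h : w ∈ cone E.rad) {c : ℝ} (hc : 0 ≤ c) :
    w + c • E.vec ∈ cone E.rad := by
  rcases hc.eq_or_lt with rfl | hc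
  · simpa using h
  obtain ⟨x, t, h⟩ := E.mem_cone_rad_iff.1 h
  obtain ⟨s, hs, h'⟩ := E.add_mem_leaf h hc
  exact E.mem_cone_rad_iff.2 ⟨x, s, h'⟩

theorem leaf_eq_of_add {w : Vec n} {x x' : E.prod.X} {t t' : Ioo (0 : ℝ) 1}
    (h : w ∈ cone {(E.prod.homeo.symm (x, t) : ProjSphere n)}) {c : ℝ}
    (h' : w + c • E.vec ∈ cone {(E.prod.homeo.symm (x', t') : ProjSphere n)}) : x = x' := by
  rcases lt_trichotomy c 0 with hc | rfl | hc
  · obtain ⟨s, -, hs⟩ := E.add_mem_leaf h' (neg_pos.2 hc)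
    rw [neg_smul, add_neg_cancel_right] at hs
    exact (E.leaf_unique h hs).1
  · rw [zero_smul, add_zero] at h'
    exact (E.leaf_unique h h').1
  · obtain ⟨s, -, hs⟩ := E.add_mem_leaf h hc
    exact (E.leaf_unique hs h').1

theorem apply_mem_leaf {g : LinAut n} (hg : g ∈ O.stab E.rad) {w : Vec n} {x : E.prod.X}
    {t : Ioo (0 : ℝ) 1} (h : w ∈ cone {(E.prod.homeo.symm (x, t) : ProjSphere n)}) :
    g w ∈ cone {(E.prod.homeo.symm ((⟨g, hg⟩ : O.stab E.rad) • x, t) : ProjSphere n)} := by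
  have h1 : g • (E.prod.homeo.symm (x, t) : ProjSphere n) ∈ E.rad := by
    have := Set.smul_mem_smul_set (a := g) (E.prod.symm_mem x t)
    rwa [E.smul_rad hg] at this
  have h2 := E.prod.equivariant ⟨g, hg⟩ (E.prod.homeo.symm (x, t)) ⟨_, h1⟩ rfl
  rw [E.prod.homeo.apply_symm_apply] at h2
  rw [← h2, E.prod.homeo.symm_apply_apply]
  exact (apply_mem_cone_singleton g).2 h

/-- g maps leaves to leaves and keeps heights, so g(w + c vec) is a positive multiple of some g w +
d vec with d > 0. At c = 1 this writes g vec in terms of vec and g w. -/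
theorem apply_vec_aux {g : LinAut n} (hg : g ∈ O.stab E.rad) {w : Vec n} (hw : w ∈ cone E.rad) :
    ∃ a b : ℝ, 0 < a ∧ 0 ≤ b ∧ g E.vec = a • E.vec + b • g w := by
  obtain ⟨x, t, h⟩ := E.mem_cone_rad_iff.1 hw
  have hgw := E.apply_mem_leaf hg h
  have hnl := E.notMem_line (E.mem_cone_rad_iff.2 ⟨_, _, hgw⟩)
  have key : ∀ c : ℝ, 0 < c → ∃ d r : ℝ, 0 < d ∧ 0 < r ∧
      g w + c • g E.vec = r • (g w + d • E.vec) := by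
    intro c hc
    obtain ⟨s, hs, h1⟩ := E.add_mem_leaf h hc
    have h2 := E.apply_mem_leaf hg h1
    rw [map_add, map_smul] at h2
    obtain ⟨d, hd, h3⟩ := E.exists_add_mem_leaf hs hgw
    obtain ⟨r, hr, he⟩ := (mem_cone_singleton_iff h3).1 h2
    exact ⟨d, r, hd, hr, he⟩
  obtain ⟨d, r, hd, hr, he⟩ := key 1 one_pos
  have hgv : g E.vec = (r * d) • E.vec + (r - 1) • g w := by
    rw [one_smul] at he
    rw [eq_sub_of_add_eq' he]; module
  refine ⟨r * d, r - 1, by positivity, ?_, hgv⟩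
  by_contra! hneg
  -- For r < 1 this value of c cancels the g w component of g(w + c vec), which would force g w onto
  -- the line.
  obtain ⟨d', r', hd', hr', he'⟩ := key (1 / (1 - r)) (by
    apply one_div_pos.2; linarith)
  refine hnl (E.mem_line_iff.2 ⟨((1 / (1 - r)) * (r * d) - r' * d') / r', ?_⟩)
  have h1r : (1 - r) ≠ 0 := by linarith
  rw [hgv] at he'
  have h5 : r' • g w = ((1 / (1 - r)) * (r * d) - r' * d') • E.vec := by
    have h6 : g w + (1 / (1 - r)) • ((r * d) • E.vec + (r - 1) • g w) =
        ((1 / (1 - r)) * (r * d)) • E.vec := by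
      have : (1 / (1 - r)) * (r - 1) = -1 := by field_simp; ring
      rw [smul_add, smul_smul, smul_smul, this]; module
    rw [h6] at he'
    rw [sub_smul, he']; module
  rw [div_eq_inv_mul, mul_smul, ← h5, smul_smul, inv_mul_cancel₀ hr'.ne', one_smul]

/-- Combining `apply_vec_aux` for g and for its inverse gives a sum of nonnegative coefficients of g
w that must vanish, as g w is not on the line. -/
theorem exists_apply_vec {g : LinAut n} (hg : g ∈ E.toPEnd.grp) :
    ∃ a : ℝ, 0 < a ∧ g E.vec = a • E.vec := by
  rw [E.grp_eq] at hg
  obtain ⟨p, hp⟩ := E.rad_proper.nonempty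
  obtain ⟨w, hw⟩ := exists_mem_cone p
  have hw := mem_cone_of_mem hp hw
  have hgw : g w ∈ cone E.rad := (apply_mem_cone_of_smul_eq (E.smul_rad hg)).2 hw
  obtain ⟨a, b, ha, hb, h1⟩ := E.apply_vec_aux hg hw
  obtain ⟨a', b', ha', hb', h2⟩ := E.apply_vec_aux ((O.stab E.rad).inv_mem hg) hgw
  have hinv : ∀ x, g (g⁻¹ x) = x := fun x => g.apply_symm_apply x
  have h3 := congrArg g h2
  have hinv' : g⁻¹ (g w) = w := g.symm_apply_apply w
  rw [hinv, hinv', map_add, map_smul, map_smul, h1] at h3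
  have h4 : a' * b + b' = 0 := by
    by_contra hne
    refine E.notMem_line hgw (E.mem_line_iff.2 ⟨(1 - a' * a) / (a' * b + b'), ?_⟩)
    have h5 : (a' * b + b') • g w = (1 - a' * a) • E.vec := by
      rw [sub_smul, one_smul]
      nth_rw 1 [h3]
      module
    rw [div_eq_inv_mul, mul_smul, ← h5, smul_smul, inv_mul_cancel₀ hne, one_smul]
  have hb0 : b = 0 := by
    have : a' * b = 0 := by nlinarith [mul_nonneg ha'.le hb]
    exact (mul_eq_zero.1 this).resolve_left ha'.ne'
  exact ⟨a, ha, by rw [h1, hb0, zero_smul, add_zero]⟩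

/-- The group of the end fixes the vectors over the vertex. -/
theorem apply_vec (hgen :
      Subgroup.closure {g : LinAut n | g ∈ E.toPEnd.grp ∧ IsOfFinOrder g} = E.toPEnd.grp ∨
      Subgroup.closure {g : LinAut n | g ∈ E.toPEnd.grp ∧ ∀ v ∈ cone {E.vertex}, g v = v} =
        E.toPEnd.grp) {g : LinAut n} (hg : g ∈ E.toPEnd.grp) : g E.vec = E.vec := by
  have hsub : E.toPEnd.grp ≤ MulAction.stabilizer (LinAut n) E.vec := by
    rcases hgen with h | h
    · rw [← h, Subgroup.closure_le]
      rintro g ⟨hg, hfin⟩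
      obtain ⟨a, ha, h1⟩ := E.exists_apply_vec hg
      obtain ⟨m, hm, hgm⟩ := isOfFinOrder_iff_pow_eq_one.1 hfin
      have h2 : ∀ k : ℕ, (g ^ k) E.vec = a ^ k • E.vec := by
        intro k
        induction k with
        | zero => simp
        | succ k ih =>
          rw [pow_succ', pow_succ']
          change g ((g ^ k) E.vec) = _
          rw [ih, map_smul, h1, smul_smul, mul_comm]
      have h3 := h2 m
      rw [hgm] at h3
      have h4 : a ^ m = 1 := by
        have h5 : (1 : ℝ) • E.vec = a ^ m • E.vec := by rw [one_smul]; exact h3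
        exact (smul_left_injective ℝ E.vec_ne_zero h5).symm
      have h5 := (pow_eq_one_iff_of_nonneg ha.le hm.ne').1 h4
      rw [h5, one_smul] at h1
      exact h1
    · rw [← h, Subgroup.closure_le]
      exact fun g hg => hg.2 _ E.vec_mem
  exact hsub hg

end ConvexProjOrbifold.PREnd

/-! ### Cocompactness and properness on leaf directions. -/

namespace ConvexProjOrbifold

variable {n : ℕ} {O : ConvexProjOrbifold n}

theorem finite_of_isCompact_subset_cone {B : Set (Vec n)} (hB : IsCompact B)
    (hBd : B ⊆ cone O.dom) : {g : LinAut n | g ∈ O.grp ∧ ∃ b ∈ B, ∃ t : ℝ, 0 < t ∧ t • g b ∈ B}.Finite := by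
  have h0 : (0 : Vec n) ∉ B := fun h => (hBd h).1 rfl
  refine (O.properlyDiscontinuous (raysOf B) (raysOf_subset hBd) (isCompact_raysOf hB h0)).subset ?_
  rintro g ⟨hg, b, hb, t, ht, hgb⟩
  have hb0 := (hBd hb).1
  have hgb0 : g b ≠ 0 := by simpa using hb0
  exact ⟨hg, rayOfNeZero ℝ (g b) hgb0, ⟨rayOfNeZero ℝ b hb0, ⟨b, cone_singleton_rayOfNeZero _, hb⟩,
    rfl⟩, ⟨t • g b, smul_mem_cone (cone_singleton_rayOfNeZero _) ht, hgb⟩⟩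

namespace PREnd

variable (E : O.PREnd)

/-- Every leaf crosses the height ε, where the group is cocompact; c is the displacement along the
leaf and t accounts for the choice of a vector on the ray. -/
theorem exists_isCompact_lift {ε : ℝ} (hε : 0 < ε) (hε1 : ε < 1) :
    ∃ Z ⊆ cone (E.prod.slab (Iic ε)), IsCompact Z ∧ ∀ w ∈ cone E.rad, ∃ g ∈ E.toPEnd.grp, ∃ z ∈ Z,
      ∃ t c : ℝ, 0 < t ∧ w = t • g z + c • E.vec := by
  obtain ⟨Z, hZ, hZc, hco⟩ := E.prod.exists_isCompact_subset_slab (J := {ε}) isCompact_singleton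
    (singleton_subset_iff.2 ⟨hε, hε1⟩) (fun g hg => E.smul_rad hg)
  refine ⟨unitVec '' Z, ?_, hZc.image continuous_unitVec, fun w hw => ?_⟩
  · rintro _ ⟨p, hp, rfl⟩
    exact mem_cone_of_mem (E.prod.slab_mono (singleton_subset_iff.2 (mem_Iic.2 le_rfl)) (hZ hp))
      (unitVec_mem p)
  · obtain ⟨x, t, h⟩ := E.mem_cone_rad_iff.1 hw
    set q : ProjSphere n := ((E.prod.homeo.symm (x, ⟨ε, hε, hε1⟩) : E.rad) : ProjSphere n) with hq
    have hqs : q ∈ E.prod.slab {ε} := E.prod.symm_mem_slab x _ rfl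
    obtain ⟨g, hg, hgZ⟩ := hco _ (E.prod.symm_mem x t)
    have hgq := hgZ q hqs fun _ _ => by simp [hq]
    -- move along the leaf
    obtain ⟨c, hc⟩ : ∃ c : ℝ, w + c • E.vec ∈ cone {q} := by
      rcases lt_trichotomy (⟨ε, hε, hε1⟩ : Ioo (0 : ℝ) 1) t with h1 | h1 | h1
      · obtain ⟨c, -, hc⟩ := E.exists_add_mem_leaf h1 h
        exact ⟨c, hc⟩
      · exact ⟨0, by rw [zero_smul, add_zero, hq, h1]; exact h⟩
      · obtain ⟨c, -, hc⟩ := E.exists_add_mem_leaf h1 (unitVec_mem q)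
        obtain ⟨r, hr, he⟩ := (mem_cone_singleton_iff hc).1 h
        refine ⟨-(r * c), ?_⟩
        rw [he, smul_add, smul_smul, neg_smul, add_neg_cancel_right]
        exact smul_mem_cone (unitVec_mem q) hr
    obtain ⟨r, hr, he⟩ := (mem_cone_singleton_iff
      ((apply_mem_cone_singleton g).2 hc)).1 (unitVec_mem (g • q))
    have hgi : ∀ x, g⁻¹ (g x) = x := fun x => g.symm_apply_apply x
    have hg' : g⁻¹ ∈ E.toPEnd.grp := by rw [E.grp_eq]; exact (O.stab E.rad).inv_mem hg
    refine ⟨g⁻¹, hg', _, mem_image_of_mem _ hgq, r⁻¹, -c, inv_pos.2 hr, ?_⟩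
    rw [he, map_smul, hgi, smul_smul, inv_mul_cancel₀ hr.ne', one_smul, neg_smul,
      add_neg_cancel_right]

/-- The unknown c may be unbounded, so proper discontinuity does not apply directly. But g keeps
heights: sliding b' along its leaf to the height of b keeps it in the compact product of the leaf
and height projections of B. -/
theorem finite_of_mkQ {B : Set (Vec n)} (hB : IsCompact B) (hBr : B ⊆ cone E.rad) :
    {g : LinAut n | g ∈ E.toPEnd.grp ∧ ∃ b ∈ B, ∃ b' ∈ B, ∃ c : ℝ,
      g b = b' + c • E.vec}.Finite := by
  have h0 : (0 : Vec n) ∉ B := fun h => (hBr h).1 rfl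
  have hc : IsCompact ((↑) ⁻¹' raysOf B : Set E.rad) := by
    rw [Subtype.isCompact_iff, Subtype.image_preimage_coe, inter_eq_right.2 (raysOf_subset hBr)]
    exact isCompact_raysOf hB h0
  have hX := hc.image (f := fun w => (E.prod.homeo w).1) (by fun_prop)
  have hT := hc.image (f := fun w => (E.prod.homeo w).2) (by fun_prop)
  have hK := (hX.prod hT).image E.prod.continuous_symm
  refine (O.properlyDiscontinuous _ ?_ hK).subset ?_
  · rintro _ ⟨q, -, rfl⟩
    exact E.rad_proper.subset_dom (E.prod.symm_mem q.1 q.2)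
  have key : ∀ b ∈ B, ∀ x t, b ∈ cone {(E.prod.homeo.symm (x, t) : ProjSphere n)} →
      x ∈ (fun w => (E.prod.homeo w).1) '' ((↑) ⁻¹' raysOf B) ∧
      t ∈ (fun w => (E.prod.homeo w).2) '' ((↑) ⁻¹' raysOf B) := by
    intro b hb x t h
    have hm : E.prod.homeo.symm (x, t) ∈ ((↑) ⁻¹' raysOf B : Set E.rad) := ⟨b, h, hb⟩
    exact ⟨⟨_, hm, by simp⟩, ⟨_, hm, by simp⟩⟩
  rintro g ⟨hg, b, hb, b', hb', c, he⟩
  rw [E.grp_eq] at hg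
  obtain ⟨x, t, h⟩ := E.mem_cone_rad_iff.1 (hBr hb)
  obtain ⟨x', t', h'⟩ := E.mem_cone_rad_iff.1 (hBr hb')
  have hg1 := E.apply_mem_leaf hg h
  have hx := E.leaf_eq_of_add h' (he ▸ hg1)
  refine ⟨hg.1, E.prod.homeo.symm (x', t), ⟨E.prod.homeo.symm (x, t),
    ⟨(x, t), ⟨(key b hb x t h).1, (key b hb x t h).2⟩, rfl⟩, ?_⟩,
    ⟨(x', t), ⟨(key b' hb' x' t' h').1, (key b hb x t h).2⟩, rfl⟩⟩
  rw [hx]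
  obtain ⟨w, hw⟩ : ∃ w, w ∈ cone {(E.prod.homeo.symm (x, t) : ProjSphere n)} := exists_mem_cone _
  obtain ⟨_, h1⟩ := hg1
  obtain ⟨_, h2⟩ := (apply_mem_cone_singleton g).2 h
  exact h2.symm.trans h1

end PREnd

end ConvexProjOrbifold

/-! ### The action on the quotient by the line. -/

namespace ConvexProjOrbifold.PREnd

variable {n : ℕ} {O : ConvexProjOrbifold n} (E : O.PREnd)

instance isClosed_line : IsClosed (E.line : Set (Vec n)) := E.line.closed_of_finiteDimensional

theorem continuous_mkQ : Continuous E.line.mkQ := continuous_quot_mk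

/-- The automorphisms of `ℝ^{n+1} ⧸ E.line` induced by the elements of `H`. -/
def quotGroup (H : Subgroup (LinAut n)) : Subgroup ((Vec n ⧸ E.line) ≃L[ℝ] (Vec n ⧸ E.line)) where
  carrier := {T | ∃ g ∈ H, ∀ x, T (E.line.mkQ x) = E.line.mkQ (g x)}
  mul_mem' := by
    rintro T T' ⟨g, hg, h⟩ ⟨g', hg', h'⟩
    refine ⟨g * g', H.mul_mem hg hg', fun x => ?_⟩
    change T (T' _) = _
    rw [h', h]; rfl
  one_mem' := ⟨1, H.one_mem, fun x => rfl⟩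
  inv_mem' := by
    rintro T ⟨g, hg, h⟩
    refine ⟨g⁻¹, H.inv_mem hg, fun x => ?_⟩
    change T.symm _ = E.line.mkQ (g.symm x)
    rw [T.symm_apply_eq, h, g.apply_symm_apply]

theorem mkQ_surjective (y : Vec n ⧸ E.line) : ∃ x, E.line.mkQ x = y :=
  E.line.mkQ_surjective y

theorem ext_mkQ {T T' : (Vec n ⧸ E.line) ≃L[ℝ] (Vec n ⧸ E.line)}
    (h : ∀ x, T (E.line.mkQ x) = T' (E.line.mkQ x)) : T = T' := by
  ext y
  obtain ⟨x, rfl⟩ := E.mkQ_surjective y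
  exact h x

theorem exists_quot {g : LinAut n} (hg : g E.vec = E.vec) :
    ∃ T : (Vec n ⧸ E.line) ≃L[ℝ] (Vec n ⧸ E.line), ∀ x, T (E.line.mkQ x) = E.line.mkQ (g x) := by
  have h : E.line.map (g : Vec n →ₗ[ℝ] Vec n) = E.line := by
    rw [E.line_eq, Submodule.map_span, image_singleton]
    exact congrArg (fun x => Submodule.span ℝ {x}) hg
  exact ⟨(Submodule.Quotient.equiv E.line E.line g h).toContinuousLinearEquiv, fun x => rfl⟩

/-- The determinant is multiplicative along the line and the quotient, and g is the identity on the
line. This is where the fixed vector, rather than only a fixed ray, is used. -/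
theorem abs_det_quot {g : LinAut n} (hg : g E.vec = E.vec)
    (hdet : |LinearMap.det (g : Vec n →ₗ[ℝ] Vec n)| = 1)
    {T : (Vec n ⧸ E.line) ≃L[ℝ] (Vec n ⧸ E.line)}
    (hT : ∀ x, T (E.line.mkQ x) = E.line.mkQ (g x)) :
    |LinearMap.det (T : (Vec n ⧸ E.line) →ₗ[ℝ] (Vec n ⧸ E.line))| = 1 := by
  have hfix : ∀ x ∈ E.line, g x = x := fun x hx => by
    obtain ⟨c, rfl⟩ := E.mem_line_iff.1 hx
    rw [map_smul, hg]
  have hle : E.line ≤ E.line.comap (g : Vec n →ₗ[ℝ] Vec n) := fun x hx => by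
    change g x ∈ E.line
    rwa [hfix x hx]
  have h1 := LinearMap.det_eq_det_mul_det E.line (g : Vec n →ₗ[ℝ] Vec n) hle
  have h2 : (g : Vec n →ₗ[ℝ] Vec n).restrict hle = LinearMap.id := by
    ext x
    exact congrArg (fun y : Vec n => y _) (hfix x x.2)
  have h3 : E.line.mapQ E.line (g : Vec n →ₗ[ℝ] Vec n) hle =
      (T : (Vec n ⧸ E.line) →ₗ[ℝ] (Vec n ⧸ E.line)) := by
    apply Submodule.linearMap_qext
    apply LinearMap.ext
    intro x
    exact (hT x).symm
  rw [h2, h3, LinearMap.det_id, one_mul] at h1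
  rw [← h1]; exact hdet

theorem mem_dirCone_iff {x : Vec n} :
    E.line.mkQ x ∈ E.dirCone ↔ ∃ c : ℝ, x + c • E.vec ∈ cone E.rad := by
  constructor
  · rintro ⟨w, hw, he⟩
    obtain ⟨c, rfl⟩ := E.mkQ_eq_iff.1 he
    exact ⟨c, hw⟩
  · rintro ⟨c, hc⟩
    exact ⟨_, hc, E.mkQ_eq_iff.2 ⟨c, rfl⟩⟩

theorem mkQ_mem_dirCone {x : Vec n} (hx : x ∈ cone E.rad) : E.line.mkQ x ∈ E.dirCone := ⟨x, hx, rfl⟩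

theorem isOpen_dirCone : IsOpen E.dirCone :=
  E.line.isOpenMap_mkQ _ (isOpen_cone E.rad_proper.1)

theorem dirCone_nonempty : E.dirCone.Nonempty := by
  obtain ⟨p, hp⟩ := E.rad_proper.nonempty
  obtain ⟨w, hw⟩ := exists_mem_cone p
  exact ⟨_, E.mkQ_mem_dirCone (mem_cone_of_mem hp hw)⟩

theorem quot_mem_dirCone_iff {T : (Vec n ⧸ E.line) ≃L[ℝ] (Vec n ⧸ E.line)}
    (hT : T ∈ posMultiples (E.quotGroup E.toPEnd.grp)) (hfix : ∀ g ∈ E.toPEnd.grp, g E.vec = E.vec)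
    (y : Vec n ⧸ E.line) : T y ∈ E.dirCone ↔ y ∈ E.dirCone := by
  obtain ⟨T', ⟨g, hg, hT'⟩, t, ht, hTx⟩ := hT
  obtain ⟨x, rfl⟩ := E.mkQ_surjective y
  rw [hTx, hT', ← map_smul, mem_dirCone_iff, mem_dirCone_iff]
  have h1 : ∀ c : ℝ, g (x + c • E.vec) = g x + c • E.vec := fun c => by
    rw [map_add, map_smul, hfix g hg]
  constructor
  · rintro ⟨c, hc⟩
    refine ⟨t⁻¹ * c, (E.apply_mem_cone_rad hg).1 ?_⟩
    rw [h1, ← smul_mem_cone_iff ht, smul_add, smul_smul, mul_inv_cancel_left₀ ht.ne']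
    exact hc
  · rintro ⟨c, hc⟩
    refine ⟨t * c, ?_⟩
    have := smul_mem_cone ((E.apply_mem_cone_rad hg).2 hc) ht
    rwa [h1, smul_add, smul_smul] at this

theorem isCocompact_of_lift {H : Subgroup (LinAut n)} (hH : H ≤ E.toPEnd.grp)
    (hfix : ∀ g ∈ E.toPEnd.grp, g E.vec = E.vec) {Z : Set (Vec n)} (hZ : IsCompact Z)
    (hZr : Z ⊆ cone E.rad) (hco : ∀ w ∈ cone E.rad, ∃ g ∈ H, ∃ z ∈ Z, ∃ t c : ℝ, 0 < t ∧
      w = t • g z + c • E.vec) : IsCocompact (posMultiples (E.quotGroup H)) E.dirCone where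
  isOpen := E.isOpen_dirCone
  map_iff T hT x := by
    obtain ⟨T', ⟨g, hg, h⟩, t⟩ := hT
    exact E.quot_mem_dirCone_iff ⟨T', ⟨g, hH hg, h⟩, t⟩ hfix x
  exists_compact := by
    refine ⟨E.line.mkQ '' Z, ?_, hZ.image E.continuous_mkQ, ?_⟩
    · rintro _ ⟨z, hz, rfl⟩
      exact E.mkQ_mem_dirCone (hZr hz)
    · rintro _ ⟨w, hw, rfl⟩
      obtain ⟨g, hg, z, hz, t, c, ht, he⟩ := hco w hw
      obtain ⟨T, hT⟩ := E.exists_quot (hfix g (hH hg))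
      let u : ℝˣ := Units.mk0 t ht.ne'
      refine ⟨T.trans (ContinuousLinearEquiv.smulLeft u), ⟨T, ⟨g, hg, hT⟩, t, ht, fun x => rfl⟩,
        _, mem_image_of_mem _ hz, ?_⟩
      change t • T (E.line.mkQ z) = _
      rw [hT, ← map_smul, eq_comm, E.mkQ_eq_iff]
      exact ⟨c, he⟩

theorem isCocompact (hfix : ∀ g ∈ E.toPEnd.grp, g E.vec = E.vec) :
    IsCocompact (posMultiples (E.quotGroup E.toPEnd.grp)) E.dirCone := by
  obtain ⟨Z, hZ, hZc, hco⟩ := E.exists_isCompact_lift (ε := 1 / 2) (by norm_num) (by norm_num)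
  exact E.isCocompact_of_lift le_rfl hfix hZc (hZ.trans (cone_mono (E.prod.slab_subset _))) hco

/-- Finitely many coset representatives applied to the compact set replace the whole group by H. -/
theorem isCocompact_of_relIndex {H : Subgroup (LinAut n)} (hH : H ≤ E.toPEnd.grp)
    (hidx : H.relIndex E.toPEnd.grp ≠ 0)
    (hfix : ∀ g ∈ E.toPEnd.grp, g E.vec = E.vec) :
    IsCocompact (posMultiples (E.quotGroup H)) E.dirCone := by
  obtain ⟨Z, hZ, hZc, hco⟩ := E.exists_isCompact_lift (ε := 1 / 2) (by norm_num) (by norm_num)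
  have hfi : (H.subgroupOf E.toPEnd.grp).FiniteIndex := ⟨hidx⟩
  let r : E.toPEnd.grp ⧸ H.subgroupOf E.toPEnd.grp → LinAut n := fun q => ((q.out)⁻¹ : E.toPEnd.grp)
  have hr : ∀ q, r q ∈ E.toPEnd.grp := fun q => ((q.out)⁻¹ : E.toPEnd.grp).2
  refine E.isCocompact_of_lift hH hfix (Z := ⋃ q, r q '' Z)
    (isCompact_iUnion fun q => hZc.image
      ((r q : Vec n →ₗ[ℝ] Vec n).continuous_of_finiteDimensional)) ?_ fun w hw => ?_
  · rw [iUnion_subset_iff]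
    rintro q _ ⟨z, hz, rfl⟩
    exact (E.apply_mem_cone_rad (hr q)).2 (cone_mono (E.prod.slab_subset _) (hZ hz))
  · obtain ⟨g, hg, z, hz, t, c, ht, he⟩ := hco w hw
    let g' : E.toPEnd.grp := ⟨g, hg⟩
    let q : E.toPEnd.grp ⧸ H.subgroupOf E.toPEnd.grp := QuotientGroup.mk (g'⁻¹)
    have hq : (QuotientGroup.mk q.out : E.toPEnd.grp ⧸ H.subgroupOf E.toPEnd.grp) =
        QuotientGroup.mk (g'⁻¹) := Quotient.out_eq q
    rw [QuotientGroup.eq, Subgroup.mem_subgroupOf] at hq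
    -- hq : out⁻¹ * g'⁻¹ ∈ H
    have hq' := H.inv_mem hq
    refine ⟨_, hq', r q z, mem_iUnion.2 ⟨q, mem_image_of_mem _ hz⟩, t, c, ht, ?_⟩
    have h1 : (((q.out)⁻¹ * g'⁻¹ : E.toPEnd.grp) : LinAut n)⁻¹ * r q = g := by
      change ((((q.out)⁻¹ * g'⁻¹ : E.toPEnd.grp)⁻¹ * (q.out)⁻¹ : E.toPEnd.grp) : LinAut n) = g
      have : ((q.out)⁻¹ * g'⁻¹ : E.toPEnd.grp)⁻¹ * (q.out)⁻¹ = g' := by group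
      rw [this]
    have h2 : (((q.out)⁻¹ * g'⁻¹ : E.toPEnd.grp) : LinAut n)⁻¹ (r q z) = g z :=
      congrArg (fun f : LinAut n => f z) h1
    rw [h2]; exact he

theorem quotGroup_proper {H : Subgroup (LinAut n)} (hH : H ≤ E.toPEnd.grp)
    {K : Set (Vec n ⧸ E.line)} (hK : IsCompact K) (hKΩ : K ⊆ E.dirCone) :
    {T | T ∈ E.quotGroup H ∧ ∃ x ∈ K, T x ∈ K}.Finite := by
  -- lift `K` to a compact set
  obtain ⟨B, hB, hBr, hKB⟩ : ∃ B : Set (Vec n), IsCompact B ∧ B ⊆ cone E.rad ∧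
      K ⊆ E.line.mkQ '' B := by
    have ho := isOpen_cone E.rad_proper.1
    have hex : ∀ y ∈ K, ∃ B : Set (Vec n), IsCompact B ∧ B ⊆ cone E.rad ∧
        y ∈ E.line.mkQ '' interior B := by
      intro y hy
      obtain ⟨w, hw, rfl⟩ := hKΩ hy
      obtain ⟨B, hB, hwB, hBs⟩ := exists_compact_subset ho hw
      exact ⟨B, hB, hBs, mem_image_of_mem _ hwB⟩
    choose! B hB hBr hmem using hex
    obtain ⟨t, htK, hcov⟩ := hK.elim_nhds_subcover (fun y => E.line.mkQ '' interior (B y))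
      fun y hy => (E.line.isOpenMap_mkQ _ isOpen_interior).mem_nhds (hmem y hy)
    refine ⟨⋃ y ∈ t, B y, t.isCompact_biUnion fun y hy => hB y (htK y hy),
      iUnion₂_subset fun y hy => hBr y (htK y hy), fun y hy => ?_⟩
    obtain ⟨z, hz, b, hb, he⟩ := mem_iUnion₂.1 (hcov hy)
    exact ⟨b, mem_iUnion₂.2 ⟨z, hz, interior_subset hb⟩, he⟩
  have hfin := E.finite_of_mkQ hB hBr
  have hch : ∀ T ∈ {T | T ∈ E.quotGroup H ∧ ∃ x ∈ K, T x ∈ K}, ∃ g ∈ {g : LinAut n |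
      g ∈ E.toPEnd.grp ∧ ∃ b ∈ B, ∃ b' ∈ B, ∃ c : ℝ, g b = b' + c • E.vec},
      ∀ x, T (E.line.mkQ x) = E.line.mkQ (g x) := by
    rintro T ⟨⟨g, hg, hT⟩, y, hy, hTy⟩
    obtain ⟨b, hb, rfl⟩ := hKB hy
    obtain ⟨b', hb', he⟩ := hKB hTy
    obtain ⟨c, hc⟩ := E.mkQ_eq_iff.1 ((hT b).symm.trans he.symm)
    exact ⟨g, ⟨hH hg, b, hb, b', hb', c, hc⟩, hT⟩
  choose! f hf hfT using hch
  refine Set.Finite.of_injOn (fun T hT => hf T hT) (fun T hT T' hT' he => ?_) hfin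
  exact E.ext_mkQ fun x => by rw [hfT T hT, hfT T' hT', he]

end ConvexProjOrbifold.PREnd

/-! ### Consequences of admissibility. -/

namespace ConvexProjOrbifold.PREnd

variable {n : ℕ} {O : ConvexProjOrbifold n} (E : O.PREnd)

theorem quotGroup_iSup_le {k : ℕ} {G : Fin k → Subgroup (LinAut n)}
    (hG : (⨆ i, G i) ≤ E.toPEnd.grp) (hfix : ∀ g ∈ E.toPEnd.grp, g E.vec = E.vec) :
    E.quotGroup (⨆ i, G i) ≤ ⨆ i, E.quotGroup (G i) := by
  rintro T ⟨g, hg, hT⟩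
  obtain ⟨T', hT', h⟩ : ∃ T' ∈ ⨆ i, E.quotGroup (G i), ∀ x, T' (E.line.mkQ x) = E.line.mkQ (g x) := by
    clear hT
    induction hg using Subgroup.iSup_induction' with
    | hp i g hg =>
      obtain ⟨T', hT'⟩ := E.exists_quot (hfix g (hG (Subgroup.mem_iSup_of_mem i hg)))
      exact ⟨T', Subgroup.mem_iSup_of_mem i ⟨g, hg, hT'⟩, hT'⟩
    | h1 => exact ⟨1, Subgroup.one_mem _, fun x => rfl⟩
    | hmul g₁ g₂ _ _ ih₁ ih₂ =>
      obtain ⟨T₁, h₁, e₁⟩ := ih₁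
      obtain ⟨T₂, h₂, e₂⟩ := ih₂
      refine ⟨T₁ * T₂, Subgroup.mul_mem _ h₁ h₂, fun x => ?_⟩
      change T₁ (T₂ _) = _
      rw [e₂, e₁]; rfl
  rwa [E.ext_mkQ fun x => (hT x).trans (h x).symm]

theorem iSup_quotGroup_le {k : ℕ} {G : Fin k → Subgroup (LinAut n)} :
    ⨆ i, E.quotGroup (G i) ≤ E.quotGroup (⨆ i, G i) :=
  iSup_le fun i _ ⟨g, hg, h⟩ => ⟨g, Subgroup.mem_iSup_of_mem i hg, h⟩

/-- An admissible end group has a subgroup of finite index that acts on a strict join. -/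
theorem Admissible.exists_isStrictJoin {E : O.PREnd} (hE : E.Admissible)
    (hfix : ∀ g ∈ E.toPEnd.grp, g E.vec = E.vec) :
    ∃ (k : ℕ) (S : Fin k → Submodule ℝ (Vec n ⧸ E.line)) (C : Fin k → Set (Vec n ⧸ E.line))
      (pr : Fin k → (Vec n ⧸ E.line) →L[ℝ] (Vec n ⧸ E.line)) (G : Fin k → Subgroup (LinAut n)),
      IsStrictJoin S C pr (closure E.dirCone) ∧ (⨆ i, G i) ≤ E.toPEnd.grp ∧
      (∀ i, ∀ g ∈ E.quotGroup (G i), ∀ x, g x ∈ C i ↔ x ∈ C i) ∧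
      (∀ i j, j ≠ i → ∀ g ∈ E.quotGroup (G i), ∃ c : ℝ, 0 < c ∧ ∀ x ∈ S j, g x = c • x) ∧
      IsCocompact (posMultiples (⨆ i, E.quotGroup (G i))) E.dirCone := by
  obtain ⟨k, S, C, G, hint, hne, hC, hcl, -, -, hle, hidx, hmem, hscal, -⟩ := hE
  obtain ⟨pr, hprm, hsum, hpr⟩ := hint.exists_proj
  have hCS : ∀ i, C i ⊆ S i := fun i x hx => by
    rw [← (hC i).1]; exact Submodule.subset_span hx
  have hsingle : ∀ i, ∀ x ∈ S i, ∀ j, pr j x = if j = i then x else 0 := by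
    intro i x hx j
    have h1 : ∑ l, (if l = i then x else 0) = x := by simp
    conv_lhs => rw [← h1]
    rw [hpr (fun l => if l = i then x else 0)]
    intro l
    by_cases h : l = i
    · subst h; simpa using hx
    · simp [h]
  refine ⟨k, S, C, pr, G, ⟨fun i => (hC i).1, fun i => ?_, fun i => (hC i).2.2.2.2.1,
    fun i x hx y hy hxy => ?_, fun x => ?_, hprm, hsum, fun i x hx => ?_, fun i j hij x hx => ?_⟩,
    hle, ?_, ?_, ?_⟩
  · obtain ⟨hsp, hclo, hconv, hsm, -, -⟩ := hC i
    refine ⟨hclo, ?_, fun {x y} hx hy => ?_, fun {x t} ht hx => hsm x hx t ht⟩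
    · rcases (C i).eq_empty_or_nonempty with h | ⟨x, hx⟩
      · rw [h, Submodule.span_empty] at hsp
        exact absurd hsp.symm (hne i)
      · simpa using hsm x hx 0 le_rfl
    · have h1 := hsm _ (hconv hx hy (a := 1 / 2) (b := 1 / 2) (by norm_num) (by norm_num)
        (by norm_num)) 2 (by norm_num)
      convert h1 using 1
      module
  · obtain ⟨hsp, -, -, hsm, -, hst⟩ := hC i
    obtain ⟨δ, hδ, h⟩ := exists_ball_of_mem_intrinsicInterior
      (fun x hx t ht => hsm x hx t ht.le) (hst x hx y hy hxy)
    rw [hsp] at h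
    exact ⟨δ, hδ, h⟩
  · rw [hcl]
    constructor
    · rintro ⟨c, hc, rfl⟩ i
      rw [hpr c fun i => hCS i (hc i)]
      exact hc i
    · exact fun h => ⟨fun i => pr i x, h, (hsum x).symm⟩
  · rw [hsingle i x hx, if_pos rfl]
  · rw [hsingle j x hx, if_neg hij]
  · rintro i T ⟨g, hg, hT⟩ y
    obtain ⟨x, rfl⟩ := E.mkQ_surjective y
    rw [hT]
    exact hmem i g hg x
  · rintro i j hj T ⟨g, hg, hT⟩
    obtain ⟨c, hc, h⟩ := hscal i j hj g hg
    refine ⟨c, hc, fun y hy => ?_⟩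
    obtain ⟨x, rfl⟩ := E.mkQ_surjective y
    rw [hT]
    exact h x hy
  · have h1 := E.isCocompact_of_relIndex hle hidx hfix
    rwa [le_antisymm (E.quotGroup_iSup_le hle hfix) E.iSup_quotGroup_le] at h1

theorem Admissible.isClosedCone {E : O.PREnd} (hE : E.Admissible)
    (hfix : ∀ g ∈ E.toPEnd.grp, g E.vec = E.vec) : IsClosedCone (closure E.dirCone) := by
  obtain ⟨k, S, C, pr, G, h, -⟩ := hE.exists_isStrictJoin hfix
  exact h.isClosedCone'

theorem Admissible.pointed {E : O.PREnd} (hE : E.Admissible)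
    (hfix : ∀ g ∈ E.toPEnd.grp, g E.vec = E.vec) :
    ∀ x ∈ closure E.dirCone, -x ∈ closure E.dirCone → x = 0 := by
  obtain ⟨k, S, C, pr, G, h, -⟩ := hE.exists_isStrictJoin hfix
  intro x hx hx'
  rw [h.mem_iff] at hx hx'
  rw [← h.sum_pr x]
  refine Finset.sum_eq_zero fun i _ => h.pointed i _ (hx i) ?_
  have := hx' i
  rwa [map_neg] at this

theorem Admissible.eq_interior {E : O.PREnd} (hE : E.Admissible)
    (hfix : ∀ g ∈ E.toPEnd.grp, g E.vec = E.vec) : E.dirCone = interior (closure E.dirCone) :=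
  (E.isCocompact hfix).eq_interior_closure (hE.isClosedCone hfix) (hE.pointed hfix)

theorem Admissible.ker_le_span {E : O.PREnd} (hE : E.Admissible)
    (hfix : ∀ g ∈ E.toPEnd.grp, g E.vec = E.vec) {φ : (Vec n ⧸ E.line) →L[ℝ] ℝ}
    (hφ : ∀ T ∈ E.quotGroup E.toPEnd.grp, ∃ χ : ℝ, 0 < χ ∧ ∀ x, φ (T x) = χ * φ x)
    (hpos : ∀ x ∈ E.dirCone, 0 < φ x) {e : Vec n ⧸ E.line} (he : φ e = 0) :
    e ∈ Submodule.span ℝ (closure E.dirCone ∩ {x | φ x = 0}) := by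
  obtain ⟨k, S, C, pr, G, h, hle, hmem, hscal, hco⟩ := hE.exists_isStrictJoin hfix
  refine IsJoinAction.ker_le_span (𝒢 := fun i => E.quotGroup (G i)) (S := S) (C := C) (pr := pr)
    ⟨h, hmem, hscal, ?_, hpos, E.dirCone_nonempty, hco, fun K hKΩ hK => ?_⟩ he
  · rintro i T ⟨g, hg, hT⟩
    exact hφ T ⟨g, hle (Subgroup.mem_iSup_of_mem i hg), hT⟩
  · exact (E.quotGroup_proper hle hK hKΩ).subset fun T ⟨hT, hx⟩ => ⟨E.iSup_quotGroup_le hT, hx⟩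

end ConvexProjOrbifold.PREnd

/-! ### Pushing compact sets to the boundary of a cone. -/

section Cones

variable {E : Type*} [NormedAddCommGroup E] [NormedSpace ℝ E]

/-- The interior of a set relative to a subspace. -/
def relInterior (H : Submodule ℝ E) (A : Set E) : Set E :=
  {x | x ∈ H ∧ ∃ δ : ℝ, 0 < δ ∧ ∀ s ∈ H, ‖s‖ < δ → x + s ∈ A}

theorem relInterior_subset {H : Submodule ℝ E} {A : Set E} : relInterior H A ⊆ A :=
  fun x ⟨_, _, hδ, h⟩ => by simpa using h 0 H.zero_mem (by simpa using hδ)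

theorem exists_add_mem_relInterior {H : Submodule ℝ E} {A : Set E} {x : E}
    (hx : x ∈ relInterior H A) :
    ∃ δ : ℝ, 0 < δ ∧ ∀ s ∈ H, ‖s‖ < δ → x + s ∈ relInterior H A := by
  obtain ⟨hxH, δ, hδ, h⟩ := hx
  refine ⟨δ / 2, half_pos hδ, fun s hs hsδ => ⟨H.add_mem hxH hs, δ / 2, half_pos hδ,
    fun s' hs' hs'δ => ?_⟩⟩
  rw [add_assoc]
  exact h _ (H.add_mem hs hs') ((norm_add_le _ _).trans_lt (by linarith))

variable [FiniteDimensional ℝ E]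

/-- Automorphisms that push a compact set to a boundary point `y` of the cone converge, and are
uniformly invertible on a subspace in which `y` is an interior point. -/
theorem IsCocompact.exists_tendsto_boundary {𝒯 : Set (E ≃L[ℝ] E)} {Ω : Set E}
    (h : IsCocompact 𝒯 Ω) (hQ : IsClosedCone (closure Ω))
    (hp : ∀ x ∈ closure Ω, -x ∈ closure Ω → x = 0) (hne : Ω.Nonempty) {y : E}
    {N : Submodule ℝ E} {δ : ℝ} (hδ : 0 < δ) (hy : ∀ s ∈ N, ‖s‖ < δ → y + s ∈ closure Ω) :
    ∃ F ⊆ Ω, IsCompact F ∧ ∃ (T : ℕ → E ≃L[ℝ] E) (f : ℕ → E) (T₀ : E →L[ℝ] E) (B : ℝ),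
      (∀ j, T j ∈ 𝒯 ∧ f j ∈ F) ∧ Tendsto (fun j => T j (f j)) atTop (𝓝 y) ∧
      Tendsto (fun j => (T j : E →L[ℝ] E)) atTop (𝓝 T₀) ∧ 0 < B ∧
      ∀ j, ∀ s ∈ N, ‖(T j).symm s‖ ≤ B * ‖s‖ := by
  have hyQ : y ∈ closure Ω := by simpa using hy 0 N.zero_mem (by simpa using hδ)
  have hint := h.eq_interior_closure hQ hp
  obtain ⟨F, hFΩ, hF, hco⟩ := h.exists_compact
  obtain ⟨ψ, hψ⟩ := hQ.exists_norm_le hp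
  obtain ⟨x, hx⟩ := hne
  have hxj : ∀ j : ℕ, (1 / ((j : ℝ) + 1)) • x + y ∈ Ω := fun j => by
    rw [hint] at hx ⊢
    exact hQ.smul_add_mem_interior (hQ.smul_mem_interior hx Nat.one_div_pos_of_nat) hyQ
  choose T hT f hf hTf using fun j => hco _ (hxj j)
  have hTQ : ∀ j z, T j z ∈ closure Ω ↔ z ∈ closure Ω := fun j =>
    map_mem_closure_iff (h.map_iff _ (hT j))
  have hlim : Tendsto (fun j => T j (f j)) atTop (𝓝 y) := by
    simp only [hTf]
    have := (tendsto_one_div_add_atTop_nhds_zero_nat (𝕜 := ℝ)).smul_const x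
    simpa using this.add_const y
  obtain ⟨M, hM⟩ := hQ.exists_norm_map_le hp hF (hFΩ.trans hint.subset) (‖x‖ + ‖y‖)
  have hTM : ∀ j, ‖(T j : E →L[ℝ] E)‖ ≤ M := fun j => by
    refine hM _ (fun z hz => (hTQ j z).2 hz) ⟨f j, hf j, ?_⟩
    change ‖T j (f j)‖ ≤ _
    rw [hTf]
    refine (norm_add_le _ _).trans (add_le_add_left ?_ _)
    rw [norm_smul, Real.norm_of_nonneg Nat.one_div_pos_of_nat.le]
    refine mul_le_of_le_one_left (norm_nonneg _) ?_
    rw [div_le_one (by positivity)]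
    linarith [(Nat.cast_nonneg j : (0 : ℝ) ≤ j)]
  have : ProperSpace (E →L[ℝ] E) := FiniteDimensional.proper ℝ _
  obtain ⟨T₀, -, σ, hσ, hT₀⟩ := (isCompact_closedBall (0 : E →L[ℝ] E) M).tendsto_subseq
    (x := fun j => (T j : E →L[ℝ] E)) fun j => by simpa using hTM j
  obtain ⟨R, hR⟩ := hF.isBounded.exists_norm_le
  have hR0 : 0 ≤ R := (norm_nonneg _).trans (hR _ (hf 0))
  -- the inverses are bounded on `N`
  have hinvy : ∀ j, ψ ((T j).symm y) ≤ ‖ψ‖ * R := fun j => by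
    have h1 : f j = (1 / ((j : ℝ) + 1)) • (T j).symm x + (T j).symm y := by
      rw [← map_smul, ← map_add, ← hTf, (T j).symm_apply_apply]
    have h2 : (T j).symm x ∈ closure Ω := by
      rw [← hTQ j, (T j).apply_symm_apply]; exact subset_closure hx
    have h3 : 0 ≤ ψ ((1 / ((j : ℝ) + 1)) • (T j).symm x) :=
      (norm_nonneg _).trans (hψ _ (hQ.smul_mem Nat.one_div_pos_of_nat.le h2))
    have h4 : ψ (f j) ≤ ‖ψ‖ * R := (le_abs_self _).trans
      ((ψ.le_opNorm _).trans (mul_le_mul_of_nonneg_left (hR _ (hf j)) (norm_nonneg _)))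
    rw [h1, map_add] at h4
    linarith
  -- The preimages of y + s and y - s lie in the cone and average to the preimage of y, on which ψ
  -- is at most ψ (f j); so the preimage of s is bounded.
  have hsmall : ∀ j, ∀ s ∈ N, ‖s‖ < δ → ‖(T j).symm s‖ ≤ 3 * (‖ψ‖ * R) := by
    intro j s hs hsδ
    have key : ∀ s ∈ N, ‖s‖ < δ → (T j).symm y + (T j).symm s ∈ closure Ω := by
      intro s hs hsδ
      rw [← map_add, ← hTQ j, (T j).apply_symm_apply]
      exact hy s hs hsδ
    have h1 := key s hs hsδ
    have h2 := key (-s) (N.neg_mem hs) (by rwa [norm_neg])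
    have h3 : 0 ≤ ψ ((T j).symm y + (T j).symm (-s)) := (norm_nonneg _).trans (hψ _ h2)
    have h4 := hψ _ h1
    have hy0 : (T j).symm y ∈ closure Ω := by
      rwa [← hTQ j, (T j).apply_symm_apply]
    have h5 := hψ _ hy0
    have h6 : ‖(T j).symm s‖ ≤ ‖(T j).symm y + (T j).symm s‖ + ‖(T j).symm y‖ := by
      have := norm_sub_le ((T j).symm y + (T j).symm s) ((T j).symm y)
      rwa [add_sub_cancel_left] at this
    rw [map_neg, map_add, map_neg] at h3
    rw [map_add] at h4
    have := hinvy j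
    linarith
  refine ⟨F, hFΩ, hF, T ∘ σ, f ∘ σ, T₀, (3 * (‖ψ‖ * R)) * (2 / δ) + 1,
    fun j => ⟨hT _, hf _⟩, hlim.comp hσ.tendsto_atTop, hT₀, by positivity, fun j s hs => ?_⟩
  rcases eq_or_ne s 0 with rfl | hs0
  · simp
  have hsn : 0 < ‖s‖ := norm_pos_iff.2 hs0
  have h1 := hsmall (σ j) ((δ / (2 * ‖s‖)) • s) (N.smul_mem _ hs) (by
    rw [norm_smul, Real.norm_of_nonneg (by positivity)]
    field_simp; norm_num)
  rw [map_smul, norm_smul, Real.norm_of_nonneg (by positivity), div_mul_eq_mul_div,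
    div_le_iff₀ (by positivity)] at h1
  have h2 : ‖(T (σ j)).symm s‖ ≤ 3 * (‖ψ‖ * R) * (2 / δ) * ‖s‖ := by
    rw [show 3 * (‖ψ‖ * R) * (2 / δ) * ‖s‖ = 3 * (‖ψ‖ * R) * (2 * ‖s‖) / δ by ring,
      le_div_iff₀ hδ, mul_comm]
    exact h1
  change ‖(T (σ j)).symm s‖ ≤ _
  rw [add_mul, one_mul]
  linarith

theorem map_mem_relInterior {H : Submodule ℝ E} {A : Set E} (g : E ≃ₗ[ℝ] E)
    (hH : ∀ x, g x ∈ H ↔ x ∈ H) (hA : ∀ x, g x ∈ A ↔ x ∈ A) {x : E} (hx : x ∈ relInterior H A) :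
    g x ∈ relInterior H A := by
  obtain ⟨hxH, δ, hδ, h⟩ := hx
  set L : E →L[ℝ] E := LinearMap.toContinuousLinearMap (g.symm : E →ₗ[ℝ] E) with hL
  have hLx : ∀ s, L s = g.symm s := fun s => rfl
  refine ⟨(hH x).2 hxH, δ / (‖L‖ + 1), by positivity, fun s hs hsδ => ?_⟩
  have h1 : g x + s = g (x + L s) := by rw [map_add, hLx, g.apply_symm_apply]
  rw [h1, hA]
  refine h _ ((hH _).1 (by rwa [hLx, g.apply_symm_apply])) ((L.le_opNorm s).trans_lt ?_)
  rw [lt_div_iff₀ (by positivity)] at hsδ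
  nlinarith [norm_nonneg s, norm_nonneg L]

theorem relInterior_span_nonempty {A : Set E} (hA : Convex ℝ A) (hne : A.Nonempty)
    (hs : ∀ x ∈ A, ∀ t : ℝ, 0 < t → t • x ∈ A) : (relInterior (Submodule.span ℝ A) A).Nonempty := by
  obtain ⟨a, ha⟩ := hne.intrinsicInterior hA
  obtain ⟨δ, hδ, h⟩ := exists_ball_of_mem_intrinsicInterior hs ha
  exact ⟨a, Submodule.subset_span (intrinsicInterior_subset ha), δ, hδ, h⟩

end Cones

theorem exists_ker_eq {n : ℕ} {H : Submodule ℝ (Vec n)} (hH : Module.finrank ℝ H = n) :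
    ∃ φ : Vec n →ₗ[ℝ] ℝ, LinearMap.ker φ = H := by
  have hfr : Module.finrank ℝ (Vec n) = n + 1 := by simp
  have hlt : H < ⊤ := lt_top_iff_ne_top.2 fun h => by
    rw [h, finrank_top, hfr] at hH; omega
  obtain ⟨φ, hφ0, hφ⟩ := Submodule.exists_le_ker_of_lt_top H hlt
  refine ⟨φ, (Submodule.eq_of_le_of_finrank_eq hφ ?_).symm⟩
  have h1 := φ.finrank_range_add_finrank_ker
  rw [LinearMap.range_eq_top.2 (LinearMap.surjective hφ0), finrank_top, Module.finrank_self,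
    hfr] at h1
  omega

theorem exists_map_eq_mul {n : ℕ} {φ : Vec n →ₗ[ℝ] ℝ} {g : LinAut n}
    (hg : ∀ x, φ x = 0 → φ (g x) = 0) : ∃ χ : ℝ, ∀ x, φ (g x) = χ * φ x := by
  by_cases h0 : ∀ x, φ x = 0
  · exact ⟨0, fun x => by rw [h0, h0, mul_zero]⟩
  · push Not at h0
    obtain ⟨w, hw⟩ := h0
    refine ⟨φ (g w) / φ w, fun x => ?_⟩
    have h1 := hg (x - (φ x / φ w) • w) (by
      rw [map_sub, map_smul, smul_eq_mul, div_mul_cancel₀ _ hw, sub_self])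
    rw [map_sub, map_smul, map_sub, map_smul, smul_eq_mul, sub_eq_zero] at h1
    rw [h1]; ring

/-! ### The invariant hyperplane misses the vertex. -/

namespace ConvexProjOrbifold

variable {n : ℕ} (O : ConvexProjOrbifold n)

theorem isOpen_cone_interior : IsOpen (cone (interior O.dom)) := isOpen_cone isOpen_interior

theorem convex_cone_interior : Convex ℝ (cone (interior O.dom)) := by
  rw [cone_interior]; exact O.convex.1.interior

variable {O}

theorem add_mem_cone_interior {x y : Vec n} (hx : x ∈ cone (interior O.dom))
    (hy : y ∈ cone (interior O.dom)) : x + y ∈ cone (interior O.dom) := by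
  have := smul_mem_cone (O.convex_cone_interior hx hy (a := 1 / 2) (b := 1 / 2) (by norm_num)
    (by norm_num) (by norm_num)) (t := 2) (by norm_num)
  convert this using 1
  module

namespace PREnd

variable (E : O.PREnd)

theorem cone_rad_subset : cone E.rad ⊆ cone (interior O.dom) :=
  cone_mono E.rad_proper.subset_interior

/-- Split off a small multiple of a point of the radial neighborhood, which is stable under adding
multiples of `vec`, and use convexity of the domain. -/
theorem add_vec_mem_cone_interior {x : Vec n} (hx : x ∈ cone (interior O.dom)) {c : ℝ}
    (hc : 0 ≤ c) : x + c • E.vec ∈ cone (interior O.dom) := by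
  obtain ⟨p, hp⟩ := E.rad_proper.nonempty
  obtain ⟨w, hw⟩ := exists_mem_cone p
  have hw := mem_cone_of_mem hp hw
  have hlim : Tendsto (fun η : ℝ => x - η • w) (𝓝[>] 0) (𝓝 x) := by
    have h1 : Continuous fun η : ℝ => x - η • w := by fun_prop
    have h2 := h1.tendsto 0
    rw [zero_smul, sub_zero] at h2
    exact h2.mono_left nhdsWithin_le_nhds
  obtain ⟨η, hη, hη0⟩ := ((hlim.eventually (O.isOpen_cone_interior.mem_nhds hx)).and
    self_mem_nhdsWithin).exists
  have hη0 : 0 < η := hη0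
  have h1 := smul_mem_cone (E.cone_rad_subset (E.add_mem_cone_rad hw (c := η⁻¹ * c)
    (by positivity))) hη0
  have h2 := add_mem_cone_interior hη h1
  rw [smul_add, smul_smul, mul_inv_cancel_left₀ hη0.ne'] at h2
  convert h2 using 1
  module

/-- A ball around `vec` avoids the closed cone over D; dividing x + s vec by s shows that s cannot
be large compared with x. -/
theorem exists_fiber_bound {D : Set (ProjSphere n)} (hv : E.vertex ∉ closure D) :
    ∃ ρ : ℝ, 0 < ρ ∧ ∀ (x : Vec n) (s : ℝ), 0 < s → x + s • E.vec ∈ closure (cone D) →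
      s * ρ ≤ ‖x‖ := by
  have h1 : E.vec ∉ closure (cone D) := fun h => hv (by
    have : E.vec ∈ cone (closure D) := by
      rw [cone_closure]; exact ⟨h, E.vec_ne_zero⟩
    exact mem_of_mem_cone E.vec_mem this)
  obtain ⟨ρ, hρ, hb⟩ := Metric.isOpen_iff.1 isClosed_closure.isOpen_compl _ h1
  refine ⟨ρ, hρ, fun x s hs h => ?_⟩
  by_contra! hlt
  refine hb (a := s⁻¹ • x + E.vec) ?_ ?_
  · rw [Metric.mem_ball, dist_eq_norm, add_sub_cancel_right, norm_smul, norm_inv,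
      Real.norm_of_nonneg hs.le, inv_mul_lt_iff₀ hs]
    exact hlt
  · have h2 : s⁻¹ • x + E.vec = s⁻¹ • (x + s • E.vec) := by
      rw [smul_add, smul_smul, inv_mul_cancel₀ hs.ne', one_smul]
    rw [h2]
    have h3 : s⁻¹ • (x + s • E.vec) ∈ (fun z : Vec n => s⁻¹ • z) '' closure (cone D) :=
      ⟨_, h, rfl⟩
    refine closure_mono ?_ (image_closure_subset_closure_image (continuous_const_smul s⁻¹) h3)
    rintro _ ⟨z, hz, rfl⟩
    exact smul_mem_cone hz (inv_pos.2 hs)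

/-- The hyperplane `H` through the vertex is the kernel of an eigenfunctional on the quotient that is
positive on the cone of directions. -/
theorem exists_eigenfunctional (hE : E.Admissible)
    (hfix : ∀ g ∈ E.toPEnd.grp, g E.vec = E.vec) {H : Submodule ℝ (Vec n)}
    (hDfr : Module.finrank ℝ H = n) (hgH1 : ∀ g ∈ E.toPEnd.grp, ∀ x ∈ H, g x ∈ H)
    (hvH : E.vec ∈ H) : ∃ φ : (Vec n ⧸ E.line) →L[ℝ] ℝ, (∀ x ∈ E.dirCone, 0 < φ x) ∧
      (∀ x, φ (E.line.mkQ x) = 0 ↔ x ∈ H) ∧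
      ∀ T ∈ E.quotGroup E.toPEnd.grp, ∃ χ : ℝ, 0 < χ ∧ ∀ x, φ (T x) = χ * φ x := by
  obtain ⟨φ₀, hφ₀⟩ := exists_ker_eq hDfr
  have hkerH : ∀ x, φ₀ x = 0 ↔ x ∈ H := fun x => by rw [← hφ₀, LinearMap.mem_ker]
  have hline : E.line ≤ LinearMap.ker φ₀ := fun x hx => by
    obtain ⟨c, rfl⟩ := E.mem_line_iff.1 hx
    rw [hφ₀]; exact H.smul_mem _ hvH
  obtain ⟨φ₁, hφ₁⟩ : ∃ φ : (Vec n ⧸ E.line) →L[ℝ] ℝ, ∀ x, φ (E.line.mkQ x) = φ₀ x :=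
    ⟨LinearMap.toContinuousLinearMap (E.line.liftQ φ₀ hline), fun x => rfl⟩
  have hQ := hE.isClosedCone hfix
  have hp := hE.pointed hfix
  have hΩ := hE.eq_interior hfix
  have hco := E.isCocompact hfix
  have hφ₁0 : φ₁ ≠ 0 := by
    rintro rfl
    have : H = ⊤ := eq_top_iff.2 fun x _ => (hkerH x).1 (hφ₁ x).symm
    rw [this, finrank_top] at hDfr
    simp at hDfr
  have heig : ∀ T ∈ E.quotGroup E.toPEnd.grp, ∃ χ : ℝ, ∀ x, φ₁ (T x) = χ * φ₁ x := by
    rintro T ⟨g, hg, hT⟩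
    obtain ⟨χ, hχ⟩ := exists_map_eq_mul (φ := φ₀) (g := g)
      fun x hx => (hkerH _).2 (hgH1 g hg x ((hkerH x).1 hx))
    refine ⟨χ, fun y => ?_⟩
    obtain ⟨x, rfl⟩ := E.mkQ_surjective y
    rw [hT, hφ₁, hφ₁, hχ]
  have hne : ∀ x ∈ E.dirCone, φ₁ x ≠ 0 := fun x hx =>
    hco.ne_zero_of_eigen hQ hp hφ₁0 (by
      rintro T ⟨T', hT', t, ht, hTx⟩
      obtain ⟨χ, hχ⟩ := heig T' hT'
      exact ⟨t * χ, fun x => by rw [hTx, map_smul, hχ, smul_eq_mul, mul_assoc]⟩) hx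
  have hconvΩ : Convex ℝ E.dirCone := by rw [hΩ]; exact hQ.convex.interior
  -- choose the sign
  obtain ⟨φ, hφ, hpos⟩ : ∃ φ : (Vec n ⧸ E.line) →L[ℝ] ℝ, (φ = φ₁ ∨ φ = -φ₁) ∧
      ∀ x ∈ E.dirCone, 0 < φ x := by
    have hpre : IsPreconnected (φ₁ '' E.dirCone) :=
      hconvΩ.isPreconnected.image _ φ₁.continuous.continuousOn
    obtain ⟨a, ha⟩ := E.dirCone_nonempty
    rcases lt_or_gt_of_ne (hne a ha) with h | h
    · refine ⟨-φ₁, Or.inr rfl, fun x hx => ?_⟩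
      by_contra! hle
      have hle' : 0 ≤ φ₁ x := by simpa using hle
      obtain ⟨z, hz, hz0⟩ := hpre.ordConnected.out ⟨a, ha, rfl⟩ ⟨x, hx, rfl⟩ ⟨h.le, hle'⟩
      exact hne z hz hz0
    · refine ⟨φ₁, Or.inl rfl, fun x hx => ?_⟩
      by_contra! hle
      obtain ⟨z, hz, hz0⟩ := hpre.ordConnected.out ⟨x, hx, rfl⟩ ⟨a, ha, rfl⟩ ⟨hle, h.le⟩
      exact hne z hz hz0
  have hφ0 : ∀ x, φ (E.line.mkQ x) = 0 ↔ x ∈ H := fun x => by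
    rw [← hkerH, ← hφ₁]
    rcases hφ with rfl | rfl
    · rfl
    · rw [_root_.neg_apply, neg_eq_zero]
  have heig' : ∀ T ∈ E.quotGroup E.toPEnd.grp, ∃ χ : ℝ, 0 < χ ∧ ∀ x, φ (T x) = χ * φ x := by
    intro T hT
    obtain ⟨χ, hχ⟩ := heig T hT
    have h1 : ∀ x, φ (T x) = χ * φ x := fun x => by
      rcases hφ with rfl | rfl
      · exact hχ x
      · rw [_root_.neg_apply, _root_.neg_apply, hχ]; ring
    refine ⟨χ, ?_, h1⟩
    obtain ⟨a, ha⟩ := E.dirCone_nonempty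
    have h2 := hpos _ ((hco.map_iff T ⟨T, hT, 1, one_pos, fun x => (one_smul ℝ _).symm⟩ a).2 ha)
    rw [h1] at h2
    exact pos_of_mul_pos_left h2 (hpos a ha).le
  exact ⟨φ, hpos, hφ0, heig'⟩

set_option maxHeartbeats 1000000 in
/-- The hyperplane spanned by an invariant totally geodesic domain misses the vertex. -/
theorem vec_notMem_span (hn : 2 ≤ n) (hE : E.Admissible)
    (hfix : ∀ g ∈ E.toPEnd.grp, g E.vec = E.vec) {D : Set (ProjSphere n)}
    (hDfr : Module.finrank ℝ (Submodule.span ℝ (cone D)) = n) (hDconv : Convex ℝ (cone D))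
    (hDinv : ∀ g ∈ E.toPEnd.grp, g • D = D) (hDd : D ⊆ interior O.dom)
    (hv : E.vertex ∉ closure D) : E.vec ∉ Submodule.span ℝ (cone D) := by
  intro hvH
  set H := Submodule.span ℝ (cone D) with hH
  have hgD : ∀ g ∈ E.toPEnd.grp, ∀ x, g x ∈ cone D ↔ x ∈ cone D := fun g hg x =>
    apply_mem_cone_of_smul_eq (hDinv g hg)
  have hgH1 : ∀ g ∈ E.toPEnd.grp, ∀ x ∈ H, g x ∈ H := by
    intro g hg x hx
    have : H ≤ H.comap (g : Vec n →ₗ[ℝ] Vec n) := Submodule.span_le.2 fun y hy =>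
      Submodule.subset_span ((hgD g hg y).2 hy)
    exact this hx
  have hgH : ∀ g ∈ E.toPEnd.grp, ∀ x, g x ∈ H ↔ x ∈ H := fun g hg x =>
    ⟨fun h => by simpa using hgH1 g⁻¹ (E.toPEnd.grp.inv_mem hg) _ h, hgH1 g hg x⟩
  obtain ⟨ρ, hρ, hbound⟩ := E.exists_fiber_bound hv
  obtain ⟨φ, hpos, hφ0, heig'⟩ := E.exists_eigenfunctional hE hfix hDfr hgH1 hvH
  have hQ := hE.isClosedCone hfix
  have hp := hE.pointed hfix
  have hΩ := hE.eq_interior hfix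
  have hco := E.isCocompact hfix
  -- a relatively interior point of the face
  set A := closure E.dirCone ∩ {x | φ x = 0} with hA
  have hAcone : ∀ x ∈ A, ∀ t : ℝ, 0 < t → t • x ∈ A := fun x hx t ht =>
    ⟨hQ.smul_mem ht.le hx.1, by
      have : φ x = 0 := hx.2
      change φ (t • x) = 0
      rw [map_smul, this, smul_zero]⟩
  have hAconv : Convex ℝ A := hQ.convex.inter (convex_hyperplane φ.isLinear 0)
  obtain ⟨y, -, δ, hδ, hyδ⟩ := relInterior_span_nonempty hAconv
    ⟨0, hQ.zero_mem, map_zero φ⟩ hAcone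
  have hyA : y ∈ A := by simpa using hyδ 0 (Submodule.zero_mem _) (by simpa using hδ)
  -- The face spans the whole kernel, so y is interior to the face relative to ker φ.
  have hyQ : ∀ s ∈ LinearMap.ker (φ : (Vec n ⧸ E.line) →ₗ[ℝ] ℝ), ‖s‖ < δ →
      y + s ∈ closure E.dirCone := fun s hs hsδ =>
    (hyδ s (hE.ker_le_span hfix heig' hpos hs) hsδ).1
  obtain ⟨F, hFΩ, hF, T, f, T₀, B, hTf, hlim, hT₀, hB, hinv⟩ :=
    hco.exists_tendsto_boundary hQ hp E.dirCone_nonempty hδ hyQ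
  choose T' hT' t ht hTx using fun j => (hTf j).1
  choose g hg hTg using hT'
  have hTmk : ∀ j x, T j (E.line.mkQ x) = E.line.mkQ (t j • g j x) := fun j x => by
    rw [hTx, hTg, map_smul]
  -- the relative interior of the invariant domain
  have hDne : (cone D).Nonempty := by
    rw [nonempty_iff_ne_empty]
    intro h0
    rw [hH, h0, Submodule.span_empty, finrank_bot] at hDfr
    omega
  obtain ⟨d, hd⟩ := relInterior_span_nonempty hDconv hDne fun x hx t ht => smul_mem_cone hx ht
  rw [← hH] at hd
  have hDI : cone D ⊆ cone (interior O.dom) := cone_mono hDd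
  have hsm : ∀ x ∈ relInterior H (cone D), ∀ t : ℝ, 0 < t → t • x ∈ relInterior H (cone D) :=
    fun x hx t ht => map_mem_relInterior (LinearEquiv.smulOfNeZero ℝ (Vec n) t ht.ne')
      (fun x => H.smul_mem_iff ht.ne') (fun x => smul_mem_cone_iff ht) hx
  have hgDo : ∀ g ∈ E.toPEnd.grp, ∀ x ∈ relInterior H (cone D), g x ∈ relInterior H (cone D) :=
    fun g hg x hx => map_mem_relInterior g (hgH g hg) (hgD g hg) hx
  -- A positive multiple of `vec` is excluded because the vertex is not in D; a nonpositive one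
  -- because adding |c| vec would reach the origin inside the cone over the domain.
  have hdl : E.line.mkQ d ≠ 0 := by
    intro h0
    obtain ⟨c, hc⟩ := E.mem_line_iff.1 ((Submodule.Quotient.mk_eq_zero _).1 h0)
    have hdD := relInterior_subset hd
    rw [← hc] at hdD
    have hcD := add_vec_mem_cone_interior E (hDI hdD) (c := |c|) (abs_nonneg _)
    rcases lt_or_ge 0 c with h | h
    · refine hv (subset_closure (mem_of_mem_cone E.vec_mem ?_))
      exact (smul_mem_cone_iff h).1 hdD
    · rw [abs_of_nonpos h, neg_smul, add_neg_cancel] at hcD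
      exact hcD.1 rfl
  -- lift the limit
  obtain ⟨σ₀, hσ₀⟩ := LinearMap.exists_rightInverse_of_surjective E.line.mkQ
    (Submodule.range_mkQ _)
  set σ : (Vec n ⧸ E.line) →L[ℝ] Vec n := LinearMap.toContinuousLinearMap σ₀ with hσdef
  have hσ : ∀ u, E.line.mkQ (σ u) = u := fun u => LinearMap.congr_fun hσ₀ u
  have hdφ : φ (E.line.mkQ d) = 0 := (hφ0 d).2 hd.1
  have hTφ : ∀ j x, φ x = 0 ↔ φ (T j x) = 0 := fun j x => by
    obtain ⟨χ, hχ, h⟩ := heig' (T' j) ⟨g j, hg j, hTg j⟩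
    rw [hTx, map_smul, h, smul_eq_mul]
    simp [(ht j).ne', hχ.ne']
  set u : ℕ → Vec n ⧸ E.line := fun j => T j (E.line.mkQ d) - T₀ (E.line.mkQ d) with hu
  have hTd : Tendsto (fun j => T j (E.line.mkQ d)) atTop (𝓝 (T₀ (E.line.mkQ d))) :=
    ((ContinuousLinearMap.apply ℝ _ (E.line.mkQ d)).continuous.tendsto T₀).comp hT₀
  have hu0 : Tendsto u atTop (𝓝 0) := by
    have := hTd.sub_const (T₀ (E.line.mkQ d))
    rwa [sub_self] at this
  have hT₀φ : φ (T₀ (E.line.mkQ d)) = 0 := by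
    refine tendsto_nhds_unique ((φ.continuous.tendsto _).comp hTd) ?_
    refine tendsto_const_nhds.congr fun j => ?_
    exact ((hTφ j _).1 hdφ).symm
  have huφ : ∀ j, φ (u j) = 0 := fun j => by
    rw [hu, map_sub, hT₀φ, sub_zero, ← hTφ]; exact hdφ
  have hσH : ∀ x, φ x = 0 → σ x ∈ H := fun x hx => by rwa [← hφ0, hσ]
  have huinv : Tendsto (fun j => (T j).symm (u j)) atTop (𝓝 0) := by
    refine squeeze_zero_norm (fun j => hinv j _ (huφ j)) ?_
    simpa using hu0.norm.const_mul B
  -- The limit direction is attained: it equals T j applied to the direction of d minus a vector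
  -- tending to 0 in ker φ, and the corrected point is still in the relative interior of the cone
  -- over D.
  obtain ⟨e₀, he₀, he₀T⟩ : ∃ e ∈ relInterior H (cone D), E.line.mkQ e = T₀ (E.line.mkQ d) := by
    obtain ⟨η, hη, hd'⟩ := exists_add_mem_relInterior hd
    have h1 : Tendsto (fun j => ‖-σ ((T j).symm (u j))‖) atTop (𝓝 0) := by
      have := ((σ.continuous.tendsto 0).comp huinv).neg.norm
      simpa using this
    obtain ⟨j, hj⟩ := (h1.eventually (gt_mem_nhds hη)).exists
    refine ⟨_, hsm _ (hgDo _ (hg j) _ (hd' _ (H.neg_mem (hσH _ ?_)) hj)) _ (ht j), ?_⟩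
    · rw [hTφ j, (T j).apply_symm_apply]; exact huφ j
    · rw [← hTmk, map_add, map_neg, hσ, map_add, map_neg, (T j).apply_symm_apply, hu]
      simp
  obtain ⟨η₁, hη₁, he₀'⟩ := exists_add_mem_relInterior he₀
  obtain ⟨η₂, hη₂, hball⟩ := Metric.isOpen_iff.1 O.isOpen_cone_interior e₀
    (hDI (relInterior_subset he₀))
  -- the end point of a fibre
  set S := {s : ℝ | d + s • E.vec ∈ relInterior H (cone D)} with hS
  have hS0 : (0 : ℝ) ∈ S := by
    change d + (0 : ℝ) • E.vec ∈ relInterior H (cone D)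
    simpa using hd
  have hSb : BddAbove S := by
    refine ⟨‖d‖ / ρ, fun s hs => ?_⟩
    rcases lt_or_ge 0 s with h | h
    · have hs' : d + s • E.vec ∈ relInterior H (cone D) := hs
      rw [le_div_iff₀ hρ]
      exact hbound d s h (subset_closure (relInterior_subset hs'))
    · exact h.trans (by positivity)
  set α := sSup S with hα
  have hα0 : 0 ≤ α := le_csSup hSb hS0
  set q := d + α • E.vec with hq
  have hqI : q ∈ cone (interior O.dom) :=
    add_vec_mem_cone_interior E (hDI (relInterior_subset hd)) hα0
  have hqcl : q ∈ closure (cone D) := by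
    have hSc : Continuous fun s : ℝ => d + s • E.vec := by fun_prop
    have h1 : q ∈ (fun s : ℝ => d + s • E.vec) '' closure S :=
      ⟨α, csSup_mem_closure ⟨0, hS0⟩ hSb, rfl⟩
    refine closure_mono ?_ (image_closure_subset_closure_image hSc h1)
    rintro _ ⟨s, hs, rfl⟩
    have hs' : d + s • E.vec ∈ relInterior H (cone D) := hs
    exact relInterior_subset hs'
  set R := (‖e₀‖ + η₂) / ρ with hR
  have hR0 : 0 ≤ R := by positivity
  -- K contains q and, for large j, the images t j • g j q, which lie over directions close to that
  -- of e₀ at a height between 0 and R.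
  set K : Set (Vec n) := insert q ((fun p : Vec n × ℝ => p.1 + p.2 • E.vec) ''
    (Metric.closedBall e₀ (η₂ / 2) ×ˢ Icc 0 R)) with hK
  have hKc : IsCompact K :=
    (((isCompact_closedBall _ _).prod isCompact_Icc).image (by fun_prop)).insert q
  have hKd : K ⊆ cone O.dom := by
    refine (insert_subset hqI ?_).trans (cone_mono interior_subset)
    rintro _ ⟨⟨e, r⟩, ⟨he, hr⟩, rfl⟩
    exact add_vec_mem_cone_interior E (hball (Metric.closedBall_subset_ball (half_lt_self hη₂) he))
      hr.1
  have hfin := finite_of_isCompact_subset_cone hKc hKd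
  have hev : ∀ᶠ j in atTop, g j ∈ {g : LinAut n | g ∈ O.grp ∧ ∃ b ∈ K, ∃ t : ℝ, 0 < t ∧
      t • g b ∈ K} := by
    have h1 : Tendsto (fun j => ‖σ (u j)‖) atTop (𝓝 0) := by
      have := ((σ.continuous.tendsto 0).comp hu0).norm
      simpa using this
    filter_upwards [h1.eventually (gt_mem_nhds (lt_min hη₁ (half_pos hη₂)))] with j hj
    have hej := he₀' _ (hσH _ (huφ j)) (hj.trans_le (min_le_left _ _))
    have hej2 : ‖σ (u j)‖ < η₂ / 2 := hj.trans_le (min_le_right _ _)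
    obtain ⟨r, hr⟩ : ∃ r : ℝ, t j • g j q = e₀ + σ (u j) + r • E.vec := by
      rw [← E.mkQ_eq_iff, ← hTmk, hq, map_add, map_smul, E.mkQ_vec, smul_zero, add_zero, map_add,
        he₀T, hσ, hu]
      simp
    -- q is the upper end of its fibre and g j preserves D, so q is not sent below the point e₀ + σ
    -- (u j) of the relative interior. The upper bound on r comes from `exists_fiber_bound`.
    have hr0 : 0 ≤ r := by
      have h2 : t j • g j (d + (α - (t j)⁻¹ * r) • E.vec) = e₀ + σ (u j) := by
        rw [← sub_eq_iff_eq_add] at hr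
        rw [← hr, hq, map_add, map_add, map_smul, map_smul, hfix _ (hg j), sub_smul, smul_add,
          smul_add, smul_sub, smul_smul (t j) (_ * _), mul_inv_cancel_left₀ (ht j).ne']
        abel
      have h3 : d + (α - (t j)⁻¹ * r) • E.vec ∈ relInterior H (cone D) := by
        have h4 := hgDo _ (E.toPEnd.grp.inv_mem (hg j)) _ (hsm _ hej _ (inv_pos.2 (ht j)))
        rw [← h2, smul_smul, inv_mul_cancel₀ (ht j).ne', one_smul] at h4
        have h6 : (g j)⁻¹ (g j (d + (α - (t j)⁻¹ * r) • E.vec)) = d + (α - (t j)⁻¹ * r) • E.vec :=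
          (g j).symm_apply_apply _
        rwa [h6] at h4
      have h5 : α - (t j)⁻¹ * r ≤ α := le_csSup hSb h3
      have h6 : 0 ≤ (t j)⁻¹ * r := by linarith
      exact nonneg_of_mul_nonneg_right h6 (inv_pos.2 (ht j))
    have hrR : r ≤ R := by
      rcases hr0.eq_or_lt with h | h
      · rw [← h]; exact hR0
      rw [hR, le_div_iff₀ hρ]
      have h0 : ‖e₀ + σ (u j)‖ ≤ ‖e₀‖ + η₂ := (norm_add_le _ _).trans (by linarith)
      refine (hbound _ r h ?_).trans h0
      rw [← hr]
      have h2 : t j • g j q ∈ (fun x => t j • g j x) '' closure (cone D) := ⟨q, hqcl, rfl⟩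
      have h3 : Continuous fun x => t j • g j x :=
        (continuous_const_smul (t j)).comp (g j : Vec n →ₗ[ℝ] Vec n).continuous_of_finiteDimensional
      refine closure_mono ?_ (image_closure_subset_closure_image h3 h2)
      rintro _ ⟨x, hx, rfl⟩
      exact smul_mem_cone ((hgD _ (hg j) x).2 hx) (ht j)
    refine ⟨(hg j).1, q, mem_insert _ _, t j, ht j, mem_insert_of_mem _ ⟨(_, r), ⟨?_, hr0, hrR⟩,
      hr.symm⟩⟩
    rw [Metric.mem_closedBall, dist_eq_norm, add_sub_cancel_left]
    exact hej2.le
  obtain ⟨g₁, hg₁⟩ : ∃ g₁, ∃ᶠ j in atTop, g j = g₁ := by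
    by_contra! hcon
    have h1 := (eventually_all_finite hfin).2 fun g₁ _ => hcon g₁
    obtain ⟨j, hj, hj'⟩ := (hev.and h1).exists
    exact hj' _ hj rfl
  obtain ⟨j₁, hj₁⟩ := hg₁.exists
  have hTeq : ∀ j, g j = g₁ → T' j = T' j₁ := fun j hj =>
    E.ext_mkQ fun x => by rw [hTg, hTg, hj, hj₁]
  -- the scalars are bounded
  set a := ‖E.line.mkQ (g₁ d)‖ with ha
  have hTd' : ∀ j, g j = g₁ → ‖T j (E.line.mkQ d)‖ = t j * a := fun j hj => by
    rw [hTmk, map_smul, norm_smul, Real.norm_of_nonneg (ht j).le, hj]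
  -- Uniform invertibility on ker φ keeps the scalars t j with g j = g₁ away from 0.
  have hlow : ∀ j, ‖E.line.mkQ d‖ / B ≤ ‖T j (E.line.mkQ d)‖ := fun j => by
    rw [div_le_iff₀' hB]
    have := hinv j (T j (E.line.mkQ d)) ((hTφ j _).1 hdφ)
    rwa [(T j).symm_apply_apply] at this
  have hlow0 : 0 < ‖E.line.mkQ d‖ / B := div_pos (norm_pos_iff.2 hdl) hB
  have ha0 : 0 < a := by
    have h1 := hlow0.trans_le (hlow j₁)
    rw [hTd' j₁ hj₁] at h1
    exact pos_of_mul_pos_right h1 (ht j₁).le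
  obtain ⟨b, hb⟩ : ∃ b : ℝ, ∀ᶠ j in atTop, ‖T j (E.line.mkQ d)‖ ≤ b :=
    ⟨‖T₀ (E.line.mkQ d)‖ + 1, (hTd.norm.eventually (gt_mem_nhds (lt_add_one _))).mono
      fun _ h => h.le⟩
  set C : Set (Vec n ⧸ E.line) := (fun p : ℝ × (Vec n ⧸ E.line) => p.1 • T' j₁ p.2) ''
    (Icc (‖E.line.mkQ d‖ / B / a) (b / a) ×ˢ F) with hC
  have hCc : IsCompact C := (isCompact_Icc.prod hF).image (by fun_prop)
  have hCΩ : C ⊆ E.dirCone := by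
    rintro _ ⟨⟨s, x⟩, ⟨hs, hx⟩, rfl⟩
    have h1 := (hco.map_iff (T' j₁) ⟨T' j₁, ⟨g j₁, hg j₁, hTg j₁⟩, 1, one_pos,
      fun x => (one_smul ℝ _).symm⟩ x).2 (hFΩ hx)
    have hs0 : 0 < s := lt_of_lt_of_le (div_pos hlow0 ha0) hs.1
    rw [hΩ] at h1 ⊢
    exact hQ.smul_mem_interior h1 hs0
  -- Along the indices with g j = g₁, y is a limit of points of the compact subset C of the
  -- directions.
  have hyC : y ∈ C := by
    refine hCc.isClosed.mem_of_frequently_of_tendsto ?_ hlim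
    refine (hg₁.and_eventually hb).mono ?_
    rintro j ⟨hj, hjb⟩
    refine ⟨(t j, f j), ⟨⟨?_, ?_⟩, (hTf j).2⟩, ?_⟩
    · rw [div_le_iff₀ ha0, ← hTd' j hj]; exact hlow j
    · rw [le_div_iff₀ ha0, ← hTd' j hj]; exact hjb
    · change t j • T' j₁ (f j) = _
      rw [hTx, hTeq j hj]
  exact (hpos y (hCΩ hyC)).ne' hyA.2

end PREnd

end ConvexProjOrbifold

/-! ### Directions of points of the domain. -/

section Cones

variable {E : Type*} [NormedAddCommGroup E] [NormedSpace ℝ E] [FiniteDimensional ℝ E]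

/-- If multiples of automorphisms of determinant `±1` push a compact set in the interior of a cone
to its boundary, then the factors tend to zero. -/
theorem IsClosedCone.tendsto_zero_of_tendsto_boundary {Q : Set E} (hQ : IsClosedCone Q)
    (hp : ∀ x ∈ Q, -x ∈ Q → x = 0) {F : Set E} (hF : IsCompact F) (hFQ : F ⊆ interior Q)
    {T : ℕ → E ≃L[ℝ] E} {t : ℕ → ℝ} {f : ℕ → E} {y : E} (hTQ : ∀ j, ∀ x ∈ Q, T j x ∈ Q)
    (hdet : ∀ j, |LinearMap.det (T j : E →ₗ[ℝ] E)| = 1) (ht : ∀ j, 0 < t j) (hf : ∀ j, f j ∈ F)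
    (hlim : Tendsto (fun j => t j • T j (f j)) atTop (𝓝 y)) (hy : y ∉ interior Q) :
    Tendsto t atTop (𝓝 0) := by
  by_contra hcon
  -- If the factors do not tend to 0, the determinants of a convergent subsequence of t j • T j stay
  -- away from 0. The limit is then an automorphism mapping the interior of Q into itself, and y is
  -- an interior point.
  obtain ⟨ε, hε, hfr⟩ : ∃ ε : ℝ, 0 < ε ∧ ∃ᶠ j in atTop, ε ≤ t j := by
    rw [Metric.tendsto_nhds] at hcon
    push Not at hcon
    obtain ⟨ε, hε, h⟩ := hcon
    refine ⟨ε, hε, h.mono fun j hj => ?_⟩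
    rwa [dist_zero_right, Real.norm_of_nonneg (ht j).le] at hj
  obtain ⟨τ, hτ, hετ⟩ := extraction_of_frequently_atTop hfr
  let L : ℕ → E →L[ℝ] E := fun j => t j • (T j : E →L[ℝ] E)
  have hLQ : ∀ j, ∀ x ∈ Q, L j x ∈ Q := fun j x hx => hQ.smul_mem (ht j).le (hTQ j x hx)
  have hLdet : ∀ j, |LinearMap.det (L j : E →ₗ[ℝ] E)| = t j ^ Module.finrank ℝ E := fun j => by
    have h1 : (L j : E →ₗ[ℝ] E) = t j • (T j : E →ₗ[ℝ] E) := rfl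
    rw [h1, LinearMap.det_smul, abs_mul, hdet, mul_one, abs_of_pos (pow_pos (ht j) _)]
  obtain ⟨R, hR⟩ := (Metric.isBounded_range_of_tendsto _ hlim).exists_norm_le
  obtain ⟨M, hM⟩ := hQ.exists_norm_map_le hp hF hFQ R
  have hLM : ∀ j, ‖L j‖ ≤ M := fun j => hM _ (hLQ j) ⟨f j, hf j, hR _ ⟨j, rfl⟩⟩
  have : ProperSpace (E →L[ℝ] E) := FiniteDimensional.proper ℝ _
  obtain ⟨⟨T₀, f₀⟩, ⟨-, hf₀⟩, σ, hσ, hlim₀⟩ :=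
    ((isCompact_closedBall (0 : E →L[ℝ] E) M).prod hF).tendsto_subseq
    (x := fun j => (L (τ j), f (τ j))) fun j => ⟨by simpa using hLM (τ j), hf _⟩
  have hT₀ := (continuous_fst.tendsto _).comp hlim₀
  have hf₀' := (continuous_snd.tendsto _).comp hlim₀
  have hTy : T₀ f₀ = y := by
    have h1 : Tendsto (fun j => L (τ (σ j)) (f (τ (σ j)))) atTop (𝓝 (T₀ f₀)) :=
      (isBoundedBilinearMap_apply.continuous.tendsto (T₀, f₀)).comp hlim₀
    exact tendsto_nhds_unique h1 (hlim.comp (hτ.comp hσ).tendsto_atTop)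
  have hdet₀ : T₀.det ≠ 0 := by
    have h1 : Tendsto (fun j => |(L (τ (σ j))).det|) atTop (𝓝 |T₀.det|) :=
      ((ContinuousLinearMap.continuous_det.tendsto T₀).comp hT₀).abs
    have h2 : ε ^ Module.finrank ℝ E ≤ |T₀.det| := ge_of_tendsto' h1 fun j => by
      have h3 := hLdet (τ (σ j))
      change _ ≤ |LinearMap.det (L (τ (σ j)) : E →ₗ[ℝ] E)|
      rw [h3]
      exact pow_le_pow_left₀ hε.le (hετ _) _
    intro h0
    rw [h0, abs_zero] at h2
    exact absurd h2 (not_le.2 (pow_pos hε _))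
  let e := T₀.toContinuousLinearEquivOfDetNeZero hdet₀
  have he : ∀ x, e x = T₀ x := fun x => rfl
  refine hy (interior_maximal ?_ (e.toHomeomorph.isOpenMap _ isOpen_interior)
    ⟨f₀, hFQ hf₀, hTy⟩)
  rintro _ ⟨x, hx, rfl⟩
  have h1 : Tendsto (fun j => L (τ (σ j)) x) atTop (𝓝 (T₀ x)) :=
    ((ContinuousLinearMap.apply ℝ _ x).continuous.tendsto T₀).comp hT₀
  exact hQ.isClosed.mem_of_tendsto h1 (Eventually.of_forall fun j => hLQ _ x (interior_subset hx))

end Cones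

namespace ConvexProjOrbifold.PREnd

variable {n : ℕ} {O : ConvexProjOrbifold n} (E : O.PREnd)

/-- A splitting of `ℝ^{n+1}` into the line over the vertex and a hyperplane, given by the projection
`s` to the line and the section `σ` whose image is the hyperplane. It is invariant under the end
group, and the hyperplane meets the domain in the cone over the directions. -/
structure IsSplitting (s : Vec n →L[ℝ] ℝ) (σ : (Vec n ⧸ E.line) →L[ℝ] Vec n) : Prop where
  map_vec : s E.vec = 1
  mkQ_section : ∀ y, E.line.mkQ (σ y) = y
  map_section : ∀ y, s (σ y) = 0
  map_apply : ∀ g ∈ E.toPEnd.grp, ∀ x, s (g x) = s x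
  mkQ_mem : ∀ x ∈ cone (interior O.dom), E.line.mkQ x ∈ E.dirCone
  section_mem : ∀ y ∈ E.dirCone, σ y ∈ cone (interior O.dom)

theorem mem_cone_slab_of_mem_closure {ε : ℝ} (hε1 : ε < 1) {x : Vec n}
    (hx : x ∈ closure (cone (E.prod.slab (Iic ε)))) (hxd : x ∈ cone (interior O.dom)) :
    x ∈ cone (E.prod.slab (Iic ε)) := by
  obtain ⟨h0, hd⟩ := hxd
  have h1 : x ∈ cone (closure (E.prod.slab (Iic ε))) := by rw [cone_closure]; exact ⟨hx, h0⟩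
  exact ⟨h0, E.mem_slab_of_mem_closure hε1 h1.2 hd⟩

/-- Suppose p has a boundary direction, approximated by multiples t_j g_j z_j of translates of a
compact set. The determinant forces t_j → 0, hence, by invariance of s, their s-coordinates tend to
0 and they converge to the projection of p to ker s. Moved towards the vertex, this limit is in the
domain and in the closure of a truncation of the radial neighborhood, so it is in the truncation,
and its direction is not a boundary direction. Connectedness of the interior of the domain then
excludes all other directions. -/
theorem mkQ_mem_dirCone_of_interior (hE : E.Admissible)
    (hfix : ∀ g ∈ E.toPEnd.grp, g E.vec = E.vec) {s : Vec n →L[ℝ] ℝ} (hs : s E.vec = 1)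
    (hsg : ∀ g ∈ E.toPEnd.grp, ∀ x, s (g x) = s x) {x : Vec n}
    (hx : x ∈ cone (interior O.dom)) : E.line.mkQ x ∈ E.dirCone := by
  have hQ := hE.isClosedCone hfix
  have hp := hE.pointed hfix
  have hΩ := hE.eq_interior hfix
  have hco := E.isCocompact hfix
  -- boundary directions do not occur
  have key : ∀ p ∈ cone (interior O.dom), E.line.mkQ p ∈ closure E.dirCone →
      E.line.mkQ p ∈ E.dirCone := by
    intro p hp' hpQ
    by_contra hpn
    obtain ⟨Z, hZ, hZc, hcoZ⟩ := E.exists_isCompact_lift (ε := 1 / 2) (by norm_num) (by norm_num)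
    obtain ⟨x₀, hx₀⟩ := E.dirCone_nonempty
    have hyj : ∀ j : ℕ, (1 / ((j : ℝ) + 1)) • x₀ + E.line.mkQ p ∈ E.dirCone := fun j => by
      rw [hΩ] at hx₀ ⊢
      exact hQ.smul_add_mem_interior (hQ.smul_mem_interior hx₀ Nat.one_div_pos_of_nat) hpQ
    have hch : ∀ j : ℕ, ∃ g ∈ E.toPEnd.grp, ∃ z ∈ Z, ∃ t : ℝ, 0 < t ∧
        E.line.mkQ (t • g z) = (1 / ((j : ℝ) + 1)) • x₀ + E.line.mkQ p := by
      intro j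
      obtain ⟨w, hw, he⟩ := hyj j
      obtain ⟨g, hg, z, hz, t, c, ht, hwe⟩ := hcoZ w hw
      refine ⟨g, hg, z, hz, t, ht, ?_⟩
      rw [← he, eq_comm, E.mkQ_eq_iff]
      exact ⟨c, hwe⟩
    choose g hg z hz t ht hgz using hch
    choose T hT using fun j => E.exists_quot (hfix _ (hg j))
    have hlim : Tendsto (fun j => E.line.mkQ (t j • g j (z j))) atTop (𝓝 (E.line.mkQ p)) := by
      simp only [hgz]
      have := (tendsto_one_div_add_atTop_nhds_zero_nat (𝕜 := ℝ)).smul_const x₀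
      simpa using this.add_const (E.line.mkQ p)
    have hZΩ : E.line.mkQ '' Z ⊆ interior (closure E.dirCone) := by
      rw [← hΩ]
      rintro _ ⟨z, hz, rfl⟩
      exact E.mkQ_mem_dirCone (cone_mono (E.prod.slab_subset _) (hZ hz))
    have ht0 : Tendsto t atTop (𝓝 0) := by
      refine hQ.tendsto_zero_of_tendsto_boundary hp (hZc.image E.continuous_mkQ) hZΩ (T := T)
        (f := fun j => E.line.mkQ (z j)) (y := E.line.mkQ p) (fun j x hx => ?_)
        (fun j => E.abs_det_quot (hfix _ (hg j)) (O.det_eq _ (hg j).1) (hT j)) ht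
        (fun j => mem_image_of_mem _ (hz j)) ?_ (by rwa [← hΩ])
      · exact (map_mem_closure_iff (hco.map_iff _ ⟨T j, ⟨g j, hg j, hT j⟩, 1, one_pos,
          fun x => (one_smul ℝ _).symm⟩) x).2 hx
      · simpa only [hT, map_smul] using hlim
    have hst : Tendsto (fun j => s (t j • g j (z j))) atTop (𝓝 0) := by
      obtain ⟨B, hB⟩ := hZc.isBounded.exists_norm_le
      refine squeeze_zero_norm (a := fun j => t j * (‖s‖ * B)) (fun j => ?_) ?_
      · rw [map_smul, hsg _ (hg j), norm_smul, Real.norm_of_nonneg (ht j).le]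
        exact mul_le_mul_of_nonneg_left ((s.le_opNorm _).trans
          (mul_le_mul_of_nonneg_left (hB _ (hz j)) (norm_nonneg _))) (ht j).le
      · simpa using ht0.mul_const (‖s‖ * B)
    -- lift the convergence
    obtain ⟨σ₀, hσ₀⟩ := LinearMap.exists_rightInverse_of_surjective E.line.mkQ
      (Submodule.range_mkQ _)
    set σ : (Vec n ⧸ E.line) →L[ℝ] Vec n := LinearMap.toContinuousLinearMap σ₀ with hσdef
    have hσ : ∀ u, E.line.mkQ (σ u) = u := fun u => LinearMap.congr_fun hσ₀ u
    have hdec : ∀ x, x = σ (E.line.mkQ x) + (s x - s (σ (E.line.mkQ x))) • E.vec := fun x => by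
      obtain ⟨c, hc⟩ := E.mkQ_eq_iff.1 (hσ (E.line.mkQ x)).symm
      have h1 := congrArg s hc
      rw [map_add, map_smul, hs, smul_eq_mul, mul_one] at h1
      rw [h1, add_sub_cancel_left]; exact hc
    -- The limit p - s(p) vec need not be in the domain. Adding |s p| vec brings it to p or above p,
    -- hence inside, and keeps the approximating points in the truncation.
    set c := |s p| with hc
    have hlim' : Tendsto (fun j => t j • g j (z j) + c • E.vec) atTop
        (𝓝 (p + (c - s p) • E.vec)) := by
      have h1 : Tendsto (fun j => σ (E.line.mkQ (t j • g j (z j))) +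
          (s (t j • g j (z j)) - s (σ (E.line.mkQ (t j • g j (z j))))) • E.vec + c • E.vec) atTop
          (𝓝 (σ (E.line.mkQ p) + (0 - s (σ (E.line.mkQ p))) • E.vec + c • E.vec)) := by
        have h2 := (σ.continuous.tendsto _).comp hlim
        have h3 := (s.continuous.tendsto _).comp h2
        exact (h2.add ((hst.sub h3).smul_const E.vec)).add_const _
      have h4 : σ (E.line.mkQ p) + (0 - s (σ (E.line.mkQ p))) • E.vec + c • E.vec =
          p + (c - s p) • E.vec := by
        conv_rhs => rw [hdec p]
        have : s (σ (E.line.mkQ p) + (s p - s (σ (E.line.mkQ p))) • E.vec) = s p := by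
          rw [← hdec p]
        rw [this]
        module
      rw [h4] at h1
      refine h1.congr fun j => ?_
      rw [← hdec]
    have hcl : p + (c - s p) • E.vec ∈ closure (cone (E.prod.slab (Iic (1 / 2)))) := by
      refine mem_closure_of_tendsto hlim' (Eventually.of_forall fun j => ?_)
      have h2 : g j • E.prod.slab (Iic (1 / 2)) = E.prod.slab (Iic (1 / 2)) := by
        ext q
        rw [Set.mem_smul_set_iff_inv_smul_mem]
        exact E.prod.smul_mem_slab_iff (fun g hg => E.smul_rad hg)
          (E.grp_eq ▸ E.toPEnd.grp.inv_mem (hg j))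
      exact E.add_mem_cone_slab (smul_mem_cone ((apply_mem_cone_of_smul_eq h2).2 (hZ (hz j)))
        (ht j)) (abs_nonneg _)
    have hmem := E.mem_cone_slab_of_mem_closure (by norm_num) hcl
      (E.add_vec_mem_cone_interior hp' (sub_nonneg.2 (le_abs_self _)))
    refine hpn (E.mem_dirCone_iff.2 ⟨_, cone_mono (E.prod.slab_subset _) hmem⟩)
  -- connectedness
  have hpre : IsPreconnected (E.line.mkQ '' cone (interior O.dom)) :=
    O.convex_cone_interior.isPreconnected.image _ E.continuous_mkQ.continuousOn
  refine hpre.subset_left_of_subset_union (E.isOpen_dirCone) isClosed_closure.isOpen_compl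
    (disjoint_left.2 fun y h1 h2 => h2 (subset_closure h1)) ?_ ?_ (mem_image_of_mem _ hx)
  · rintro _ ⟨p, hp', rfl⟩
    by_cases h : E.line.mkQ p ∈ closure E.dirCone
    · exact Or.inl (key p hp' h)
    · exact Or.inr h
  · obtain ⟨_, w, hw, rfl⟩ := E.dirCone_nonempty
    exact ⟨_, mem_image_of_mem _ (E.cone_rad_subset hw), E.mkQ_mem_dirCone hw⟩

end ConvexProjOrbifold.PREnd

/-! ### The invariant splitting. -/

namespace ConvexProjOrbifold.PREnd

variable {n : ℕ} {O : ConvexProjOrbifold n} (E : O.PREnd)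

/-- As `vec` is not in H, s is the functional with kernel H normalised on `vec`, and σ is the
section with image H. The remaining point is that D covers every direction. -/
theorem exists_isSplitting (hn : 2 ≤ n) (hE : E.Admissible)
    (hfix : ∀ g ∈ E.toPEnd.grp, g E.vec = E.vec) {D : Set (ProjSphere n)}
    (hDfr : Module.finrank ℝ (Submodule.span ℝ (cone D)) = n) (hDconv : Convex ℝ (cone D))
    (hDinv : ∀ g ∈ E.toPEnd.grp, g • D = D) (hDd : D ⊆ interior O.dom)
    (hv : E.vertex ∉ closure D) : ∃ s σ, E.IsSplitting s σ := by
  have hvH := E.vec_notMem_span hn hE hfix hDfr hDconv hDinv hDd hv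
  set H := Submodule.span ℝ (cone D) with hH
  have hgD : ∀ g ∈ E.toPEnd.grp, ∀ x, g x ∈ cone D ↔ x ∈ cone D := fun g hg x =>
    apply_mem_cone_of_smul_eq (hDinv g hg)
  have hgH : ∀ g ∈ E.toPEnd.grp, ∀ x ∈ H, g x ∈ H := by
    intro g hg x hx
    have : H ≤ H.comap (g : Vec n →ₗ[ℝ] Vec n) := Submodule.span_le.2 fun y hy =>
      Submodule.subset_span ((hgD g hg y).2 hy)
    exact this hx
  obtain ⟨φ₀, hφ₀⟩ := exists_ker_eq hDfr
  have hkerH : ∀ x, φ₀ x = 0 ↔ x ∈ H := fun x => by rw [← hφ₀, LinearMap.mem_ker]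
  have hφv : φ₀ E.vec ≠ 0 := fun h => hvH ((hkerH _).1 h)
  set s : Vec n →L[ℝ] ℝ := LinearMap.toContinuousLinearMap ((φ₀ E.vec)⁻¹ • φ₀) with hs
  have hsx : ∀ x, s x = (φ₀ E.vec)⁻¹ * φ₀ x := fun x => rfl
  have hsv : s E.vec = 1 := by rw [hsx, inv_mul_cancel₀ hφv]
  have hsH : ∀ x, s x = 0 ↔ x ∈ H := fun x => by
    rw [hsx, ← hkerH]; simp [hφv]
  have hsg : ∀ g ∈ E.toPEnd.grp, ∀ x, s (g x) = s x := by
    intro g hg x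
    have h1 : s (x - s x • E.vec) = 0 := by
      rw [map_sub, map_smul, hsv, smul_eq_mul, mul_one, sub_self]
    have h2 := (hsH _).2 (hgH g hg _ ((hsH _).1 h1))
    rw [map_sub, map_smul, hfix g hg, map_sub, map_smul, hsv, smul_eq_mul, mul_one, sub_eq_zero] at h2
    exact h2
  have hΩmem : ∀ x ∈ cone (interior O.dom), E.line.mkQ x ∈ E.dirCone := fun x hx =>
    E.mkQ_mem_dirCone_of_interior hE hfix hsv hsg hx
  obtain ⟨σ₀, hσ₀⟩ := LinearMap.exists_rightInverse_of_surjective E.line.mkQ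
    (Submodule.range_mkQ _)
  set σ : (Vec n ⧸ E.line) →L[ℝ] Vec n := LinearMap.toContinuousLinearMap
    (σ₀ - ((s : Vec n →ₗ[ℝ] ℝ) ∘ₗ σ₀).smulRight E.vec) with hσdef
  have hσx : ∀ u, σ u = σ₀ u - s (σ₀ u) • E.vec := fun u => rfl
  have hσ : ∀ u, E.line.mkQ (σ u) = u := fun u => by
    rw [hσx, map_sub, map_smul, E.mkQ_vec, smul_zero, sub_zero]
    exact LinearMap.congr_fun hσ₀ u
  have hsσ : ∀ u, s (σ u) = 0 := fun u => by
    rw [hσx, map_sub, map_smul, hsv, smul_eq_mul, mul_one, sub_self]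
  refine ⟨s, σ, hsv, hσ, hsσ, hsg, hΩmem, fun y hy => ?_⟩
  have hσH : ∀ x ∈ H, σ (E.line.mkQ x) = x := fun x hx => by
    obtain ⟨c, hc⟩ := E.mkQ_eq_iff.1 (hσ (E.line.mkQ x))
    have h1 := congrArg s hc
    rw [hsσ, map_add, (hsH x).2 hx, map_smul, hsv, smul_eq_mul, mul_one, zero_add] at h1
    rw [hc, ← h1, zero_smul, add_zero]
  -- the projection of the invariant domain is everything
  set A := E.line.mkQ '' cone D with hA
  have hDI : cone D ⊆ cone (interior O.dom) := cone_mono hDd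
  have hDne : (cone D).Nonempty := by
    rw [nonempty_iff_ne_empty]
    intro h0
    rw [hH, h0, Submodule.span_empty, finrank_bot] at hDfr
    omega
  have hAconv : Convex ℝ A := hDconv.linear_image E.line.mkQ
  have hAsm : ∀ x ∈ closure A, ∀ t : ℝ, 0 < t → t • x ∈ closure A := by
    intro x hx t ht
    refine closure_mono ?_ (image_closure_subset_closure_image (continuous_const_smul t)
      (mem_image_of_mem _ hx))
    rintro _ ⟨_, ⟨z, hz, rfl⟩, rfl⟩
    exact ⟨t • z, smul_mem_cone hz ht, map_smul _ _ _⟩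
  have hAcone : IsClosedCone (closure A) := by
    have h0 : (0 : Vec n ⧸ E.line) ∈ closure A := by
      obtain ⟨d, hd⟩ := hDne
      refine mem_closure_of_tendsto (f := fun j : ℕ => (1 / ((j : ℝ) + 1)) • E.line.mkQ d)
        (b := atTop) ?_ (Eventually.of_forall fun j => ?_)
      · simpa using (tendsto_one_div_add_atTop_nhds_zero_nat (𝕜 := ℝ)).smul_const (E.line.mkQ d)
      · exact ⟨_, smul_mem_cone hd Nat.one_div_pos_of_nat, map_smul _ _ _⟩
    refine ⟨isClosed_closure, h0, fun {x y} hx hy => ?_, fun {x t} ht hx => ?_⟩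
    · have h1 := hAsm _ (hAconv.closure hx hy (a := 1 / 2) (b := 1 / 2) (by norm_num) (by norm_num)
        (by norm_num)) 2 (by norm_num)
      convert h1 using 1
      module
    · rcases ht.eq_or_lt with rfl | ht
      · rw [zero_smul]; exact h0
      · exact hAsm x hx t ht
  have hsub : closure E.dirCone ⊆ closure A := by
    refine (E.isCocompact hfix).closure_subset (hE.isClosedCone hfix) (hE.pointed hfix) hAcone ?_ ?_
    · rintro T ⟨T', ⟨g, hg, hT'⟩, t, ht, hTx⟩ x hx
      refine closure_mono ?_ (image_closure_subset_closure_image T.continuous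
        (mem_image_of_mem _ hx))
      rintro _ ⟨_, ⟨z, hz, rfl⟩, rfl⟩
      rw [hTx, hT', ← map_smul]
      exact ⟨_, smul_mem_cone ((hgD g hg z).2 hz) ht, rfl⟩
    · obtain ⟨d, hd⟩ := hDne
      exact ⟨_, subset_closure ⟨d, hd, rfl⟩, hΩmem d (hDI hd)⟩
  have hAint : (interior A).Nonempty := by
    obtain ⟨d, hdH, δ, hδ, hd⟩ := relInterior_span_nonempty hDconv hDne
      fun x hx t ht => smul_mem_cone hx ht
    rw [← hH] at hdH hd
    have hc : Continuous fun u => ‖σ u‖ := by fun_prop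
    refine ⟨E.line.mkQ d, interior_maximal (t := {u | ‖σ u - d‖ < δ}) ?_ ?_ ?_⟩
    · intro u hu
      have h1 := hd (σ u - d) (H.sub_mem ((hsH _).1 (hsσ u)) hdH) hu
      rw [add_sub_cancel] at h1
      exact ⟨_, h1, hσ u⟩
    · exact isOpen_lt (by fun_prop) continuous_const
    · change ‖σ (E.line.mkQ d) - d‖ < δ
      rw [hσH d hdH, sub_self, norm_zero]; exact hδ
  -- The closure of A contains all directions because it is an invariant closed cone meeting them. A
  -- convex set with nonempty interior has the same interior as its closure, so A itself contains
  -- them.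
  have hyA : y ∈ A := by
    have h1 : y ∈ interior (closure A) :=
      interior_mono hsub ((hE.eq_interior hfix) ▸ hy)
    rw [hAconv.interior_closure_eq_interior_of_nonempty_interior hAint] at h1
    exact interior_subset h1
  obtain ⟨d, hd, rfl⟩ := hyA
  rw [hσH d (Submodule.subset_span hd)]
  exact hDI hd

variable {E}

theorem IsSplitting.eq_add {s : Vec n →L[ℝ] ℝ} {σ : (Vec n ⧸ E.line) →L[ℝ] Vec n}
    (h : E.IsSplitting s σ) (x : Vec n) : x = σ (E.line.mkQ x) + s x • E.vec := by
  obtain ⟨c, hc⟩ := E.mkQ_eq_iff.1 (h.mkQ_section (E.line.mkQ x)).symm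
  have h1 := congrArg s hc
  rw [map_add, map_smul, h.map_section, h.map_vec, smul_eq_mul, mul_one, zero_add] at h1
  rw [h1]; exact hc

theorem IsSplitting.ext {s : Vec n →L[ℝ] ℝ} {σ : (Vec n ⧸ E.line) →L[ℝ] Vec n}
    (h : E.IsSplitting s σ) {x y : Vec n} (hm : E.line.mkQ x = E.line.mkQ y) (hs : s x = s y) :
    x = y := by
  rw [h.eq_add x, h.eq_add y, hm, hs]

end ConvexProjOrbifold.PREnd

theorem ContDiffOn.differentiableAt_fderiv {E : Type*} [NormedAddCommGroup E] [NormedSpace ℝ E]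
    {f : E → ℝ} {Ω : Set E} (hf : ContDiffOn ℝ ∞ f Ω) (hΩ : IsOpen Ω) {x : E} (hx : x ∈ Ω) :
    DifferentiableAt ℝ (fderiv ℝ f) x :=
  ((hf.contDiffAt (hΩ.mem_nhds hx)).fderiv_right (m := ∞) (by simp)).differentiableAt (by simp)

theorem hasDerivAt_fderiv_comp {E : Type*} [NormedAddCommGroup E] [NormedSpace ℝ E]
    {f : E → ℝ} {c : ℝ → E} {t : ℝ} {z : E} (hf : DifferentiableAt ℝ (fderiv ℝ f) (c t))
    (hc : HasDerivAt c z t) (w : E) :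
    HasDerivAt (fun r => fderiv ℝ f (c r) w) (fderiv ℝ (fderiv ℝ f) (c t) z w) t :=
  ((ContinuousLinearMap.apply ℝ ℝ w).hasFDerivAt.comp (c t) hf.hasFDerivAt).comp_hasDerivAt t hc

/-! ### A defining function for the boundary of the lens. -/

section Defining

variable {V U : Type*} [NormedAddCommGroup V] [NormedSpace ℝ V] [NormedAddCommGroup U]
  [NormedSpace ℝ U] (p : V →L[ℝ] U) (s : V →L[ℝ] ℝ) (κ : ℝ) (f : U → ℝ)

/-- The defining function of the hypersurface `{f (κ p / s) = 1}`. -/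
noncomputable def definingFun (x : V) : ℝ := f ((κ / s x) • p x) - 1

variable {p s κ f} {Ω : Set U}

theorem isOpen_definingFun_domain (hΩ : IsOpen Ω) : IsOpen {x : V | 0 < s x ∧ p x ∈ Ω} :=
  (isOpen_lt continuous_const s.continuous).inter (hΩ.preimage p.continuous)

theorem contDiffOn_definingFun (hf : ContDiffOn ℝ ∞ f Ω)
    (hsm : ∀ x ∈ Ω, ∀ t : ℝ, 0 < t → t • x ∈ Ω) (hκ : 0 < κ) :
    ContDiffOn ℝ ∞ (definingFun p s κ f) {x : V | 0 < s x ∧ p x ∈ Ω} := by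
  refine (hf.comp (g := f) (f := fun x => (κ / s x) • p x) ?_ ?_).sub contDiffOn_const
  · exact (contDiffOn_const.div s.contDiff.contDiffOn fun x hx => hx.1.ne').smul
      p.contDiff.contDiffOn
  · exact fun x hx => hsm _ hx.2 _ (div_pos hκ hx.1)

/-- The radial projection of a line to the level s = κ is a line again, with fractional linear
parameter t/(1 + bt), b = s w / s v. -/
theorem definingFun_line {v w : V} (hv : s v ≠ 0) {t : ℝ} (ht : 1 + s w / s v * t ≠ 0) :
    definingFun p s κ f (v + t • w) = f ((κ / s v) • p v + (t / (1 + s w / s v * t)) •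
      ((κ / s v) • p w - (s w / s v) • (κ / s v) • p v)) - 1 := by
  have h1 : s (v + t • w) = s v * (1 + s w / s v * t) := by
    rw [map_add, map_smul, smul_eq_mul]; field_simp
  rw [definingFun, h1, map_add, map_smul]
  congr 2
  set b := s w / s v
  rw [smul_add, smul_sub, smul_smul, smul_smul, smul_smul, smul_smul]
  have h2 : κ / (s v * (1 + b * t)) = κ / s v - t / (1 + b * t) * (b * (κ / s v)) := by
    field_simp; ring
  have h3 : κ / (s v * (1 + b * t)) * t = t / (1 + b * t) * (κ / s v) := by
    field_simp
  rw [h3]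
  nth_rw 1 [h2]
  module

theorem fderiv_definingFun_line (hΩ : IsOpen Ω) (hf : ContDiffOn ℝ ∞ f Ω)
    (hsm : ∀ x ∈ Ω, ∀ t : ℝ, 0 < t → t • x ∈ Ω) (hκ : 0 < κ) {v : V} (hv : 0 < s v)
    (hvΩ : p v ∈ Ω) (w : V) : ∀ᶠ t : ℝ in 𝓝 0, fderiv ℝ (definingFun p s κ f) (v + t • w) w =
      fderiv ℝ f ((κ / s v) • p v + (t / (1 + s w / s v * t)) •
        ((κ / s v) • p w - (s w / s v) • (κ / s v) • p v))
        ((κ / s v) • p w - (s w / s v) • (κ / s v) • p v) * (1 / (1 + s w / s v * t) ^ 2) := by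
  set b := s w / s v with hb
  set y₀ := (κ / s v) • p v with hy₀
  set z := (κ / s v) • p w - b • y₀ with hz
  have hN : IsOpen {x : V | 0 < s x ∧ p x ∈ Ω} := isOpen_definingFun_domain hΩ
  have hy₀Ω : y₀ ∈ Ω := hsm _ hvΩ _ (div_pos hκ hv)
  have hc1 : ContinuousAt (fun t : ℝ => v + t • w) 0 := by fun_prop
  have h1 : ∀ᶠ t : ℝ in 𝓝 0, v + t • w ∈ {x : V | 0 < s x ∧ p x ∈ Ω} :=
    hc1.eventually_mem (hN.mem_nhds (by simpa using ⟨hv, hvΩ⟩))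
  have h2 : ∀ᶠ t : ℝ in 𝓝 0, 1 + b * t ≠ 0 := by
    have hc : ContinuousAt (fun t : ℝ => 1 + b * t) 0 := by fun_prop
    exact hc.eventually_ne (by simp)
  have h3 : ∀ᶠ t : ℝ in 𝓝 0, y₀ + (t / (1 + b * t)) • z ∈ Ω := by
    have hc : ContinuousAt (fun t : ℝ => y₀ + (t / (1 + b * t)) • z) 0 :=
      continuousAt_const.add ((continuousAt_id.div (by fun_prop) (by simp)).smul continuousAt_const)
    exact hc.eventually_mem (hΩ.mem_nhds (by simpa using hy₀Ω))
  filter_upwards [h1, h2, h3, h2.eventually_nhds] with t ht1 ht2 ht3 ht4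
  have hd1 : HasDerivAt (fun r : ℝ => definingFun p s κ f (v + r • w))
      (fderiv ℝ (definingFun p s κ f) (v + t • w) w) t := by
    have hdiff : DifferentiableAt ℝ (definingFun p s κ f) (v + t • w) :=
      ((contDiffOn_definingFun hf hsm hκ).contDiffAt (hN.mem_nhds ht1)).differentiableAt (by simp)
    have hl : HasDerivAt (fun r : ℝ => v + r • w) w t := by
      simpa using ((hasDerivAt_id t).smul_const w).const_add v
    exact hdiff.hasFDerivAt.comp_hasDerivAt t hl
  have hd2 : HasDerivAt (fun r : ℝ => f (y₀ + (r / (1 + b * r)) • z) - 1)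
      (fderiv ℝ f (y₀ + (t / (1 + b * t)) • z) ((1 / (1 + b * t) ^ 2) • z)) t := by
    have hdiff : DifferentiableAt ℝ f (y₀ + (t / (1 + b * t)) • z) :=
      (hf.contDiffAt (hΩ.mem_nhds ht3)).differentiableAt (by simp)
    have hθ : HasDerivAt (fun r : ℝ => r / (1 + b * r)) (1 / (1 + b * t) ^ 2) t := by
      have h5 : HasDerivAt (fun r : ℝ => 1 + b * r) b t := by
        simpa using ((hasDerivAt_id t).const_mul b).const_add 1
      have h6 := (hasDerivAt_id t).div h5 ht2
      have h7 : 1 * (1 + b * t) - id t * b = 1 := by rw [id_eq]; ring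
      rwa [h7] at h6
    exact (hdiff.hasFDerivAt.comp_hasDerivAt t ((hθ.smul_const z).const_add y₀)).sub_const 1
  have heq : (fun r : ℝ => definingFun p s κ f (v + r • w)) =ᶠ[𝓝 t]
      fun r : ℝ => f (y₀ + (r / (1 + b * r)) • z) - 1 := by
    filter_upwards [ht4] with r hr
    exact definingFun_line hv.ne' hr
  rw [hd1.unique (hd2.congr_of_eventuallyEq heq), map_smul, smul_eq_mul, mul_comm]

theorem fderiv_definingFun (hΩ : IsOpen Ω) (hf : ContDiffOn ℝ ∞ f Ω)
    (hsm : ∀ x ∈ Ω, ∀ t : ℝ, 0 < t → t • x ∈ Ω) (hκ : 0 < κ) {v : V} (hv : 0 < s v)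
    (hvΩ : p v ∈ Ω) (w : V) : fderiv ℝ (definingFun p s κ f) v w =
      fderiv ℝ f ((κ / s v) • p v) ((κ / s v) • p w - (s w / s v) • (κ / s v) • p v) := by
  have := (fderiv_definingFun_line hΩ hf hsm hκ hv hvΩ w).self_of_nhds
  simpa using this

/-- The reparametrisation has first derivative 1 at 0. Its second derivative is multiplied by the
first derivative of f in the projected direction, which vanishes for a tangent vector w. -/
theorem fderiv_fderiv_definingFun (hΩ : IsOpen Ω) (hf : ContDiffOn ℝ ∞ f Ω)
    (hsm : ∀ x ∈ Ω, ∀ t : ℝ, 0 < t → t • x ∈ Ω) (hκ : 0 < κ) {v : V} (hv : 0 < s v)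
    (hvΩ : p v ∈ Ω) {w : V} (hw : fderiv ℝ (definingFun p s κ f) v w = 0) :
    fderiv ℝ (fderiv ℝ (definingFun p s κ f)) v w w =
      fderiv ℝ (fderiv ℝ f) ((κ / s v) • p v) ((κ / s v) • p w - (s w / s v) • (κ / s v) • p v)
        ((κ / s v) • p w - (s w / s v) • (κ / s v) • p v) := by
  have hline := fderiv_definingFun_line hΩ hf hsm hκ hv hvΩ w
  have hw' := fderiv_definingFun hΩ hf hsm hκ hv hvΩ w
  rw [hw] at hw'
  set b := s w / s v with hb
  set y₀ := (κ / s v) • p v with hy₀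
  set z := (κ / s v) • p w - b • y₀ with hz
  have hy₀Ω : y₀ ∈ Ω := hsm _ hvΩ _ (div_pos hκ hv)
  have hd1 : HasDerivAt (fun t : ℝ => fderiv ℝ (definingFun p s κ f) (v + t • w) w)
      (fderiv ℝ (fderiv ℝ (definingFun p s κ f)) v w w) 0 := by
    have hl : HasDerivAt (fun r : ℝ => v + r • w) w 0 := by
      simpa using ((hasDerivAt_id (0 : ℝ)).smul_const w).const_add v
    have h0 : v + (0 : ℝ) • w = v := by rw [zero_smul, add_zero]
    have hdiff : DifferentiableAt ℝ (fderiv ℝ (definingFun p s κ f)) (v + (0 : ℝ) • w) :=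
      (contDiffOn_definingFun hf hsm hκ).differentiableAt_fderiv
        (isOpen_definingFun_domain hΩ) (by rw [h0]; exact ⟨hv, hvΩ⟩)
    have h1 := hasDerivAt_fderiv_comp hdiff hl w
    rwa [h0] at h1
  have hd2 : HasDerivAt (fun t : ℝ => fderiv ℝ f (y₀ + (t / (1 + b * t)) • z) z *
      (1 / (1 + b * t) ^ 2)) (fderiv ℝ (fderiv ℝ f) y₀ z z) 0 := by
    have hθ : HasDerivAt (fun r : ℝ => r / (1 + b * r)) 1 0 := by
      have h5 : HasDerivAt (fun r : ℝ => 1 + b * r) b 0 := by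
        simpa using ((hasDerivAt_id (0 : ℝ)).const_mul b).const_add 1
      have h6 := (hasDerivAt_id (0 : ℝ)).div h5 (by simp)
      have h7 : (1 * (1 + b * 0) - id 0 * b) / (1 + b * 0) ^ 2 = 1 := by simp
      rwa [h7] at h6
    have hl : HasDerivAt (fun r : ℝ => y₀ + (r / (1 + b * r)) • z) z 0 := by
      have h5 := (hθ.smul_const z).const_add y₀
      rwa [one_smul] at h5
    have h0 : y₀ + ((0 : ℝ) / (1 + b * 0)) • z = y₀ := by rw [zero_div, zero_smul, add_zero]
    have h1 := hasDerivAt_fderiv_comp (f := f) (c := fun r : ℝ => y₀ + (r / (1 + b * r)) • z)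
      (by rw [h0]; exact hf.differentiableAt_fderiv hΩ hy₀Ω) hl z
    have h6 : DifferentiableAt ℝ (fun t : ℝ => 1 / (1 + b * t) ^ 2) 0 := by
      refine (differentiableAt_const _).div ?_ (by simp)
      fun_prop
    have h7 := h1.mul h6.hasDerivAt
    have h8 : (1 : ℝ) / (1 + b * 0) ^ 2 = 1 := by norm_num
    simp only [h0, h8, ← hw', zero_mul, mul_one, add_zero] at h7
    exact h7
  exact hd1.unique (hd2.congr_of_eventuallyEq hline)

end Defining

/-- A fixed interior point y₀ minus a multiple of y of norm δ/2 is still interior, and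
superadditivity bounds F of that multiple by F y₀. -/
theorem IsConeFunction.exists_le_norm {E : Type} [NormedAddCommGroup E] [NormedSpace ℝ E]
    {Q : Set E} {f F : E → ℝ} (h : IsConeFunction Q f F) (hQ : IsClosedCone Q)
    (hne : (interior Q).Nonempty) (h0 : (0 : E) ∉ interior Q) :
    ∃ M : ℝ, 0 < M ∧ ∀ y ∈ interior Q, F y ≤ M * ‖y‖ := by
  obtain ⟨y₀, hy₀⟩ := hne
  obtain ⟨δ, hδ, hb⟩ := Metric.isOpen_iff.1 isOpen_interior _ hy₀
  have hF₀ := h.pos _ hy₀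
  refine ⟨F y₀ * (2 / δ), by positivity, fun y hy => ?_⟩
  have hy0 : y ≠ 0 := fun h' => h0 (h' ▸ hy)
  have hn : 0 < ‖y‖ := norm_pos_iff.2 hy0
  have ht0 : 0 < δ / 2 / ‖y‖ := by positivity
  have hty := hQ.smul_mem_interior hy ht0
  have hsub : y₀ - (δ / 2 / ‖y‖) • y ∈ interior Q := by
    refine hb ?_
    rw [Metric.mem_ball, dist_eq_norm, sub_sub_cancel_left, norm_neg, norm_smul,
      Real.norm_of_nonneg ht0.le, div_mul_cancel₀ _ hn.ne']
    exact half_lt_self hδ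
  have h1 := h.superadd _ hty _ hsub
  rw [add_sub_cancel, h.smul _ hy _ ht0] at h1
  have h2 := h.pos _ hsub
  have h3 : δ / 2 / ‖y‖ * F y ≤ F y₀ := by linarith
  have h4 : F y₀ * (2 / δ) * ‖y‖ = F y₀ / (δ / 2 / ‖y‖) := by field_simp
  rw [h4, le_div_iff₀ ht0, mul_comm]
  exact h3

/-! ### The lens regions and their position in the domain. -/

namespace ConvexProjOrbifold.PREnd

variable {n : ℕ} {O : ConvexProjOrbifold n} (E : O.PREnd)

theorem zero_notMem_dirCone : (0 : Vec n ⧸ E.line) ∉ E.dirCone := by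
  rintro ⟨w, hw, h0⟩
  exact E.notMem_line hw ((Submodule.Quotient.mk_eq_zero _).1 h0)

theorem smul_mem_dirCone {y : Vec n ⧸ E.line} (hy : y ∈ E.dirCone) {t : ℝ} (ht : 0 < t) :
    t • y ∈ E.dirCone := by
  obtain ⟨w, hw, rfl⟩ := hy
  rw [← map_smul]
  exact E.mkQ_mem_dirCone (smul_mem_cone hw ht)

theorem quot_apply_mem_dirCone {g : LinAut n} (hfix : ∀ g ∈ E.toPEnd.grp, g E.vec = E.vec)
    (hg : g ∈ E.toPEnd.grp) {x : Vec n} :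
    E.line.mkQ (g x) ∈ E.dirCone ↔ E.line.mkQ x ∈ E.dirCone := by
  obtain ⟨T, hT⟩ := E.exists_quot (hfix g hg)
  rw [← hT]
  exact E.quot_mem_dirCone_iff ⟨T, ⟨g, hg, hT⟩, 1, one_pos, fun x => (one_smul ℝ _).symm⟩ hfix _

/-- The data from which a lens is built: a splitting, and a cone function on the cone of
directions. -/
structure LensData (s : Vec n →L[ℝ] ℝ) (σ : (Vec n ⧸ E.line) →L[ℝ] Vec n)
    (f F : (Vec n ⧸ E.line) → ℝ) : Prop where
  fix : ∀ g ∈ E.toPEnd.grp, g E.vec = E.vec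
  split : E.IsSplitting s σ
  isClosedCone : IsClosedCone (closure E.dirCone)
  pointed : ∀ x ∈ closure E.dirCone, -x ∈ closure E.dirCone → x = 0
  eq_interior : interior (closure E.dirCone) = E.dirCone
  coneFun : IsConeFunction (closure E.dirCone) f F

/-- The set of points where the ratio of the coordinate `s` and the cone function lies in `J`. -/
def region (s : Vec n →L[ℝ] ℝ) (F : (Vec n ⧸ E.line) → ℝ) (J : Set ℝ) : Set (ProjSphere n) :=
  raysOf {x | E.line.mkQ x ∈ E.dirCone ∧ s x / F (E.line.mkQ x) ∈ J}

namespace LensData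

variable {E} {s : Vec n →L[ℝ] ℝ} {σ : (Vec n ⧸ E.line) →L[ℝ] Vec n}
  {f F : (Vec n ⧸ E.line) → ℝ}

theorem mem_interior (h : E.LensData s σ f F) {y : Vec n ⧸ E.line} (hy : y ∈ E.dirCone) :
    y ∈ interior (closure E.dirCone) := by
  rw [h.eq_interior]; exact hy

theorem pos (h : E.LensData s σ f F) {y : Vec n ⧸ E.line} (hy : y ∈ E.dirCone) : 0 < F y :=
  h.coneFun.pos y (h.mem_interior hy)

theorem smul (h : E.LensData s σ f F) {y : Vec n ⧸ E.line} (hy : y ∈ E.dirCone) {t : ℝ}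
    (ht : 0 < t) : F (t • y) = t * F y :=
  h.coneFun.smul y (h.mem_interior hy) t ht

theorem continuousOn (h : E.LensData s σ f F) : ContinuousOn F E.dirCone := by
  have := h.coneFun.continuousOn
  rwa [h.eq_interior] at this

theorem add_mem (h : E.LensData s σ f F) {y z : Vec n ⧸ E.line} (hy : y ∈ E.dirCone)
    (hz : z ∈ E.dirCone) : y + z ∈ E.dirCone := by
  rw [← h.eq_interior] at hy ⊢
  exact h.isClosedCone.smul_add_mem_interior hy (subset_closure hz)

theorem map (h : E.LensData s σ f F) {g : LinAut n} (hg : g ∈ E.toPEnd.grp) (x : Vec n) :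
    F (E.line.mkQ (g x)) = F (E.line.mkQ x) := by
  obtain ⟨T, hT⟩ := E.exists_quot (h.fix g hg)
  rw [← hT]
  refine h.coneFun.map T (fun y => ?_) (E.abs_det_quot (h.fix g hg) (O.det_eq g hg.1) hT) _
  exact map_mem_closure_iff (fun y => E.quot_mem_dirCone_iff ⟨T, ⟨g, hg, hT⟩, 1, one_pos,
    fun x => (one_smul ℝ _).symm⟩ h.fix y) y

theorem mem_cone_region (h : E.LensData s σ f F) {J : Set ℝ} {x : Vec n} :
    x ∈ cone (E.region s F J) ↔ E.line.mkQ x ∈ E.dirCone ∧ s x / F (E.line.mkQ x) ∈ J := by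
  rw [region, cone_raysOf]
  · rfl
  · rintro ⟨h0, -⟩
    rw [map_zero] at h0
    exact E.zero_notMem_dirCone h0
  · rintro x ⟨hx, hJ⟩ t ht
    refine ⟨?_, ?_⟩
    · rw [map_smul]; exact E.smul_mem_dirCone hx ht
    · rw [map_smul, map_smul, h.smul hx ht, smul_eq_mul, mul_div_mul_left _ _ ht.ne']
      exact hJ

theorem region_mono (h : E.LensData s σ f F) {I J : Set ℝ} (hIJ : I ⊆ J) :
    E.region s F I ⊆ E.region s F J :=
  subset_of_cone_subset fun x hx => by
    rw [h.mem_cone_region] at hx ⊢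
    exact ⟨hx.1, hIJ hx.2⟩

theorem continuousOn_ratio (h : E.LensData s σ f F) :
    ContinuousOn (fun x => s x / F (E.line.mkQ x)) (E.line.mkQ ⁻¹' E.dirCone) :=
  s.continuous.continuousOn.div (h.continuousOn.comp E.continuous_mkQ.continuousOn
    fun _ hx => hx) fun _ hx => (h.pos hx).ne'

theorem isOpen_region (h : E.LensData s σ f F) {J : Set ℝ} (hJ : IsOpen J) :
    IsOpen (E.region s F J) := by
  rw [isOpen_iff_isOpen_cone]
  have h1 : cone (E.region s F J) = E.line.mkQ ⁻¹' E.dirCone ∩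
      (fun x => s x / F (E.line.mkQ x)) ⁻¹' J := by
    ext x; exact h.mem_cone_region
  rw [h1]
  exact h.continuousOn_ratio.isOpen_inter_preimage (E.isOpen_dirCone.preimage E.continuous_mkQ) hJ

theorem ratio_add_vec (h : E.LensData s σ f F) (x : Vec n) (c : ℝ) :
    s (x + c • E.vec) / F (E.line.mkQ (x + c • E.vec)) =
      s x / F (E.line.mkQ x) + c / F (E.line.mkQ x) := by
  rw [map_add, map_add, map_smul, map_smul, E.mkQ_vec, smul_zero, add_zero, h.split.map_vec,
    smul_eq_mul, mul_one, add_div]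

theorem mkQ_add_vec (x : Vec n) (c : ℝ) : E.line.mkQ (x + c • E.vec) = E.line.mkQ x := by
  rw [map_add, map_smul, E.mkQ_vec, smul_zero, add_zero]

/-- On a fibre in the direction of `vec` the ratio s/F is an affine coordinate, so a neighborhood of
a point in the region contains a neighborhood of its ratio in J. -/
theorem interior_region (h : E.LensData s σ f F) (J : Set ℝ) :
    interior (E.region s F J) = E.region s F (interior J) := by
  apply subset_antisymm
  · apply subset_of_cone_subset
    intro x hx
    rw [cone_interior] at hx
    obtain ⟨hx1, hx2⟩ := h.mem_cone_region.1 (interior_subset hx)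
    refine h.mem_cone_region.2 ⟨hx1, ?_⟩
    set a := F (E.line.mkQ x) with ha
    have ha0 : 0 < a := h.pos hx1
    -- restrict to the line through `x` in the direction of the vertex
    set r := s x / a with hr
    have hc : ContinuousAt (fun q : ℝ => x + ((q - r) * a) • E.vec) r := by fun_prop
    have h1 : ∀ᶠ q in 𝓝 r, x + ((q - r) * a) • E.vec ∈ interior (cone (E.region s F J)) :=
      hc.eventually_mem (isOpen_interior.mem_nhds (by simpa using hx))
    refine mem_interior_iff_mem_nhds.2 ?_
    filter_upwards [h1] with q hq
    have h2 := (h.mem_cone_region.1 (interior_subset hq)).2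
    rw [h.ratio_add_vec, mul_div_cancel_right₀ _ ha0.ne'] at h2
    convert h2 using 1
    change q = r + (q - r)
    ring
  · exact interior_maximal (h.region_mono interior_subset) (h.isOpen_region isOpen_interior)

theorem smul_region (h : E.LensData s σ f F) (J : Set ℝ) {g : LinAut n} (hg : g ∈ E.toPEnd.grp) :
    g • E.region s F J = E.region s F J := by
  apply cone_injective
  ext x
  obtain ⟨x, rfl⟩ := g.surjective x
  rw [smul_mem_cone_smul, h.mem_cone_region, h.mem_cone_region, h.map hg, h.split.map_apply g hg,
    E.quot_apply_mem_dirCone h.fix hg]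

theorem superadd (h : E.LensData s σ f F) {x y : Vec n ⧸ E.line} (hx : x ∈ E.dirCone)
    (hy : y ∈ E.dirCone) : F x + F y ≤ F (x + y) :=
  h.coneFun.superadd _ (h.mem_interior hx) _ (h.mem_interior hy)

theorem _root_.convex_cone_of_add {A : Set (ProjSphere n)}
    (hadd : ∀ x ∈ cone A, ∀ y ∈ cone A, x + y ∈ cone A) : Convex ℝ (cone A) := by
  intro x hx y hy a b ha hb hab
  rcases ha.eq_or_lt with rfl | ha
  · rw [zero_add] at hab; subst hab; simpa using hy
  rcases hb.eq_or_lt with rfl | hb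
  · rw [add_zero] at hab; subst hab; simpa using hx
  exact hadd _ (smul_mem_cone hx ha) _ (smul_mem_cone hy hb)

/-- The condition is s ≥ -εF; s is additive and F superadditive. -/
theorem add_mem_cone_region_Ici (h : E.LensData s σ f F) {ε : ℝ} (hε : 0 ≤ ε) {x y : Vec n}
    (hx : x ∈ cone (E.region s F (Ici (-ε)))) (hy : y ∈ cone (E.region s F (Ici (-ε)))) :
    x + y ∈ cone (E.region s F (Ici (-ε))) := by
  rw [h.mem_cone_region] at hx hy ⊢
  obtain ⟨hx1, hx2⟩ := hx
  obtain ⟨hy1, hy2⟩ := hy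
  have hxy := h.add_mem hx1 hy1
  rw [mem_Ici, le_div_iff₀ (h.pos hx1)] at hx2
  rw [mem_Ici, le_div_iff₀ (h.pos hy1)] at hy2
  refine ⟨by rwa [map_add], ?_⟩
  rw [map_add E.line.mkQ, mem_Ici, le_div_iff₀ (h.pos hxy), map_add]
  nlinarith [h.superadd hx1 hy1]

theorem convex_region_Icc (h : E.LensData s σ f F) {ε : ℝ} (hε : 0 ≤ ε) :
    Convex ℝ (cone (E.region s F (Icc (-ε) ε))) := by
  refine convex_cone_of_add fun x hx y hy => ?_
  have h1 := h.add_mem_cone_region_Ici hε (cone_mono (h.region_mono Icc_subset_Ici_self) hx)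
    (cone_mono (h.region_mono Icc_subset_Ici_self) hy)
  rw [h.mem_cone_region] at hx hy h1 ⊢
  obtain ⟨hx1, -, hx2⟩ := hx
  obtain ⟨hy1, -, hy2⟩ := hy
  have hxy := h.add_mem hx1 hy1
  rw [div_le_iff₀ (h.pos hx1)] at hx2
  rw [div_le_iff₀ (h.pos hy1)] at hy2
  refine ⟨h1.1, h1.2, ?_⟩
  rw [map_add E.line.mkQ, div_le_iff₀ (h.pos hxy), map_add]
  nlinarith [h.superadd hx1 hy1]

theorem point_mem_cone_region (h : E.LensData s σ f F) {y : Vec n ⧸ E.line} (hy : y ∈ E.dirCone)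
    {J : Set ℝ} {c : ℝ} (hc : c ∈ J) : σ y + (c * F y) • E.vec ∈ cone (E.region s F J) := by
  rw [h.mem_cone_region, mkQ_add_vec, h.split.mkQ_section, map_add, map_smul, h.split.map_section,
    h.split.map_vec, smul_eq_mul, mul_one, zero_add, mul_div_cancel_right₀ _ (h.pos hy).ne']
  exact ⟨hy, hc⟩

theorem region_nonempty (h : E.LensData s σ f F) {J : Set ℝ} (hJ : J.Nonempty) :
    (E.region s F J).Nonempty := by
  obtain ⟨y, hy⟩ := E.dirCone_nonempty
  obtain ⟨c, hc⟩ := hJ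
  exact ⟨_, (h.point_mem_cone_region hy hc).2⟩

theorem ratio_move (h : E.LensData s σ f F) {x : Vec n} (hx : E.line.mkQ x ∈ E.dirCone) (j : ℝ) :
    s (x + ((j - s x / F (E.line.mkQ x)) * F (E.line.mkQ x)) • E.vec) /
      F (E.line.mkQ (x + ((j - s x / F (E.line.mkQ x)) * F (E.line.mkQ x)) • E.vec)) = j := by
  rw [h.ratio_add_vec, mul_div_cancel_right₀ _ (h.pos hx).ne']
  ring

/-- Going towards the vertex raises the ratio s/F without bound, so the cone over a region is
everything above it. The general J covers both the lens and its top alone. -/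
theorem coneOver_region (h : E.LensData s σ f F) {J : Set ℝ} {a : ℝ} (hJne : J.Nonempty)
    (hJ : J ⊆ Ici a) (hle : ∀ c, a ≤ c → ∃ j ∈ J, j ≤ c) :
    coneOver E.vertex (E.region s F J) = insert E.vertex (E.region s F (Ici a)) := by
  apply subset_antisymm
  · refine iUnion₂_subset fun q hq y hy => ?_
    rcases hy with rfl | rfl | ⟨u, hu, w, hw, hy⟩
    · exact mem_insert _ _
    · exact mem_insert_of_mem _ (h.region_mono hJ hq)
    · refine mem_insert_of_mem _ (mem_of_mem_cone hy ?_)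
      obtain ⟨c, hc, rfl⟩ := (mem_cone_singleton_iff E.vec_mem).1 hu
      obtain ⟨hw1, hw2⟩ := h.mem_cone_region.1 (mem_cone_of_mem hq hw)
      rw [add_comm _ w, h.mem_cone_region, h.ratio_add_vec, mkQ_add_vec]
      have h1 : 0 < c / F (E.line.mkQ w) := div_pos hc (h.pos hw1)
      have h2 : a ≤ s w / F (E.line.mkQ w) := hJ hw2
      exact ⟨hw1, by rw [mem_Ici]; linarith⟩
  · rintro y (rfl | hy)
    · obtain ⟨q, hq⟩ := h.region_nonempty hJne
      exact mem_iUnion₂.2 ⟨q, hq, mem_insert _ _⟩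
    · obtain ⟨x, hx⟩ := exists_mem_cone y
      obtain ⟨hx1, hx2⟩ := h.mem_cone_region.1 (mem_cone_of_mem hy hx)
      obtain ⟨j, hj, hjr⟩ := hle _ hx2
      set r := s x / F (E.line.mkQ x) with hr
      set x' := x + ((j - r) * F (E.line.mkQ x)) • E.vec with hx'
      have hx'J : x' ∈ cone (E.region s F J) := by
        rw [h.mem_cone_region]
        exact ⟨by rwa [hx', mkQ_add_vec], by rw [hx', h.ratio_move hx1]; exact hj⟩
      refine mem_iUnion₂.2 ⟨_, hx'J.2, ?_⟩
      rcases hjr.eq_or_lt with h1 | h1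
      · have h2 : x' = x := by rw [hx', h1, sub_self, zero_mul, zero_smul, add_zero]
        refine mem_insert_of_mem _ (Or.inl ?_)
        have h3 : x ∈ cone {rayOfNeZero ℝ x' hx'J.1} := h2 ▸ cone_singleton_rayOfNeZero hx'J.1
        exact mem_singleton_iff.1 (mem_of_mem_cone hx h3)
      · refine mem_insert_of_mem _ (Or.inr ⟨((r - j) * F (E.line.mkQ x)) • E.vec,
          smul_mem_cone E.vec_mem (mul_pos (sub_pos.2 h1) (h.pos hx1)), x',
          cone_singleton_rayOfNeZero hx'J.1, ?_⟩)
        have h2 : ((r - j) * F (E.line.mkQ x)) • E.vec + x' = x := by rw [hx']; module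
        rw [h2]; exact hx

/-- The points of the regions are moved by the group into the cones over a compact set. -/
theorem exists_compact (h : E.LensData s σ f F) : ∃ K ⊆ E.dirCone, IsCompact K ∧
    ∀ x, E.line.mkQ x ∈ E.dirCone → ∃ g ∈ E.toPEnd.grp, ∃ y ∈ K, ∃ t : ℝ, 0 < t ∧
      x = t • g (σ y + (s x / F (E.line.mkQ x) * F y) • E.vec) := by
  obtain ⟨K, hK, hKc, hco⟩ := (E.isCocompact h.fix).exists_compact
  refine ⟨K, hK, hKc, fun x hx => ?_⟩
  obtain ⟨T, ⟨T', ⟨g, hg, hT'⟩, t, ht, hTx⟩, y, hy, he⟩ := hco _ hx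
  have hmk : E.line.mkQ x = t • E.line.mkQ (g (σ y)) := by
    rw [← hT', h.split.mkQ_section, ← hTx, he]
  have hgy : E.line.mkQ (g (σ y)) ∈ E.dirCone := by
    rw [E.quot_apply_mem_dirCone h.fix hg, h.split.mkQ_section]; exact hK hy
  have hF : F (E.line.mkQ x) = t * F y := by
    rw [hmk, h.smul hgy ht, h.map hg, h.split.mkQ_section]
  have hFy := h.pos (hK hy)
  refine ⟨g, hg, y, hy, t, ht, h.split.ext ?_ ?_⟩
  · rw [map_smul, map_add g, map_smul g, h.fix g hg, mkQ_add_vec, hmk]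
  · rw [map_smul, h.split.map_apply g hg, map_add, map_smul, h.split.map_section, h.split.map_vec,
      hF, smul_eq_mul, smul_eq_mul, mul_one, zero_add]
    field_simp

/-- By invariance it suffices to look over a compact set K of directions. There the section lies in
the interior of the domain with a uniform margin δ, and F is bounded, so ε is δ over the bound.
Points above are reached by adding `vec`. -/
theorem exists_region_subset (h : E.LensData s σ f F) :
    ∃ ε : ℝ, 0 < ε ∧ E.region s F (Ici (-ε)) ⊆ interior O.dom := by
  obtain ⟨K, hK, hKc, hco⟩ := h.exists_compact
  have hsub : σ '' K ⊆ cone (interior O.dom) := by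
    rintro _ ⟨y, hy, rfl⟩; exact h.split.section_mem y (hK hy)
  obtain ⟨δ, hδ, hb⟩ := exists_ball_subset_of_isCompact (hKc.image σ.continuous)
    O.isOpen_cone_interior hsub
  obtain ⟨M, hM⟩ := hKc.exists_bound_of_continuousOn (h.continuousOn.mono hK)
  have hM1 : 0 < |M| + 1 := by positivity
  refine ⟨δ / (|M| + 1), by positivity, subset_of_cone_subset fun x hx => ?_⟩
  obtain ⟨hx1, hx2⟩ := h.mem_cone_region.1 hx
  obtain ⟨g, hg, y, hy, t, ht, he⟩ := hco x hx1
  have hginv : g • interior O.dom = interior O.dom := by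
    rw [← interior_smul, O.invariant g hg.1]
  rw [he]
  refine smul_mem_cone ((apply_mem_cone_of_smul_eq hginv).2 ?_) ht
  set r := s x / F (E.line.mkQ x) with hr
  have hFy := h.pos (hK hy)
  have hFM : F y ≤ |M| + 1 := by
    have := (le_abs_self _).trans ((hM y hy).trans (le_abs_self M))
    linarith
  have h1 : -δ ≤ r * F y := by
    have h2 : δ / (|M| + 1) * F y ≤ δ := by
      rw [div_mul_eq_mul_div, div_le_iff₀ hM1]
      exact mul_le_mul_of_nonneg_left hFM hδ.le
    have h3 : -(δ / (|M| + 1)) ≤ r := hx2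
    nlinarith
  have h2 := E.add_vec_mem_cone_interior (hb _ (mem_image_of_mem σ hy) (-δ • E.vec) (by
    rw [norm_smul, norm_neg, Real.norm_of_nonneg hδ.le, vec, norm_unitVec, mul_one]))
    (c := r * F y + δ) (by linarith)
  convert h2 using 1
  module

/-- The slice {s = -εF} is the saturation of a compact set, hence avoided by some member of the end
sequence. This member is connected, has only directions in `dirCone`, and meets the upper side, so
it lies there entirely. -/
theorem exists_nhd_subset_region (h : E.LensData s σ f F) {ε : ℝ}
    (hsub : E.region s F (Ici (-ε)) ⊆ interior O.dom) :
    ∃ i, E.nhd i ⊆ E.region s F (Ioi (-ε)) := by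
  obtain ⟨K, hK, hKc, hco⟩ := h.exists_compact
  set B : Set (Vec n) := (fun y => σ y + (-ε * F y) • E.vec) '' K with hB
  have hBr : B ⊆ cone (E.region s F {-ε}) := by
    rintro _ ⟨y, hy, rfl⟩
    exact h.point_mem_cone_region (hK hy) rfl
  have hBc : IsCompact B := hKc.image_of_continuousOn (σ.continuous.continuousOn.add
    ((continuousOn_const.mul (h.continuousOn.mono hK)).smul continuousOn_const))
  have hBd : raysOf B ⊆ O.dom := (raysOf_subset hBr).trans
    ((h.region_mono (singleton_subset_iff.2 (mem_Ici.2 le_rfl))).trans (hsub.trans interior_subset))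
  obtain ⟨i, hi⟩ := E.toPEnd.exists_disjoint (isCompact_raysOf hBc fun h0 => (hBr h0).1 rfl) hBd
  refine ⟨i, (E.proper i).isPreconnected.subset_left_of_subset_union
    (h.isOpen_region isOpen_Ioi) (h.isOpen_region (J := Iio (-ε)) isOpen_Iio) ?_ ?_ ?_⟩
  · refine disjoint_left.2 fun p h1 h2 => ?_
    obtain ⟨x, hx⟩ := exists_mem_cone p
    have h3 : -ε < _ := (h.mem_cone_region.1 (mem_cone_of_mem h1 hx)).2
    have h4 : _ < -ε := (h.mem_cone_region.1 (mem_cone_of_mem h2 hx)).2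
    exact lt_asymm h3 h4
  · intro p hp
    obtain ⟨x, hx⟩ := exists_mem_cone p
    have hx1 := h.split.mkQ_mem x (mem_cone_of_mem ((E.proper i).subset_interior hp) hx)
    rcases lt_trichotomy (s x / F (E.line.mkQ x)) (-ε) with h1 | h1 | h1
    · exact Or.inr (mem_of_mem_cone hx (h.mem_cone_region.2 ⟨hx1, h1⟩))
    · exfalso
      obtain ⟨g, hg, y, hy, t, ht, he⟩ := hco x hx1
      rw [h1] at he
      have hyB : σ y + (-ε * F y) • E.vec ∈ B := mem_image_of_mem _ hy
      have hb0 := (hBr hyB).1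
      refine hi g hg.1 (rayOfNeZero ℝ _ hb0) ⟨_, cone_singleton_rayOfNeZero hb0, hyB⟩ ?_
      refine mem_of_mem_cone ((apply_mem_cone_singleton g).2 (cone_singleton_rayOfNeZero hb0)) ?_
      rw [← smul_mem_cone_iff ht, ← he]
      exact mem_cone_of_mem hp hx
    · exact Or.inl (mem_of_mem_cone hx (h.mem_cone_region.2 ⟨hx1, h1⟩))
  · obtain ⟨η, hη, hη1, hηi⟩ := E.exists_nhd_slab i
    obtain ⟨p, hp⟩ := E.exists_mem_slab E.rad_proper.nonempty ⟨hη, hη1⟩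
    obtain ⟨w, hw⟩ := exists_mem_cone p
    have hw' : w ∈ cone (E.prod.slab (Iic η)) := mem_cone_of_mem
      (E.prod.slab_mono (singleton_subset_iff.2 (mem_Iic.2 le_rfl)) hp) hw
    have hwΩ : E.line.mkQ w ∈ E.dirCone :=
      E.mkQ_mem_dirCone (cone_mono (E.prod.slab_subset _) hw')
    -- Raise w far enough towards the vertex for its ratio to be at least 1 - ε; the truncation is
    -- stable under this, so the raised point is still in `nhd i`.
    set c := max 0 ((-ε + 1 - s w / F (E.line.mkQ w)) * F (E.line.mkQ w)) with hc
    have h1 := E.add_mem_cone_slab hw' (c := c) (le_max_left _ _)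
    refine ⟨rayOfNeZero ℝ _ h1.1, hηi h1.2, ?_⟩
    have h2 : w + c • E.vec ∈ cone (E.region s F (Ioi (-ε))) := by
      rw [h.mem_cone_region, h.ratio_add_vec, mkQ_add_vec]
      refine ⟨hwΩ, ?_⟩
      have h3 : -ε + 1 - s w / F (E.line.mkQ w) ≤ c / F (E.line.mkQ w) := by
        rw [le_div_iff₀ (h.pos hwΩ)]; exact le_max_right _ _
      rw [mem_Ioi]; linarith
    exact h2.2

end LensData

end ConvexProjOrbifold.PREnd

/-- An ambient homeomorphism takes the set to the open unit ball, which is homeomorphic to the whole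
space. -/
theorem Convex.nonempty_homeomorph {N : Type*} [NormedAddCommGroup N] [NormedSpace ℝ N]
    [FiniteDimensional ℝ N] {B : Set N} (hB : Convex ℝ B) (ho : IsOpen B) (hne : B.Nonempty)
    (hb : Bornology.IsBounded B) {m : ℕ} (hm : Module.finrank ℝ N = m) :
    Nonempty (B ≃ₜ EuclideanSpace ℝ (Fin m)) := by
  obtain ⟨h, h1, -, -⟩ := exists_homeomorph_image_interior_closure_frontier_eq_unitBall hB
    (by rwa [ho.interior_eq]) hb
  rw [ho.interior_eq] at h1
  have e : N ≃L[ℝ] EuclideanSpace ℝ (Fin m) :=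
    ContinuousLinearEquiv.ofFinrankEq (by rw [hm, finrank_euclideanSpace_fin])
  exact ⟨((h.image B).trans (Homeomorph.setCongr h1)).trans
    (Homeomorph.unitBall.symm.trans e.toHomeomorph)⟩

/-! ### The boundary slices: open cells, smooth and strictly convex. -/

namespace ConvexProjOrbifold.PREnd.LensData

variable {n : ℕ} {O : ConvexProjOrbifold n} {E : O.PREnd}
  {s : Vec n →L[ℝ] ℝ} {σ : (Vec n ⧸ E.line) →L[ℝ] Vec n} {f F : (Vec n ⧸ E.line) → ℝ}

theorem ne_zero_of_mem {y : Vec n ⧸ E.line} (hy : y ∈ E.dirCone) : y ≠ 0 :=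
  fun h0 => E.zero_notMem_dirCone (h0 ▸ hy)

/-- A linear functional that dominates the norm on the directions. -/
theorem exists_norm_le (h : E.LensData s σ f F) : ∃ ψ : (Vec n ⧸ E.line) →L[ℝ] ℝ,
    (∀ y ∈ closure E.dirCone, ‖y‖ ≤ ψ y) ∧ ∀ y ∈ E.dirCone, 0 < ψ y := by
  obtain ⟨ψ, hψ⟩ := h.isClosedCone.exists_norm_le h.pointed
  exact ⟨ψ, hψ, fun y hy => (norm_pos_iff.2 (ne_zero_of_mem hy)).trans_le
    (hψ y (subset_closure hy))⟩

theorem finrank_quot : Module.finrank ℝ (Vec n ⧸ E.line) = n := by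
  have h1 := E.line.finrank_quotient_add_finrank
  rw [E.line_eq, finrank_span_singleton E.vec_ne_zero, finrank_euclideanSpace_fin,
    ← E.line_eq] at h1
  omega

theorem eq_section_add (h : E.LensData s σ f F) {c : ℝ} {x : Vec n}
    (hx : x ∈ cone (E.region s F {c})) :
    x = σ (E.line.mkQ x) + (c * F (E.line.mkQ x)) • E.vec := by
  obtain ⟨h1, h2⟩ := h.mem_cone_region.1 hx
  rw [mem_singleton_iff, div_eq_iff (h.pos h1).ne'] at h2
  rw [← h2]
  exact h.split.eq_add x

/-- The slice {s = cF} is the graph of cF over the directions. Normalising the directions by ψ = 1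
identifies rays with points of an affine section. -/
theorem nonempty_homeomorph_slice (h : E.LensData s σ f F) (c : ℝ)
    {ψ : (Vec n ⧸ E.line) →L[ℝ] ℝ} (hψ : ∀ y ∈ E.dirCone, 0 < ψ y) {y₀ : Vec n ⧸ E.line}
    (hy₀ : ψ y₀ = 1) :
    Nonempty (E.region s F {c} ≃ₜ {u : LinearMap.ker (ψ : (Vec n ⧸ E.line) →ₗ[ℝ] ℝ) |
      y₀ + (u : Vec n ⧸ E.line) ∈ E.dirCone}) := by
  have hU : ∀ p : E.region s F {c}, E.line.mkQ (unitVec (p : ProjSphere n)) ∈ E.dirCone :=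
    fun p => (h.mem_cone_region.1 (mem_cone_of_mem p.2 (unitVec_mem _))).1
  have hF : ∀ u : {u : LinearMap.ker (ψ : (Vec n ⧸ E.line) →ₗ[ℝ] ℝ) |
      y₀ + (u : Vec n ⧸ E.line) ∈ E.dirCone}, ψ (y₀ + (u.1 : Vec n ⧸ E.line)) = 1 := fun u => by
    have h1 : ψ (u.1 : Vec n ⧸ E.line) = 0 := u.1.2
    rw [map_add, hy₀, h1, add_zero]
  refine ⟨{
    toFun := fun p => ⟨⟨(ψ (E.line.mkQ (unitVec (p : ProjSphere n))))⁻¹ •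
      E.line.mkQ (unitVec (p : ProjSphere n)) - y₀, ?_⟩, ?_⟩
    invFun := fun u => ⟨rayOfNeZero ℝ (σ (y₀ + (u.1 : Vec n ⧸ E.line)) +
      (c * F (y₀ + (u.1 : Vec n ⧸ E.line))) • E.vec)
      (h.point_mem_cone_region (J := {c}) u.2 rfl).1,
      (h.point_mem_cone_region (J := {c}) u.2 rfl).2⟩
    left_inv := ?_
    right_inv := ?_
    continuous_toFun := ?_
    continuous_invFun := ?_ }⟩
  · change ψ _ = 0
    rw [map_sub, map_smul, hy₀, smul_eq_mul, inv_mul_cancel₀ (hψ _ (hU p)).ne', sub_self]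
  · change y₀ + (_ - y₀) ∈ E.dirCone
    rw [add_sub_cancel]
    exact E.smul_mem_dirCone (hU p) (inv_pos.2 (hψ _ (hU p)))
  · intro p
    apply Subtype.ext
    have hx := mem_cone_of_mem p.2 (unitVec_mem (p : ProjSphere n))
    set x := unitVec (p : ProjSphere n) with hxdef
    have hpos := inv_pos.2 (hψ _ (hU p))
    have h2 : σ (y₀ + ((ψ (E.line.mkQ x))⁻¹ • E.line.mkQ x - y₀)) +
        (c * F (y₀ + ((ψ (E.line.mkQ x))⁻¹ • E.line.mkQ x - y₀))) • E.vec ∈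
        cone {(p : ProjSphere n)} := by
      rw [add_sub_cancel, h.smul (hU p) hpos, map_smul, mul_left_comm, mul_smul, ← smul_add,
        ← h.eq_section_add hx]
      exact smul_mem_cone (unitVec_mem _) hpos
    exact h2.2
  · intro u
    apply Subtype.ext
    apply Subtype.ext
    change (ψ (E.line.mkQ (unitVec (rayOfNeZero ℝ _ _))))⁻¹ •
      E.line.mkQ (unitVec (rayOfNeZero ℝ _ _)) - y₀ = (u.1 : Vec n ⧸ E.line)
    have hne := (h.point_mem_cone_region (J := {c}) u.2 rfl).1
    rw [unitVec_rayOfNeZero hne, map_smul, mkQ_add_vec, h.split.mkQ_section, map_smul, hF,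
      smul_eq_mul, mul_one, inv_inv, smul_smul, mul_inv_cancel₀ (norm_ne_zero_iff.2 hne),
      one_smul, add_sub_cancel_left]
  · refine Continuous.subtype_mk (Continuous.subtype_mk ?_ _) _
    have h1 : Continuous fun p : E.region s F {c} => E.line.mkQ (unitVec (p : ProjSphere n)) :=
      E.continuous_mkQ.comp (continuous_unitVec.comp continuous_subtype_val)
    exact (((ψ.continuous.comp h1).inv₀ fun p => (hψ _ (hU p)).ne').smul h1).sub
      continuous_const
  · refine Continuous.subtype_mk (continuous_rayOfNeZero.comp (Continuous.subtype_mk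
      (f := fun u : {u : LinearMap.ker (ψ : (Vec n ⧸ E.line) →ₗ[ℝ] ℝ) |
        y₀ + (u : Vec n ⧸ E.line) ∈ E.dirCone} => σ (y₀ + (u.1 : Vec n ⧸ E.line)) +
        (c * F (y₀ + (u.1 : Vec n ⧸ E.line))) • E.vec) ?_
        fun u => (h.point_mem_cone_region (J := {c}) u.2 rfl).1)) _
    have h1 : Continuous fun u : {u : LinearMap.ker (ψ : (Vec n ⧸ E.line) →ₗ[ℝ] ℝ) |
        y₀ + (u : Vec n ⧸ E.line) ∈ E.dirCone} => y₀ + (u.1 : Vec n ⧸ E.line) :=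
      continuous_const.add (continuous_subtype_val.comp continuous_subtype_val)
    exact (σ.continuous.comp h1).add ((continuous_const.mul
      (h.continuousOn.comp_continuous h1 fun u => u.2)).smul continuous_const)

theorem nonempty_homeomorph (h : E.LensData s σ f F) (c : ℝ) :
    Nonempty (E.region s F {c} ≃ₜ EuclideanSpace ℝ (Fin (n - 1))) := by
  obtain ⟨ψ, hψ, hψ0⟩ := h.exists_norm_le
  obtain ⟨y, hy⟩ := E.dirCone_nonempty
  set y₀ := (ψ y)⁻¹ • y with hy₀
  have hy₀Ω : y₀ ∈ E.dirCone := E.smul_mem_dirCone hy (inv_pos.2 (hψ0 y hy))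
  have hy₀1 : ψ y₀ = 1 := by
    rw [hy₀, map_smul, smul_eq_mul, inv_mul_cancel₀ (hψ0 y hy).ne']
  obtain ⟨e₁⟩ := h.nonempty_homeomorph_slice c hψ0 hy₀1
  have hφ : ∀ u : LinearMap.ker (ψ : (Vec n ⧸ E.line) →ₗ[ℝ] ℝ), ψ (u : Vec n ⧸ E.line) = 0 :=
    fun u => u.2
  suffices hB : Nonempty ({u : LinearMap.ker (ψ : (Vec n ⧸ E.line) →ₗ[ℝ] ℝ) |
      y₀ + (u : Vec n ⧸ E.line) ∈ E.dirCone} ≃ₜ EuclideanSpace ℝ (Fin (n - 1))) from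
    hB.map fun e₂ => e₁.trans e₂
  refine Convex.nonempty_homeomorph (N := LinearMap.ker (ψ : (Vec n ⧸ E.line) →ₗ[ℝ] ℝ))
    (B := {u | y₀ + (u : Vec n ⧸ E.line) ∈ E.dirCone}) (m := n - 1) ?_ ?_ ⟨0, ?_⟩ ?_ ?_
  · intro u hu v hv a b ha hb hab
    have h1 : Convex ℝ E.dirCone := by
      rw [← h.eq_interior]; exact h.isClosedCone.convex.interior
    have h2 := h1 hu hv ha hb hab
    rw [smul_add, smul_add, add_add_add_comm, ← add_smul, hab, one_smul] at h2
    exact h2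
  · exact E.isOpen_dirCone.preimage (continuous_const.add continuous_subtype_val)
  · change y₀ + (0 : Vec n ⧸ E.line) ∈ E.dirCone
    rwa [add_zero]
  · refine (Metric.isBounded_closedBall (x := (0 : LinearMap.ker
      (ψ : (Vec n ⧸ E.line) →ₗ[ℝ] ℝ))) (r := 1 + ‖y₀‖)).subset fun u hu => ?_
    rw [mem_closedBall_zero_iff]
    have h1 := hψ _ (subset_closure hu)
    rw [map_add, hφ, add_zero, hy₀1] at h1
    have h2 := norm_sub_le (y₀ + (u : Vec n ⧸ E.line)) y₀
    rw [add_sub_cancel_left] at h2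
    exact h2.trans (by linarith)
  · have h1 := (ψ : (Vec n ⧸ E.line) →ₗ[ℝ] ℝ).finrank_range_add_finrank_ker
    have h2 : LinearMap.range (ψ : (Vec n ⧸ E.line) →ₗ[ℝ] ℝ) = ⊤ := by
      refine LinearMap.range_eq_top.2 (LinearMap.surjective fun h0 => ?_)
      have h3 : ψ y₀ = 0 := by
        change (ψ : (Vec n ⧸ E.line) →ₗ[ℝ] ℝ) y₀ = 0
        rw [h0]; rfl
      rw [hy₀1] at h3
      exact one_ne_zero h3
    rw [h2, finrank_top, Module.finrank_self, finrank_quot] at h1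
    omega

/-- The sign τ selects the boundary component. Where τs > 0, the condition |s| ≤ εF reduces to τs ≤
εF, that is, f ≤ 1 at the rescaled direction (ε/τs) p; both sides are treated at once. -/
theorem smoothStrictlyConvex (h : E.LensData s σ f F) {ε τ : ℝ} (hε : 0 < ε) (hτ : τ = 1 ∨ τ = -1)
    {y : ProjSphere n} (hy : y ∈ E.region s F {τ * ε}) :
    SmoothStrictlyConvexBoundaryAt (E.region s F (Icc (-ε) ε)) y := by
  have hττ : τ * τ = 1 := by rcases hτ with rfl | rfl <;> norm_num
  obtain ⟨v, hv⟩ := exists_mem_cone y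
  obtain ⟨hvΩ, hvr⟩ := h.mem_cone_region.1 (mem_cone_of_mem hy hv)
  rw [mem_singleton_iff] at hvr
  set p : Vec n →L[ℝ] (Vec n ⧸ E.line) := ⟨E.line.mkQ, E.continuous_mkQ⟩ with hp
  have hpx : ∀ x, p x = E.line.mkQ x := fun x => rfl
  set s' : Vec n →L[ℝ] ℝ := τ • s with hs'
  have hsx : ∀ x, s' x = τ * s x := fun x => rfl
  have hFv := h.pos hvΩ
  have hsv : s' v = ε * F (E.line.mkQ v) := by
    rw [div_eq_iff hFv.ne'] at hvr
    rw [hsx, hvr, ← mul_assoc, ← mul_assoc, hττ, one_mul]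
  have hsv0 : 0 < s' v := by rw [hsv]; positivity
  have hint := h.eq_interior
  have hf : ContDiffOn ℝ ∞ f E.dirCone := by
    have := h.coneFun.contDiffOn; rwa [hint] at this
  have hsm : ∀ x ∈ E.dirCone, ∀ t : ℝ, 0 < t → t • x ∈ E.dirCone :=
    fun x hx t ht => E.smul_mem_dirCone hx ht
  have hy₀Ω : (ε / s' v) • p v ∈ E.dirCone := hsm _ hvΩ _ (div_pos hε hsv0)
  have hpv : p v ∈ E.dirCone := hvΩ
  have hder := fun w => fderiv_definingFun E.isOpen_dirCone hf hsm hε hsv0 hpv w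
  -- The direction of the vertex is transverse to the boundary: it changes only the rescaling
  -- factor, and f has nonzero radial derivative.
  have hvec : fderiv ℝ (definingFun p s' ε f) v E.vec ≠ 0 := by
    rw [hder, hpx E.vec, E.mkQ_vec, smul_zero, zero_sub, map_neg, map_smul, hsx, h.split.map_vec]
    have h1 := h.coneFun.fderiv_self_neg _ (h.mem_interior hy₀Ω)
    have h2 : τ ≠ 0 := fun h0 => by rw [h0, zero_mul] at hττ; exact zero_ne_one hττ
    rw [neg_ne_zero, smul_eq_mul, mul_one]
    exact mul_ne_zero (div_ne_zero h2 hsv0.ne') h1.ne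
  refine ⟨v, hv, {x | 0 < s' x ∧ p x ∈ E.dirCone}, definingFun p s' ε f,
    isOpen_definingFun_domain E.isOpen_dirCone, ⟨hsv0, hvΩ⟩, contDiffOn_definingFun hf hsm hε,
    ?_, fun h0 => hvec (by rw [h0]; rfl), ?_, ?_⟩
  · rw [definingFun, sub_eq_zero]
    refine h.coneFun.eq_one _ (h.mem_interior hy₀Ω) ?_
    rw [h.smul hpv (div_pos hε hsv0), hpx, hsv]
    field_simp
  · rintro x ⟨hx1, hx2⟩
    have hFx := h.pos hx2
    have hpos := div_pos hε hx1
    rw [h.mem_cone_region, definingFun, sub_nonpos, ← h.coneFun.one_le_iff _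
      (h.mem_interior (hsm _ hx2 _ hpos)), h.smul hx2 hpos, div_mul_eq_mul_div, le_div_iff₀ hx1,
      one_mul, ← hpx, mem_Icc, ← abs_le, abs_div, abs_of_pos (h.pos hx2), div_le_iff₀ (h.pos hx2)]
    have h1 : |s x| = s' x := by
      have h2 : |s' x| = |s x| := by
        rw [hsx, abs_mul]; rcases hτ with rfl | rfl <;> simp
      rw [← h2, abs_of_pos hx1]
    rw [h1]
    exact ⟨fun h => h.2, fun h => ⟨hx2, h⟩⟩
  · intro w hw hws
    rw [fderiv_fderiv_definingFun E.isOpen_dirCone hf hsm hε hsv0 hpv hw]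
    -- The projected tangent vector vanishes only if w is a multiple of v: its direction and its
    -- s-coordinate both have ratio s' w / s' v to those of v.
    refine h.coneFun.hess_pos _ (h.mem_interior hy₀Ω) _ fun h0 => hws ?_
    rw [Submodule.mem_span_singleton]
    refine ⟨s' w / s' v, h.split.ext ?_ ?_⟩
    · have h1 : (ε / s' v) • (p w - (s' w / s' v) • p v) = 0 := by
        rw [← h0, smul_sub, smul_comm]
      rw [smul_eq_zero, or_iff_right (div_pos hε hsv0).ne', sub_eq_zero] at h1
      rw [map_smul]; exact h1.symm
    · have h1 : s' ((s' w / s' v) • v) = s' w := by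
        rw [map_smul, smul_eq_mul, div_mul_cancel₀ _ hsv0.ne']
      rw [hsx, hsx] at h1
      have h2 : τ ≠ 0 := fun h0 => by rw [h0, zero_mul] at hττ; exact zero_ne_one hττ
      exact mul_left_cancel₀ h2 h1

end ConvexProjOrbifold.PREnd.LensData

/-! ### The lens-cone. -/

namespace ConvexProjOrbifold.PREnd.LensData

variable {n : ℕ} {O : ConvexProjOrbifold n} {E : O.PREnd}
  {s : Vec n →L[ℝ] ℝ} {σ : (Vec n ⧸ E.line) →L[ℝ] Vec n} {f F : (Vec n ⧸ E.line) → ℝ}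

theorem mem_region (h : E.LensData s σ f F) {J : Set ℝ} {p : ProjSphere n} {x : Vec n}
    (hx : x ∈ cone {p}) :
    p ∈ E.region s F J ↔ E.line.mkQ x ∈ E.dirCone ∧ s x / F (E.line.mkQ x) ∈ J := by
  rw [mem_iff_mem_cone hx, h.mem_cone_region]

theorem disjoint_region (h : E.LensData s σ f F) {I J : Set ℝ} (hIJ : Disjoint I J) :
    Disjoint (E.region s F I) (E.region s F J) := by
  refine disjoint_left.2 fun p h1 h2 => ?_
  obtain ⟨x, hx⟩ := exists_mem_cone p
  exact disjoint_left.1 hIJ ((h.mem_region hx).1 h1).2 ((h.mem_region hx).1 h2).2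

theorem isLens (h : E.LensData s σ f F) {ε : ℝ} (hε : 0 < ε) :
    IsLens (E.region s F (Icc (-ε) ε)) (E.region s F {-ε}) (E.region s F {ε}) := by
  obtain ⟨ψ, -, hψ⟩ := h.exists_norm_le
  have hεε : -ε < ε := by linarith
  have hbd : E.region s F {-ε} ∪ E.region s F {ε} =
      E.region s F (Icc (-ε) ε) \ interior (E.region s F (Icc (-ε) ε)) := by
    rw [h.interior_region, interior_Icc]
    ext p
    obtain ⟨x, hx⟩ := exists_mem_cone p
    rw [Set.mem_sdiff, mem_union, h.mem_region hx, h.mem_region hx, h.mem_region hx,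
      h.mem_region hx]
    have h1 : s x / F (E.line.mkQ x) ∈ ({-ε} : Set ℝ) ∨ s x / F (E.line.mkQ x) ∈ ({ε} : Set ℝ) ↔
        s x / F (E.line.mkQ x) ∈ Icc (-ε) ε ∧ s x / F (E.line.mkQ x) ∉ Ioo (-ε) ε := by
      rw [← Set.mem_sdiff, Icc_sdiff_Ioo_same hεε.le]
      simp
    tauto
  refine ⟨⟨h.convex_region_Icc hε.le, (ψ : (Vec n ⧸ E.line) →ₗ[ℝ] ℝ).comp E.line.mkQ,
    fun x hx => hψ _ (h.mem_cone_region.1 hx).1⟩, ?_,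
    h.disjoint_region (disjoint_singleton.2 hεε.ne), hbd, h.nonempty_homeomorph _,
    h.nonempty_homeomorph _, fun y hy => ?_⟩
  · rw [h.interior_region, interior_Icc]
    exact h.region_nonempty (nonempty_Ioo.2 hεε)
  · rw [← hbd] at hy
    rcases hy with hy | hy
    · exact h.smoothStrictlyConvex hε (τ := -1) (Or.inr rfl) (by rwa [neg_one_mul])
    · exact h.smoothStrictlyConvex hε (τ := 1) (Or.inl rfl) (by rwa [one_mul])

theorem mem_cone_insert {A : Set (ProjSphere n)} {x : Vec n} :
    x ∈ cone (insert E.vertex A) ↔ (∃ c : ℝ, 0 < c ∧ x = c • E.vec) ∨ x ∈ cone A := by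
  rw [← mem_cone_singleton_iff E.vec_mem]
  exact ⟨fun ⟨hx, h⟩ => h.imp (fun h => ⟨hx, h⟩) fun h => ⟨hx, h⟩,
    fun h => h.elim (fun ⟨hx, h⟩ => ⟨hx, Or.inl h⟩) fun ⟨hx, h⟩ => ⟨hx, Or.inr h⟩⟩

theorem add_smul_vec_mem (h : E.LensData s σ f F) {a : ℝ} {x : Vec n}
    (hx : x ∈ cone (E.region s F (Ici a))) {c : ℝ} (hc : 0 < c) :
    x + c • E.vec ∈ cone (E.region s F (Ici a)) := by
  rw [h.mem_cone_region] at hx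
  rw [h.mem_cone_region, h.ratio_add_vec, mkQ_add_vec]
  have h1 := div_pos hc (h.pos hx.1)
  have h2 : a ≤ _ := hx.2
  exact ⟨hx.1, by rw [mem_Ici]; linarith⟩

theorem convex_cone_insert (h : E.LensData s σ f F) {ε : ℝ} (hε : 0 < ε) :
    Convex ℝ (cone (insert E.vertex (E.region s F (Ici (-ε))))) := by
  refine convex_cone_of_add fun x hx y hy => ?_
  rw [mem_cone_insert] at hx hy ⊢
  rcases hx with ⟨c, hc, rfl⟩ | hx <;> rcases hy with ⟨d, hd, rfl⟩ | hy
  · exact Or.inl ⟨c + d, add_pos hc hd, (add_smul _ _ _).symm⟩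
  · rw [add_comm _ y]; exact Or.inr (h.add_smul_vec_mem hy hc)
  · exact Or.inr (h.add_smul_vec_mem hx hd)
  · exact Or.inr (h.add_mem_cone_region_Ici hε.le hx hy)

theorem exists_bound (h : E.LensData s σ f F) :
    ∃ M : ℝ, 0 < M ∧ ∀ y ∈ E.dirCone, F y ≤ M * ‖y‖ := by
  have hne := E.dirCone_nonempty
  have h0 := E.zero_notMem_dirCone
  rw [← h.eq_interior] at hne h0
  obtain ⟨M, hM, hb⟩ := h.coneFun.exists_le_norm h.isClosedCone hne h0
  exact ⟨M, hM, fun y hy => hb y (h.mem_interior hy)⟩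

/-- On the lens, s is bounded by a multiple of the norm of the direction. This passes to the closure
and fails at `vec`, where s = 1 and the direction is 0. -/
theorem vertex_notMem_closure (h : E.LensData s σ f F) {ε : ℝ} (hε : 0 < ε) :
    E.vertex ∉ closure (E.region s F (Icc (-ε) ε)) := by
  obtain ⟨M, hM, hb⟩ := h.exists_bound
  intro hcl
  have h1 := mem_cone_of_mem hcl E.vec_mem
  rw [cone_closure] at h1
  have h2 : closure (cone (E.region s F (Icc (-ε) ε))) ⊆ {x | s x ≤ ε * (M * ‖E.line.mkQ x‖)} := by
    refine closure_minimal (fun x hx => ?_) (isClosed_le s.continuous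
      (continuous_const.mul (continuous_const.mul E.continuous_mkQ.norm)))
    obtain ⟨hx1, -, hx2⟩ := h.mem_cone_region.1 hx
    rw [div_le_iff₀ (h.pos hx1)] at hx2
    exact hx2.trans (mul_le_mul_of_nonneg_left (hb _ hx1) hε.le)
  have h3 : s E.vec ≤ ε * (M * ‖E.line.mkQ E.vec‖) := h2 h1.1
  rw [h.split.map_vec, E.mkQ_vec, norm_zero, mul_zero, mul_zero] at h3
  exact absurd h3 (by norm_num)

theorem isProperlyConvexSubset (h : E.LensData s σ f F) {ε : ℝ} (hε : 0 < ε) :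
    IsProperlyConvexSubset (insert E.vertex (E.region s F (Ici (-ε)))) := by
  obtain ⟨M, hM, hb⟩ := h.exists_bound
  obtain ⟨ψ, hψ, -⟩ := h.exists_norm_le
  -- On the closure s ≥ -εM times the norm of the direction, and ψ dominates that norm. The extra 1
  -- gives strict positivity off the line; on the line s itself is positive.
  refine ⟨h.convex_cone_insert hε, (ε * M + 1) • (ψ : (Vec n ⧸ E.line) →ₗ[ℝ] ℝ).comp E.line.mkQ +
    (s : Vec n →ₗ[ℝ] ℝ), fun x hx => ?_⟩
  rw [cone_closure] at hx
  obtain ⟨hx, hx0⟩ := hx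
  have h2 : closure (cone (insert E.vertex (E.region s F (Ici (-ε))))) ⊆
      {x | E.line.mkQ x ∈ closure E.dirCone ∧ -(ε * (M * ‖E.line.mkQ x‖)) ≤ s x} := by
    refine closure_minimal (fun x hx => ?_) ((isClosed_closure.preimage E.continuous_mkQ).inter
      (isClosed_le (continuous_const.mul (continuous_const.mul E.continuous_mkQ.norm)).neg
        s.continuous))
    rcases mem_cone_insert.1 hx with ⟨c, hc, rfl⟩ | hx
    · refine ⟨?_, ?_⟩
      · rw [map_smul, E.mkQ_vec, smul_zero]; exact h.isClosedCone.zero_mem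
      · rw [map_smul, map_smul, E.mkQ_vec, h.split.map_vec, smul_zero, norm_zero, smul_eq_mul]
        linarith
    · obtain ⟨hx1, hx2⟩ := h.mem_cone_region.1 hx
      rw [mem_Ici, le_div_iff₀ (h.pos hx1)] at hx2
      have h3 := mul_le_mul_of_nonneg_left (hb _ hx1) hε.le
      exact ⟨subset_closure hx1, by linarith⟩
  obtain ⟨h3, h4⟩ := h2 hx
  have h5 := hψ _ h3
  change 0 < (ε * M + 1) * ψ (E.line.mkQ x) + s x
  have h6 : (ε * M + 1) * ‖E.line.mkQ x‖ ≤ (ε * M + 1) * ψ (E.line.mkQ x) :=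
    mul_le_mul_of_nonneg_left h5 (by positivity)
  rcases (norm_nonneg (E.line.mkQ x)).eq_or_lt with h7 | h7
  · rw [← h7] at h4 h6
    have h8 : s x ≠ 0 := fun h8 => hx0 (h.split.ext
      (by rw [map_zero]; exact norm_eq_zero.1 h7.symm) (by rw [h8, map_zero]))
    have h9 : 0 ≤ s x := by linarith
    have := h9.lt_of_ne' h8
    linarith
  · linarith

/-- Along the segment the ratio increases strictly from -ε, and it equals ε exactly after adding 2εF
times `vec`. -/
theorem existsUnique_mem_segment (h : E.LensData s σ f F) {ε : ℝ} (hε : 0 < ε) {q : ProjSphere n}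
    (hq : q ∈ E.region s F {-ε}) : ∃! y, y ∈ closedSeg E.vertex q ∧ y ∈ E.region s F {ε} := by
  obtain ⟨w, hw⟩ := exists_mem_cone q
  obtain ⟨hw1, hw2⟩ := (h.mem_region hw).1 hq
  have hFw := h.pos hw1
  have hc : 0 < 2 * ε * F (E.line.mkQ w) := by positivity
  have hw' : w + (2 * ε * F (E.line.mkQ w)) • E.vec ∈ cone (E.region s F {ε}) := by
    rw [h.mem_cone_region, h.ratio_add_vec, mkQ_add_vec, mul_div_cancel_right₀ _ hFw.ne',
      mem_singleton_iff.1 hw2]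
    exact ⟨hw1, by rw [mem_singleton_iff]; ring⟩
  refine ⟨rayOfNeZero ℝ _ hw'.1, ⟨mem_insert_of_mem _ (Or.inr ⟨_, smul_mem_cone E.vec_mem hc, w, hw,
    ?_⟩), hw'.2⟩, ?_⟩
  · rw [add_comm _ w]; exact cone_singleton_rayOfNeZero hw'.1
  · rintro y ⟨rfl | rfl | ⟨u, hu, w', hw', hy⟩, hyε⟩
    · exact absurd ((h.mem_region E.vec_mem).1 hyε).1
        (by rw [E.mkQ_vec]; exact E.zero_notMem_dirCone)
    · have h1 := ((h.mem_region hw).1 hyε).2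
      rw [mem_singleton_iff] at h1 hw2
      linarith
    · obtain ⟨c, hc, rfl⟩ := (mem_cone_singleton_iff E.vec_mem).1 hu
      obtain ⟨d, hd, rfl⟩ := (mem_cone_singleton_iff hw).1 hw'
      have hd0 := smul_mem_cone hy (inv_pos.2 hd)
      have h1 : d⁻¹ • (c • E.vec + d • w) = w + (c / d) • E.vec := by
        rw [smul_add, smul_smul, smul_smul, inv_mul_cancel₀ hd.ne', one_smul, add_comm _ w,
          inv_mul_eq_div]
      rw [h1] at hd0
      have h2 := ((h.mem_region hd0).1 hyε).2
      rw [h.ratio_add_vec, mem_singleton_iff.1 hw2, mem_singleton_iff, neg_add_eq_iff_eq_add,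
        div_eq_iff hFw.ne'] at h2
      have h3 : c / d = 2 * ε * F (E.line.mkQ w) := by rw [h2]; ring
      rw [h3] at hd0
      exact hd0.2.symm

theorem isLensCone (h : E.LensData s σ f F) {ε : ℝ} (hε : 0 < ε) :
    IsLensCone E.vertex (E.region s F (Icc (-ε) ε)) (E.region s F {-ε}) (E.region s F {ε}) ∧
    coneOver E.vertex (E.region s F (Icc (-ε) ε)) =
      insert E.vertex (E.region s F (Ici (-ε))) := by
  have hεε : -ε ≤ ε := by linarith
  have h1 : coneOver E.vertex (E.region s F (Icc (-ε) ε)) =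
      insert E.vertex (E.region s F (Ici (-ε))) :=
    h.coneOver_region (nonempty_Icc.2 hεε) Icc_subset_Ici_self
      fun c hc => ⟨-ε, left_mem_Icc.2 hεε, hc⟩
  have h2 : coneOver E.vertex (E.region s F {-ε}) =
      insert E.vertex (E.region s F (Ici (-ε))) :=
    h.coneOver_region (singleton_nonempty _) (singleton_subset_iff.2 self_mem_Ici)
      fun c hc => ⟨-ε, rfl, hc⟩
  refine ⟨⟨h.isLens hε, h.vertex_notMem_closure hε, ?_, h1.trans h2.symm,
    fun q hq => h.existsUnique_mem_segment hε hq⟩, h1⟩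
  rw [h1]
  exact h.isProperlyConvexSubset hε

/-- The vertex is not interior: near `vec` there are vectors whose direction is opposite to one in
`dirCone`, and the cone of directions is pointed. -/
theorem interior_insert_subset (h : E.LensData s σ f F) (J : Set ℝ) :
    interior (insert E.vertex (E.region s F J)) ⊆ E.region s F J := by
  intro p hp
  refine (interior_subset hp).resolve_left ?_
  rintro rfl
  have h1 := mem_cone_of_mem hp E.vec_mem
  rw [cone_interior] at h1
  obtain ⟨y, hy⟩ := E.dirCone_nonempty
  have hc : ContinuousAt (fun t : ℝ => E.vec - t • σ y) 0 := by fun_prop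
  have h2 : ∀ᶠ t in 𝓝[>] (0 : ℝ), E.vec - t • σ y ∈ cone (insert E.vertex (E.region s F J)) :=
    (hc.eventually_mem (mem_interior_iff_mem_nhds.1 (by simpa using h1))).filter_mono
      nhdsWithin_le_nhds
  obtain ⟨t, ht, ht0⟩ := (h2.and self_mem_nhdsWithin).exists
  have ht0' : 0 < t := ht0
  have h3 : E.line.mkQ (E.vec - t • σ y) = -(t • y) := by
    rw [map_sub, map_smul, E.mkQ_vec, h.split.mkQ_section, zero_sub]
  have hty := E.smul_mem_dirCone hy ht0'
  rcases mem_cone_insert.1 ht with ⟨c, -, hc⟩ | ht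
  · rw [hc, map_smul, E.mkQ_vec, smul_zero, eq_comm, neg_eq_zero] at h3
    exact ne_zero_of_mem hty h3
  · have h4 := (h.mem_cone_region.1 ht).1
    rw [h3] at h4
    exact ne_zero_of_mem hty (h.pointed _ (subset_closure hty) (subset_closure h4))

theorem smul_vertex (h : E.LensData s σ f F) {g : LinAut n} (hg : g ∈ E.toPEnd.grp) :
    g • E.vertex = E.vertex := by
  have h1 := (apply_mem_cone_singleton g).2 E.vec_mem
  rw [h.fix g hg] at h1
  exact h1.2.symm.trans E.vec_mem.2

theorem isLensShaped (h : E.LensData s σ f F) : E.IsLensShaped := by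
  obtain ⟨ε, hε, hsub⟩ := h.exists_region_subset
  obtain ⟨hlens, hcone⟩ := h.isLensCone hε
  obtain ⟨i, hi⟩ := h.exists_nhd_subset_region hsub
  refine ⟨_, _, _, hlens, ?_, ?_, fun g hg => h.smul_region _ hg⟩
  · rw [hcone]
    exact fun p hp => interior_subset (hsub (hp.1.resolve_left hp.2))
  · rw [hcone]
    refine ⟨isOpen_interior, (h.interior_insert_subset _).trans (hsub.trans interior_subset),
      fun g hg => ?_, i, hi.trans ?_⟩
    · rw [← interior_smul, smul_set_insert, h.smul_vertex hg, h.smul_region _ hg]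
    · exact interior_maximal ((h.region_mono Ioi_subset_Ici_self).trans (subset_insert _ _))
        (h.isOpen_region isOpen_Ioi)

end ConvexProjOrbifold.PREnd.LensData

theorem mainTheorem8 {n : ℕ} (hn : 2 ≤ n) (M : ConvexProjOrbifold n) (hM : M.IsStronglyTame)
    (E : M.PREnd) (hE : E.Admissible)
    (hgen :
      Subgroup.closure {g : LinAut n | g ∈ E.toPEnd.grp ∧ IsOfFinOrder g} = E.toPEnd.grp ∨
      Subgroup.closure {g : LinAut n | g ∈ E.toPEnd.grp ∧ ∀ v ∈ cone {E.vertex}, g v = v} =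
        E.toPEnd.grp)
    (D : Set (ProjSphere n)) (hDgeod : IsTotallyGeodesicHyperdomain D)
    (hDconv : IsProperlyConvexSubset D) (hDinv : ∀ g ∈ E.toPEnd.grp, g • D = D)
    (hDnhd : ∃ W, E.toPEnd.IsNhd W ∧ D ⊆ W) (hDvertex : E.vertex ∉ closure D) :
    E.IsLensShaped := by
  have hfix : ∀ g ∈ E.toPEnd.grp, g E.vec = E.vec := fun g hg => E.apply_vec hgen hg
  have hDd : D ⊆ interior M.dom := by
    obtain ⟨W, ⟨hWo, hWd, -⟩, hDW⟩ := hDnhd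
    exact hDW.trans (interior_maximal hWd hWo)
  obtain ⟨s, σ, hsplit⟩ := E.exists_isSplitting hn hE hfix hDgeod.2 hDconv.1 hDinv hDd hDvertex
  have hU : Module.finrank ℝ (Vec n ⧸ E.line) = n :=
    ConvexProjOrbifold.PREnd.LensData.finrank_quot
  have : Nontrivial (Vec n ⧸ E.line) := Module.nontrivial_of_finrank_pos (R := ℝ) (by omega)
  have hQ := hE.isClosedCone hfix
  have hp := hE.pointed hfix
  obtain ⟨f, F, hF⟩ := hQ.exists_coneFunction hp
  exact ConvexProjOrbifold.PREnd.LensData.isLensShaped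
    ⟨hfix, hsplit, hQ, hp, (hE.eq_interior hfix).symm, hF⟩
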